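/- Let $(E,d)$ be a complete separable metric space and let $\varphi$ be a weakly complete local white noise random dynamical system on $E$, in the following sense. $(\Omega,\mathcal F,\mathbb P)$ is a probability space (not necessarily complete) with a jointly measurable group $(\theta_t)_{t\in\mathbb R}$ of maps for which $\mathbb P$ is invariant and ergodic. Put $\bar E=E\cup\{\partial\}$ with an absorbing state $\partial$. The map $\varphi:\mathbb R_+\times\Omega\times\bar E\to\bar E$ is measurable, $\varphi_0(\omega,\cdot)=\mathrm{id}$, and $\varphi_{t+s}(\omega,x)=\varphi_t(\theta_s\omega,\varphi_s(\omega,x))$ for all $s,t,\omega,x$; for every $\omega$ the set $D(\omega)=\{(t,x)\in\mathbb R_+\times E:\varphi_t(\omega,x)\in E\}$ is open, $(t,x)\in D(\omega)$ and $0\le s\le t$ imply $(s,x)\in D(\omega)$, and $\varphi_t(\omega,\cdot)$ is continuous at each $x\in E$ with $\varphi_t(\omega,x)\in E$. There are $\sigma$-algebras $\mathcal F_{s,t}\subseteq\mathcal F$ ($s\le t$) with $\mathcal F_{t,u}\subseteq\mathcal F_{s,v}$ for $s\le t\le u\le v$, $\theta_r^{-1}\mathcal F_{s,t}=\mathcal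 F_{s+r,t+r}$, $\mathcal F_{s,t}$ and $\mathcal F_{u,v}$ independent for $s\le t\le u\le v$, and $\varphi_s(\cdot,x)$ is $\mathcal F_{0,s}$-measurable for all $s\ge0$, $x\in E$; $\mathcal F_0$ is the $\sigma$-algebra generated by all $\mathcal F_{s,0}$, $s\le 0$. Weakly complete means $\varphi_t(\cdot,x)\in E$ $\mathbb P$-a.s. for all $t\ge0$, $x\in E$. Let $\rho$ be an ergodic invariant probability measure of the Markov semigroup $P_tf(x)=\mathbb E f(\varphi_t(\cdot,x))$ (functions on $E$ being extended by $0$ at $\partial$), and let $E_0$ be the set of all $x\in E$ such that the law of $\varphi_t(\cdot,x)$ converges weakly to $\rho$ as $t\to\infty$; $\varphi$ is strongly mixing if $E_0=E$. The statistical equilibrium of $\rho$ is an $\mathcal F_0$-measurable random probability measure $\omega\mapsto\mu_\omega$ on $E$ such that for every sequence $t_k\to\infty$, $\mathbb P$-a.s., $\varphi_{t_k}(\theta_{-t_k}\omega)\rho\to\mu_\omega$ weakly. A weak point attractor of a set $S\subseteq E$ is a family $A(\omega)$, $\omega\in\Omega$, of non-empty subsets of $E$, a.s. compact, with $\omega\mapsto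 d(x,A(\omega))$ $\mathcal F$-measurable for all $x\in E$, such that for every $t\ge0$ one has $\varphi_t(\omega,A(\omega))=A(\theta_t\omega)$ a.s., and such that $d(\varphi_t(\theta_{-t}\omega,x),A(\omega))\to0$ in probability as $t\to\infty$ for every $x\in S$. A weak point attractor is a weak point attractor of $E$; it is minimal if it is a.s. contained in each weak point attractor. For a non-empty open $U\subseteq E$, $\varphi$ is weakly asymptotically stable on $U$ if there are a deterministic sequence $t_n\uparrow\infty$ and $\mathcal M\in\mathcal F$ with $\mathbb P(\mathcal M)>0$ such that $1_{\mathcal M}\,d(\varphi_{t_n}(\cdot,x),\varphi_{t_n}(\cdot,y))\to0$ in probability for all $x,y\in U$. Then a statistical equilibrium $\mu_\omega$ of $\rho$ exists. Moreover, for every such $\mu_\omega$, put $A(\omega)=\operatorname{supp}(\mu_\omega)$ and suppose that trajectories started in $A$ do not explode, i.e. for every $t\ge0$, $\mathbb P$-a.s., $\varphi_t(\omega,x)\in E$ for all $x\in A(\omega)$ (this holds automatically if $\varphi$ is global, i.e. never takes the value $\partial$ on $E$). Then: 1. If $A(\omega)$ is a.s. compact, then $A$ is a weak point attractor of $E_0$.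 If, in addition, $\varphi$ is strongly mixing, then $A$ is a minimal weak point attractor. 2. If $\varphi$ is strongly mixing and weakly asymptotically stable on a non-empty open set $U$ with $\rho(U)>0$, then there are $N\in\mathbb N$, $N\ge1$, and $\mathcal F_0$-measurable random variables $a_1,\dots,a_N:\Omega\to E$ such that $A(\omega)=\{a_1(\omega),\dots,a_N(\omega)\}$ a.s., and $A$ is a minimal weak point attractor. -/

import Mathlib

open MeasureTheory ProbabilityTheory Filter Topology Set
open scoped NNReal ENNReal BoundedContinuousFunction

noncomputable section

/-- An ergodic metric dynamical system: a jointly measurable group of maps `θ t`, `t : ℝ`, on a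
probability space that preserves the probability measure `P` and is ergodic for it. -/
structure ErgodicMDS (Ω : Type*) [MeasurableSpace Ω] (P : Measure Ω) where
  θ : ℝ → Ω → Ω
  measurable_θ : Measurable fun p : ℝ × Ω => θ p.1 p.2
  θ_zero : ∀ ω, θ 0 ω = ω
  θ_add : ∀ s t ω, θ (s + t) ω = θ s (θ t ω)
  measurePreserving_θ : ∀ t, MeasurePreserving (θ t) P P
  ergodic_θ : ∀ B : Set Ω, MeasurableSet B → (∀ t, θ t ⁻¹' B = B) → P B = 0 ∨ P B = 1

/-- A local random dynamical system with state space `E`. The extended state space `E ∪ {∂}` is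
`Option E`, with `∂ = none`. Since `∂` is absorbing, the cocycle is determined by its values on
`E`, and its extension to `Option E` is `z ↦ z.bind (φ t ω)`. -/
structure LocalRDS (Ω : Type*) [MeasurableSpace Ω] (P : Measure Ω)
    (E : Type*) [MetricSpace E] [MeasurableSpace E] extends ErgodicMDS Ω P where
  φ : ℝ≥0 → Ω → E → Option E
  /-- Joint measurability, where `E` is a measurable subset of `E ∪ {∂}`. -/
  measurable_φ : ∀ B : Set E, MeasurableSet B →
    MeasurableSet {p : ℝ≥0 × Ω × E | φ p.1 p.2.1 p.2.2 ∈ some '' B}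
  φ_zero : ∀ ω x, φ 0 ω x = some x
  /-- The perfect cocycle property `φ_{t+s}(ω, x) = φ_t(θ_s ω, φ_s(ω, x))`. -/
  φ_add : ∀ (t s : ℝ≥0) ω x, φ (t + s) ω x = (φ s ω x).bind (φ t (θ s ω))
  isOpen_domain : ∀ ω, IsOpen {p : ℝ≥0 × E | φ p.1 ω p.2 ≠ none}
  domain_mono : ∀ ω x (s t : ℝ≥0), s ≤ t → φ t ω x ≠ none → φ s ω x ≠ none
  /-- `φ_t(ω, ·)` is continuous at every `x₀` with `φ_t(ω, x₀) ∈ E`; neighbourhoods of a point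
  of `E` in `E ∪ {∂}` are generated by its neighbourhoods in `E`. -/
  continuousAt_φ : ∀ t ω x₀ y₀, φ t ω x₀ = some y₀ →
    Tendsto (φ t ω) (𝓝 x₀) (map some (𝓝 y₀))

/-- A local white noise (filtered) random dynamical system. The `σ`-algebra `F s t` is
only relevant for `s ≤ t`. -/
structure WhiteNoiseLocalRDS (Ω : Type*) [MeasurableSpace Ω] (P : Measure Ω)
    (E : Type*) [MetricSpace E] [MeasurableSpace E] extends LocalRDS Ω P E where
  F : ℝ → ℝ → MeasurableSpace Ω
  F_le : ∀ s t, s ≤ t → F s t ≤ ‹MeasurableSpace Ω›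
  F_mono : ∀ s t u v, s ≤ t → t ≤ u → u ≤ v → F t u ≤ F s v
  /-- `θ_r⁻¹(F_{s,t}) = F_{s+r,t+r}`. -/
  F_shift : ∀ r s t, s ≤ t → (F s t).comap (θ r) = F (s + r) (t + r)
  F_indep : ∀ s t u v, s ≤ t → t ≤ u → u ≤ v → Indep (F s t) (F u v) P
  /-- `φ_s(·, x)`, as a map into `E ∪ {∂}`, is `F_{0,s}`-measurable. -/
  F_adapted : ∀ (s : ℝ≥0) (x : E) (B : Set E), MeasurableSet B →
    MeasurableSet[F 0 s] {ω | φ s ω x ∈ some '' B}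

/-- The extension of a function on `E` to `E ∪ {∂}` by the value `0` at `∂`. -/
def extZero {E : Type*} (f : E → ℝ) (z : Option E) : ℝ := z.elim 0 f

/-- The distance on `E ∪ {∂}` which is infinite if one of the points is `∂`. -/
def extEDist {E : Type*} [MetricSpace E] : Option E → Option E → ℝ≥0∞
  | some x, some y => edist x y
  | _, _ => ⊤

/-- The distance of a point of `E ∪ {∂}` to a subset of `E`, infinite at `∂`. -/
def extInfEDist {E : Type*} [MetricSpace E] (z : Option E) (A : Set E) : ℝ≥0∞ :=
  z.elim ⊤ fun x => Metric.infEDist x A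

/-- A random compact set: a family of non-empty sets, almost surely compact, such that
`ω ↦ d(x, A ω)` is measurable for each `x`. -/
structure IsRandomCompact {Ω : Type*} [MeasurableSpace Ω] (P : Measure Ω)
    {E : Type*} [MetricSpace E] (A : Ω → Set E) : Prop where
  nonempty : ∀ ω, (A ω).Nonempty
  compact : ∀ᵐ ω ∂P, IsCompact (A ω)
  measurable_infDist : ∀ x : E, Measurable fun ω => Metric.infDist x (A ω)

namespace WhiteNoiseLocalRDS

variable {Ω : Type*} [MeasurableSpace Ω] {P : Measure Ω}
  {E : Type*} [MetricSpace E] [MeasurableSpace E]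

/-- The past `F_t`, the smallest `σ`-algebra containing all `F s t` with `s ≤ t`. -/
abbrev past (R : WhiteNoiseLocalRDS Ω P E) (t : ℝ) : MeasurableSpace Ω :=
  ⨆ (s : ℝ) (_ : s ≤ t), R.F s t

/-- For all `t ≥ 0` and `x ∈ E`, almost surely `φ_t(·, x) ∈ E`. -/
def WeaklyComplete (R : WhiteNoiseLocalRDS Ω P E) : Prop :=
  ∀ (t : ℝ≥0) (x : E), ∀ᵐ ω ∂P, R.φ t ω x ≠ none

/-- The Markovian semigroup `P_t f(x) = 𝔼 f(φ_t(·, x))`. -/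
def semigroup (R : WhiteNoiseLocalRDS Ω P E) (t : ℝ≥0) (f : E → ℝ) (x : E) : ℝ :=
  ∫ ω, extZero f (R.φ t ω x) ∂P

/-- `ρ` is invariant for the Markovian semigroup. -/
def IsInvariantMeasure (R : WhiteNoiseLocalRDS Ω P E) (ρ : Measure E) : Prop :=
  ∀ (t : ℝ≥0) (f : E → ℝ), Measurable f → (∃ C, ∀ x, |f x| ≤ C) →
    ∫ x, R.semigroup t f x ∂ρ = ∫ x, f x ∂ρ

/-- `ρ` is an ergodic invariant measure for the Markovian semigroup. -/
def IsErgodicMeasure (R : WhiteNoiseLocalRDS Ω P E) (ρ : Measure E) : Prop :=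
  R.IsInvariantMeasure ρ ∧
    ∀ B : Set E, MeasurableSet B →
      (∀ t, R.semigroup t (B.indicator fun _ => 1) =ᵐ[ρ] B.indicator fun _ => 1) →
      ρ B = 0 ∨ ρ B = 1

/-- The set `E_0` of all points whose transition probabilities converge weakly to `ρ`. -/
def convergenceSet (R : WhiteNoiseLocalRDS Ω P E) (ρ : Measure E) : Set E :=
  {x | ∀ f : E →ᵇ ℝ, Tendsto (fun t => R.semigroup t f x) atTop (𝓝 (∫ y, f y ∂ρ))}

/-- Strong mixing: the law of `φ_t(·, x)` converges weakly to `ρ` for every `x ∈ E`. -/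
def StronglyMixing (R : WhiteNoiseLocalRDS Ω P E) (ρ : Measure E) : Prop :=
  ∀ x, x ∈ R.convergenceSet ρ

/-- `μ` is (an `F_0`-measurable version of) the statistical equilibrium of `ρ`: for every sequence
`t_k → ∞`, almost surely, `φ_{t_k}(θ_{-t_k} ω) ρ` converges weakly to `μ ω`. -/
structure IsStatisticalEquilibrium (R : WhiteNoiseLocalRDS Ω P E) (ρ : Measure E)
    (μ : Ω → Measure E) : Prop where
  isProbabilityMeasure : ∀ ω, IsProbabilityMeasure (μ ω)
  measurable : Measurable[R.past 0] μ
  tendsto : ∀ t : ℕ → ℝ≥0, Tendsto t atTop atTop → ∀ᵐ ω ∂P, ∀ f : E →ᵇ ℝ,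
    Tendsto (fun k => ∫ x, extZero f (R.φ (t k) (R.θ (-(t k : ℝ)) ω) x) ∂ρ) atTop
      (𝓝 (∫ x, f x ∂(μ ω)))

/-- `φ`-invariance of a family of sets: for all `t ≥ 0`, almost surely,
`φ_t(ω, A ω) = A (θ_t ω)` as subsets of `E ∪ {∂}`. -/
def IsInvariantSet (R : WhiteNoiseLocalRDS Ω P E) (A : Ω → Set E) : Prop :=
  ∀ t : ℝ≥0, ∀ᵐ ω ∂P, R.φ t ω '' A ω = some '' A (R.θ t ω)

/-- `A` is a weak point attractor of the set `S ⊆ E`: an invariant random compact set such that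
`d(φ_t(θ_{-t} ω, x), A ω) → 0` in probability as `t → ∞`, for each `x ∈ S`. -/
structure IsWeakPointAttractorOf (R : WhiteNoiseLocalRDS Ω P E) (S : Set E)
    (A : Ω → Set E) : Prop where
  isRandomCompact : IsRandomCompact P A
  isInvariantSet : R.IsInvariantSet A
  attracts : ∀ x ∈ S, ∀ ε : ℝ≥0∞, 0 < ε →
    Tendsto (fun t : ℝ≥0 => P {ω | ε ≤ extInfEDist (R.φ t (R.θ (-(t : ℝ)) ω) x) (A ω)}) atTop
      (𝓝 0)

/-- A weak point attractor attracts all points of `E`. -/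
def IsWeakPointAttractor (R : WhiteNoiseLocalRDS Ω P E) (A : Ω → Set E) : Prop :=
  R.IsWeakPointAttractorOf univ A

/-- A weak point attractor that is almost surely contained in each weak point attractor. -/
def IsMinimalWeakPointAttractor (R : WhiteNoiseLocalRDS Ω P E) (A : Ω → Set E) : Prop :=
  R.IsWeakPointAttractor A ∧
    ∀ A' : Ω → Set E, R.IsWeakPointAttractor A' → ∀ᵐ ω ∂P, A ω ⊆ A' ω

/-- `φ` is weakly asymptotically stable on `U`: there are `t_n ↑ ∞` and a set `M` of positive
probability such that `1_M d(φ_{t_n}(·, x), φ_{t_n}(·, y)) → 0` in probability for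
all `x, y ∈ U`. -/
def WeaklyAsymptoticallyStableOn (R : WhiteNoiseLocalRDS Ω P E) (U : Set E) : Prop :=
  IsOpen U ∧ U.Nonempty ∧
    ∃ (t : ℕ → ℝ≥0) (M : Set Ω), Monotone t ∧ Tendsto t atTop atTop ∧ MeasurableSet M ∧
      0 < P M ∧ ∀ x ∈ U, ∀ y ∈ U, ∀ ε : ℝ≥0∞, 0 < ε →
        Tendsto (fun n => P {ω | ω ∈ M ∧ ε ≤ extEDist (R.φ (t n) ω x) (R.φ (t n) ω y)}) atTop
          (𝓝 0)

end WhiteNoiseLocalRDS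

end

/-!
The proof follows the mass of `ρ` under the pullback flow `x ↦ φ_t(θ_{-t} ω, x)`.

*Existence.* The image measures `φ_t(θ_{-t} ω) ρ` form a measure-valued martingale for the
filtration `F (-t) 0`, since the noise before `-t` is independent of the noise after `-t` and `ρ` is
invariant. Bounded martingales converge, first along increasing sequences of times; an arbitrary
sequence `t_k → ∞` is merged with the integers and listed in increasing order
(`exists_monotone_enumeration`). The limits on the individual measurable sets come from a random
probability measure because the mean is constantly `ρ` (`exists_random_setwise_limit`).

*Attraction.* For `x` in the convergence set, conditioning on the noise in `[-t, 0]` and using the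
martingale gives stable convergence: jointly with every functional of the past, the law of
`φ_s(θ_{-s} ω, x)` converges to that of a point sampled from `μ ω`
(`IsStatisticalEquilibrium.tendsto_integral_mul_pullback`). In particular the pullback flow avoids
the balls of `μ ω`-measure zero, and it is attracted by the support of `μ ω`. Passing to the limit
in the cocycle property, `φ_t(ω)` maps `μ ω` to `μ (θ_t ω)`, and therefore the support to the
support when it is compact. A weak point attractor attracts `ρ` too, so it carries `μ ω`; hence the
support is minimal.

*Finiteness.* Strong mixing determines all random measures of the past that are transported by the
flow: `φ_s(θ_{-s} ω)` is independent of the remote past `ν (θ_{-s} ω)` of such a measure `ν`, so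
that stable convergence forces `ν` to be a constant multiple of `μ`
(`IsStatisticalEquilibrium.eq_smul_of_map_flow_eq`). Weak asymptotic stability makes two independent
points with law `μ ω` coincide with positive mean probability. This coincidence probability cannot
decrease under the flow and has a stationary mean, so the flow does not merge atoms, and it
transports the part of `μ` carried by the atoms of mass at least `1 / k`. For some `k` this part
does not vanish. Being a multiple of `μ`, it is all of `μ`, which therefore has at most `k` atoms
and no other mass. Quantiles under a Borel embedding of `E` into the line enumerate the atoms measurably
(`heavyAtoms_eq_range_quantile`).

The cemetery state is handled by `WhiteNoiseLocalRDS.flow`, which replaces it by an arbitrary base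
point `x₀`; by weak completeness this changes `φ_t(·, x)`, for fixed `t` and `x`, on a null set only.
-/

noncomputable section

/-! ### Freezing an independent random measure -/

theorem integral_comp_simpleFunc {α β : Type*} [MeasurableSpace α] (s : SimpleFunc α β)
    (h : β → ℝ) (κ : Measure α) [IsFiniteMeasure κ] :
    ∫ y, h (s y) ∂κ = ∑ v ∈ s.range, κ.real (s ⁻¹' {v}) * h v := by
  classical
  have h1 : ∀ y, h (s y) = ∑ v ∈ s.range, (s ⁻¹' {v}).indicator (fun _ => h v) y := by
    intro y
    rw [Finset.sum_eq_single (s y)]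
    · simp
    · intro v _ hv
      exact indicator_of_notMem (fun hy => hv (by simpa using Eq.symm hy)) _
    · intro hy
      exact absurd (s.mem_range_self y) hy
  simp_rw [h1]
  rw [integral_finsetSum]
  · refine Finset.sum_congr rfl fun v _ => ?_
    rw [integral_indicator_const _ (s.measurableSet_fiber v), smul_eq_mul]
  · intro v _
    exact (integrable_const (h v)).indicator (s.measurableSet_fiber v)

theorem exists_simpleFunc_tendsto_id (E : Type*) [MetricSpace E] [SecondCountableTopology E]
    [MeasurableSpace E] [BorelSpace E] [Nonempty E] :
    ∃ s : ℕ → SimpleFunc E E, ∀ y, Tendsto (fun n => s n y) atTop (𝓝 y) := by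
  obtain ⟨x₀⟩ := ‹Nonempty E›
  refine ⟨fun n => SimpleFunc.approxOn id measurable_id univ x₀ (mem_univ _) n, fun y => ?_⟩
  exact SimpleFunc.tendsto_approxOn measurable_id (mem_univ _) (by simp)

/-- If the pair `(W, Ψ)` is independent of the random measure `κ`, then in the expectation of
`W ∫ f(Ψ y) κ(dy)` the measure `κ` may be replaced by its mean. As `Ψ` is only measurable for
fixed `y`, the initial point is discretised; continuity of `Ω`-almost every `Ψ` at almost every
initial point removes the discretisation. -/
theorem integral_mul_integral_of_indep {Ω : Type*} {m₁ m₂ m₀ : MeasurableSpace Ω} {P : Measure Ω}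
    [IsProbabilityMeasure P]
    {E : Type*} [MetricSpace E] [SecondCountableTopology E] [MeasurableSpace E] [BorelSpace E]
    (hm₁ : m₁ ≤ m₀) (hm₂ : m₂ ≤ m₀) (hind : Indep m₁ m₂ P)
    {W : Ω → ℝ} (hW : Measurable[m₁] W) {C : ℝ} (hWC : ∀ ω, |W ω| ≤ C)
    {Ψ : Ω → E → E} (hΨ : Measurable (Function.uncurry Ψ))
    (hΨ₁ : ∀ y, Measurable[m₁] fun ω => Ψ ω y)
    {κ : Ω → Measure E} (hκ : Measurable[m₂] κ) (hκ₁ : ∀ ω, κ ω univ ≤ 1)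
    (hc₁ : ∀ᵐ ω ∂P, ∀ᵐ y ∂κ ω, ContinuousAt (Ψ ω) y)
    (hc₂ : ∀ᵐ y ∂P.bind κ, ∀ᵐ ω ∂P, ContinuousAt (Ψ ω) y) (f : E →ᵇ ℝ) :
    ∫ ω, W ω * ∫ y, f (Ψ ω y) ∂κ ω ∂P = ∫ y, ∫ ω, W ω * f (Ψ ω y) ∂P ∂P.bind κ := by
  rcases isEmpty_or_nonempty E with hE | hE
  · have : ∀ κ' : Measure E, κ' = 0 := fun κ' => Measure.eq_zero_of_isEmpty κ'
    simp [this (P.bind κ), this (κ _)]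
  have hκf : ∀ ω, IsFiniteMeasure (κ ω) := fun ω => ⟨(hκ₁ ω).trans_lt ENNReal.one_lt_top⟩
  have hκ0 : Measurable κ := hκ.mono hm₂ le_rfl
  have hW0 : Measurable W := hW.mono hm₁ le_rfl
  have hbapp : ∀ B, MeasurableSet B → (P.bind κ) B = ∫⁻ ω, κ ω B ∂P := fun B hB =>
    Measure.bind_apply hB hκ0.aemeasurable
  have hκb : IsFiniteMeasure (P.bind κ) := ⟨by
    rw [hbapp _ MeasurableSet.univ]
    calc ∫⁻ ω, κ ω univ ∂P ≤ ∫⁻ _, 1 ∂P := lintegral_mono hκ₁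
      _ < ⊤ := by simp⟩
  have hreal : ∀ B, MeasurableSet B → (P.bind κ).real B = ∫ ω, (κ ω).real B ∂P := by
    intro B hB
    rw [integral_eq_lintegral_of_nonneg_ae (Eventually.of_forall fun _ => measureReal_nonneg)]
    · simp only [Measure.real]
      rw [hbapp B hB]
      congr 1
      refine lintegral_congr fun ω => ?_
      rw [ENNReal.ofReal_toReal (measure_ne_top _ _)]
    · exact ((Measure.measurable_coe hB).comp hκ0).ennreal_toReal.aestronglyMeasurable
  obtain ⟨s, hs⟩ := exists_simpleFunc_tendsto_id E
  have hfb : ∀ z, |f z| ≤ ‖f‖ := fun z => f.norm_coe_le_norm z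
  have hC : 0 ≤ C := by
    obtain ⟨ω⟩ : Nonempty Ω := nonempty_of_isProbabilityMeasure P
    exact (abs_nonneg _).trans (hWC ω)
  have hfm : ∀ y, Measurable[m₁] fun ω => W ω * f (Ψ ω y) := fun y =>
    hW.mul (f.continuous.measurable.comp (hΨ₁ y))
  have hsum : ∀ n ω, W ω * ∫ y, f (Ψ ω (s n y)) ∂κ ω
      = ∑ v ∈ (s n).range, (W ω * f (Ψ ω v)) * (κ ω).real (s n ⁻¹' {v}) := by
    intro n ω
    rw [integral_comp_simpleFunc (s n) (fun v => f (Ψ ω v)), Finset.mul_sum]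
    exact Finset.sum_congr rfl fun v _ => by ring
  -- The identity for the discretised initial point.
  have key : ∀ n, ∫ ω, W ω * ∫ y, f (Ψ ω (s n y)) ∂κ ω ∂P
      = ∫ y, ∫ ω, W ω * f (Ψ ω (s n y)) ∂P ∂P.bind κ := by
    intro n
    have hκm : ∀ v, Measurable[m₂] fun ω => (κ ω).real (s n ⁻¹' {v}) := fun v =>
      ((Measure.measurable_coe ((s n).measurableSet_fiber v)).comp hκ).ennreal_toReal
    have hi : ∀ v, IndepFun (fun ω => W ω * f (Ψ ω v)) (fun ω => (κ ω).real (s n ⁻¹' {v})) P :=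
      fun v => indep_of_indep_of_le_left (indep_of_indep_of_le_right hind (hκm v).comap_le)
        (hfm v).comap_le
    have hI1 : ∀ v, Integrable (fun ω => W ω * f (Ψ ω v)) P := fun v =>
      Integrable.of_bound ((hfm v).mono hm₁ le_rfl).aestronglyMeasurable (C * ‖f‖)
        (Eventually.of_forall fun ω => by
          rw [Real.norm_eq_abs, abs_mul]
          exact mul_le_mul (hWC ω) (hfb _) (abs_nonneg _) hC)
    have hI2 : ∀ v, Integrable (fun ω => (κ ω).real (s n ⁻¹' {v})) P := fun v =>
      Integrable.of_bound ((hκm v).mono hm₂ le_rfl).aestronglyMeasurable 1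
        (Eventually.of_forall fun ω => by
          rw [Real.norm_eq_abs, abs_of_nonneg measureReal_nonneg]
          exact ENNReal.toReal_le_of_le_ofReal zero_le_one
            (by simpa using (measure_mono (subset_univ _)).trans (hκ₁ ω)))
    simp_rw [hsum]
    rw [integral_comp_simpleFunc (s n) (fun v => ∫ ω, W ω * f (Ψ ω v) ∂P), integral_finsetSum]
    · refine Finset.sum_congr rfl fun v _ => ?_
      rw [(hi v).integral_fun_mul_eq_mul_integral (hI1 v).aestronglyMeasurable
        (hI2 v).aestronglyMeasurable, hreal _ ((s n).measurableSet_fiber v), mul_comm]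
    · intro v _
      exact (hi v).integrable_mul (hI1 v) (hI2 v)
  have hmeasL : ∀ n, Measurable fun ω => W ω * ∫ y, f (Ψ ω (s n y)) ∂κ ω := by
    intro n
    simp_rw [hsum]
    exact Finset.measurable_sum _ fun v _ => ((hfm v).mono hm₁ le_rfl).mul
      ((Measure.measurable_coe ((s n).measurableSet_fiber v)).comp hκ0).ennreal_toReal
  have limL : Tendsto (fun n => ∫ ω, W ω * ∫ y, f (Ψ ω (s n y)) ∂κ ω ∂P) atTop
      (𝓝 (∫ ω, W ω * ∫ y, f (Ψ ω y) ∂κ ω ∂P)) := by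
    refine tendsto_integral_of_dominated_convergence (fun _ => C * ‖f‖)
      (fun n => (hmeasL n).aestronglyMeasurable) (integrable_const _) ?_ ?_
    · refine fun n => Eventually.of_forall fun ω => ?_
      rw [norm_mul]
      refine mul_le_mul (hWC ω) ?_ (norm_nonneg _) hC
      refine (norm_integral_le_of_norm_le_const (Eventually.of_forall fun y => hfb _)).trans ?_
      have : (κ ω).real univ ≤ 1 := ENNReal.toReal_le_of_le_ofReal zero_le_one
            (by simpa using hκ₁ ω)
      simpa using mul_le_mul_of_nonneg_left this (norm_nonneg f)
    · filter_upwards [hc₁] with ω hω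
      refine Tendsto.const_mul _ ?_
      refine tendsto_integral_of_dominated_convergence (fun _ => ‖f‖) (fun n => ?_)
        (integrable_const _) (fun n => Eventually.of_forall fun y => hfb _) ?_
      · exact (f.continuous.measurable.comp ((hΨ.comp measurable_prodMk_left).comp
          (s n).measurable)).aestronglyMeasurable
      · filter_upwards [hω] with y hy
        exact (f.continuous.tendsto _).comp (hy.tendsto.comp (hs y))
  have limR : Tendsto (fun n => ∫ y, ∫ ω, W ω * f (Ψ ω (s n y)) ∂P ∂P.bind κ) atTop
      (𝓝 (∫ y, ∫ ω, W ω * f (Ψ ω y) ∂P ∂P.bind κ)) := by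
    have hb : ∀ y ω, ‖W ω * f (Ψ ω y)‖ ≤ C * ‖f‖ := fun y ω => by
      rw [norm_mul]
      exact mul_le_mul (hWC ω) (hfb _) (abs_nonneg _) hC
    refine tendsto_integral_of_dominated_convergence (fun _ => C * ‖f‖) (fun n => ?_)
      (integrable_const _) ?_ ?_
    · exact ((s n).map fun v => ∫ ω, W ω * f (Ψ ω v) ∂P).measurable.aestronglyMeasurable
    · refine fun n => Eventually.of_forall fun y => ?_
      refine (norm_integral_le_of_norm_le_const (Eventually.of_forall fun ω => hb _ ω)).trans ?_
      simp
    · filter_upwards [hc₂] with y hy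
      refine tendsto_integral_of_dominated_convergence (fun _ => C * ‖f‖) (fun n => ?_)
        (integrable_const _) (fun n => Eventually.of_forall fun ω => hb _ ω) ?_
      · exact ((hfm _).mono hm₁ le_rfl).aestronglyMeasurable
      · filter_upwards [hy] with ω hω
        exact ((f.continuous.tendsto _).comp (hω.tendsto.comp (hs y))).const_mul _
  exact tendsto_nhds_unique limL (by simpa only [key] using limR)

theorem integral_bind_eq {Ω E : Type*} [MeasurableSpace Ω] [MeasurableSpace E] {P : Measure Ω}
    [IsFiniteMeasure P] {κ : Ω → Measure E} (hκ : Measurable κ) (hκ₁ : ∀ ω, κ ω univ ≤ 1)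
    {f : E → ℝ} (hf : Measurable f) {C : ℝ} (hC : ∀ y, |f y| ≤ C) :
    ∫ y, f y ∂P.bind κ = ∫ ω, ∫ y, f y ∂κ ω ∂P := by
  let η : Kernel Ω E := ⟨κ, hκ⟩
  have hη : IsFiniteKernel η := ⟨1, ENNReal.one_lt_top, hκ₁⟩
  have h := Kernel.integral_comp (η := η) (κ := Kernel.const Unit P) (a := ()) (f := f) (by
    exact Integrable.of_bound hf.aestronglyMeasurable C (Eventually.of_forall hC))
  simp only [Kernel.comp_apply, Kernel.const_apply] at h
  exact h

/-! ### Limits and enumerations of sequences -/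

/-- A sequence of jointly measurable maps has a jointly measurable limit, on the set where it
converges. -/
theorem exists_measurable_limit {X E : Type*} [MeasurableSpace X] [MetricSpace E] [CompleteSpace E]
    [SecondCountableTopology E] [MeasurableSpace E] [BorelSpace E] [Nonempty E]
    {F : ℕ → X → E} (hF : ∀ n, Measurable (F n)) :
    ∃ G : X → E, Measurable G ∧ ∀ x c, Tendsto (fun n => F n x) atTop (𝓝 c) → G x = c := by
  classical
  obtain ⟨x₀⟩ := ‹Nonempty E›
  set S := {x | ∃ c, Tendsto (fun n => F n x) atTop (𝓝 c)} with hS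
  have hSm : MeasurableSet S :=
    StronglyMeasurable.measurableSet_exists_tendsto fun n => (hF n).stronglyMeasurable
  choose! c hc using (fun x (hx : x ∈ S) => hx)
  set G : X → E := fun x => if x ∈ S then c x else x₀ with hG
  have hlim : ∀ x, Tendsto (fun n => if x ∈ S then F n x else x₀) atTop (𝓝 (G x)) := by
    intro x
    by_cases hx : x ∈ S
    · simpa [hG, hx] using hc x hx
    · simp [hG, hx]
  have hGm : Measurable G :=
    measurable_of_tendsto_metrizable (fun n => Measurable.ite hSm (hF n) measurable_const)
      (tendsto_pi_nhds.2 hlim)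
  refine ⟨G, hGm, fun x c' h => ?_⟩
  have hx : x ∈ S := ⟨c', h⟩
  simpa [hG, hx] using tendsto_nhds_unique (hc x hx) h

/-- Finitely many terms of a sequence tending to infinity lie below any bound; merged with the
integers, its values can be listed in increasing order. -/
theorem exists_monotone_enumeration (t : ℕ → ℝ≥0) (ht : Tendsto t atTop atTop) :
    ∃ s : ℕ → ℝ≥0, Monotone s ∧
      (∃ i : ℕ → ℕ, Tendsto i atTop atTop ∧ ∀ n, s (i n) = n) ∧
      ∃ j : ℕ → ℕ, Tendsto j atTop atTop ∧ ∀ k, s (j k) = t k := by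
  classical
  set S : Set ℝ≥0 := range t ∪ range ((↑) : ℕ → ℝ≥0) with hS
  have hfin : ∀ a : ℝ≥0, (S ∩ Iic a).Finite := by
    intro a
    rw [hS, union_inter_distrib_right]
    refine Finite.union ?_ ?_
    · obtain ⟨K, hK⟩ := eventually_atTop.1 (ht.eventually_gt_atTop a)
      refine ((finite_Iio K).image t).subset ?_
      rintro _ ⟨⟨k, rfl⟩, hk⟩
      refine ⟨k, ?_, rfl⟩
      by_contra h
      exact absurd (hK k (by simpa using h)) (not_lt.2 hk)
    · refine ((finite_Iic ⌊a⌋₊).image ((↑) : ℕ → ℝ≥0)).subset ?_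
      rintro _ ⟨⟨k, rfl⟩, hk⟩
      exact ⟨k, Nat.le_floor hk, rfl⟩
  have hS0 : (0 : ℝ≥0) ∈ S := Or.inr ⟨0, by simp⟩
  let ob : OrderBot S := { bot := ⟨0, hS0⟩, bot_le := fun a => (zero_le : 0 ≤ (a : ℝ≥0)) }
  have hfin' : ∀ a : S, (Iic a).Finite := by
    intro a
    refine Finite.of_finite_image (f := Subtype.val) ((hfin a).subset ?_)
      Subtype.val_injective.injOn
    rintro _ ⟨b, hb, rfl⟩
    exact ⟨b.2, hb⟩
  let lf : LocallyFiniteOrder S := LocallyFiniteOrder.ofFiniteIcc fun a b =>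
    (hfin' b).subset Icc_subset_Iic_self
  have hnm : NoMaxOrder S := ⟨fun a => by
    obtain ⟨n, hn⟩ := exists_nat_gt (a : ℝ≥0)
    exact ⟨⟨n, Or.inr ⟨n, rfl⟩⟩, hn⟩⟩
  let so : SuccOrder S := LinearLocallyFiniteOrder.succOrder S
  let po : PredOrder S := LinearLocallyFiniteOrder.predOrder S
  let e : S ≃o ℕ := orderIsoNatOfLinearSuccPredArch
  have hlow : ∀ (u : ℕ → S), Tendsto (fun k => (u k : ℝ≥0)) atTop atTop →
      Tendsto (fun k => e (u k)) atTop atTop := by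
    intro u hu
    refine tendsto_atTop.2 fun n => ?_
    filter_upwards [hu.eventually_ge_atTop ((e.symm n : S) : ℝ≥0)] with k hk
    rw [← e.symm_apply_le]
    exact hk
  exact ⟨fun n => (e.symm n : S), fun a b hab => e.symm.monotone hab,
    ⟨fun n => e ⟨n, Or.inr ⟨n, rfl⟩⟩, hlow _ tendsto_natCast_atTop_atTop, fun n => by simp⟩,
    ⟨fun k => e ⟨t k, Or.inl ⟨k, rfl⟩⟩, hlow _ ht, fun n => by simp⟩⟩

/-! ### Setwise limits of random measures -/

namespace RandomSetwiseLimit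

variable {Ω : Type*} {E : Type*} [MeasurableSpace E] {N : ℕ → Ω → Measure E}

/-- The upper setwise limit of a sequence of random measures. -/
def upperLimit (N : ℕ → Ω → Measure E) (B : Set E) (ω : Ω) : ℝ≥0∞ :=
  limsup (fun n => N n ω B) atTop

theorem measurable_upperLimit [MeasurableSpace Ω] (hN : ∀ n, Measurable (N n)) {B : Set E}
    (hB : MeasurableSet B) : Measurable (upperLimit N B) :=
  Measurable.limsup fun n => (Measure.measurable_coe hB).comp (hN n)

theorem upperLimit_mono {B C : Set E} (h : B ⊆ C) (ω : Ω) :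
    upperLimit N B ω ≤ upperLimit N C ω :=
  limsup_le_limsup (Eventually.of_forall fun _ => measure_mono h)

theorem upperLimit_le_one (hN₁ : ∀ n ω, IsProbabilityMeasure (N n ω)) (B : Set E) (ω : Ω) :
    upperLimit N B ω ≤ 1 :=
  limsup_le_of_le (h := Eventually.of_forall fun n => have := hN₁ n ω; prob_le_one)

theorem upperLimit_ne_top (hN₁ : ∀ n ω, IsProbabilityMeasure (N n ω)) (B : Set E) (ω : Ω) :
    upperLimit N B ω ≠ ⊤ :=
  ((upperLimit_le_one hN₁ B ω).trans_lt ENNReal.one_lt_top).ne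

theorem upperLimit_univ (hN₁ : ∀ n ω, IsProbabilityMeasure (N n ω)) (ω : Ω) :
    upperLimit N univ ω = 1 := by
  have : ∀ n, N n ω univ = 1 := fun n => (hN₁ n ω).measure_univ
  simp [upperLimit, this]

variable [MeasurableSpace Ω] {P : Measure Ω}

theorem ae_tendsto_upperLimit
    (hconv : ∀ B, MeasurableSet B → ∀ᵐ ω ∂P, ∃ c, Tendsto (fun n => N n ω B) atTop (𝓝 c))
    {B : Set E} (hB : MeasurableSet B) :
    ∀ᵐ ω ∂P, Tendsto (fun n => N n ω B) atTop (𝓝 (upperLimit N B ω)) := by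
  filter_upwards [hconv B hB] with ω ⟨c, hc⟩
  rwa [upperLimit, hc.limsup_eq]

theorem ae_upperLimit_union
    (hconv : ∀ B, MeasurableSet B → ∀ᵐ ω ∂P, ∃ c, Tendsto (fun n => N n ω B) atTop (𝓝 c))
    {B C : Set E} (hB : MeasurableSet B) (hC : MeasurableSet C) (hd : Disjoint B C) :
    ∀ᵐ ω ∂P, upperLimit N (B ∪ C) ω = upperLimit N B ω + upperLimit N C ω := by
  filter_upwards [ae_tendsto_upperLimit hconv hB, ae_tendsto_upperLimit hconv hC,
    ae_tendsto_upperLimit hconv (hB.union hC)] with ω h1 h2 h3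
  refine tendsto_nhds_unique h3 ?_
  simp_rw [measure_union hd hC]
  exact h1.add h2

/-- The upper setwise limits inherit continuity at `∅` from the mean measure. -/
theorem ae_tendsto_zero_of_antitone {ρ : Measure E} [IsFiniteMeasure ρ]
    (hN : ∀ n, Measurable (N n)) (hρ : ∀ n, P.bind (N n) = ρ)
    (hconv : ∀ B, MeasurableSet B → ∀ᵐ ω ∂P, ∃ c, Tendsto (fun n => N n ω B) atTop (𝓝 c))
    {B : ℕ → Set E} (hB : ∀ j, MeasurableSet (B j)) (hanti : Antitone B) (hempty : ⋂ j, B j = ∅) :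
    ∀ᵐ ω ∂P, Tendsto (fun j => upperLimit N (B j) ω) atTop (𝓝 0) := by
  have h1 : ∀ j, ∫⁻ ω, upperLimit N (B j) ω ∂P ≤ ρ (B j) := by
    intro j
    have : ∀ᵐ ω ∂P, upperLimit N (B j) ω = liminf (fun n => N n ω (B j)) atTop := by
      filter_upwards [ae_tendsto_upperLimit hconv (hB j)] with ω h
      rw [h.liminf_eq]
    rw [lintegral_congr_ae this]
    refine (lintegral_liminf_le fun n => (Measure.measurable_coe (hB j)).comp (hN n)).trans ?_
    have : ∀ n, ∫⁻ ω, N n ω (B j) ∂P = ρ (B j) := fun n => by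
      rw [← hρ n, Measure.bind_apply (hB j) (hN n).aemeasurable]
    simp [this]
  have h2 : Tendsto (fun j => ρ (B j)) atTop (𝓝 0) := by
    have := tendsto_measure_iInter_atTop (μ := ρ) (fun j => (hB j).nullMeasurableSet) hanti
      ⟨0, measure_ne_top _ _⟩
    simpa [hempty, Function.comp_def] using this
  have h3 : ∫⁻ ω, ⨅ j, upperLimit N (B j) ω ∂P = 0 := by
    refine le_antisymm (ge_of_tendsto' h2 fun j => ?_) (zero_le)
    exact (lintegral_mono fun ω => iInf_le _ j).trans (h1 j)
  rw [lintegral_eq_zero_iff (Measurable.iInf fun j => measurable_upperLimit hN (hB j))] at h3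
  filter_upwards [h3] with ω hω
  have := tendsto_atTop_iInf (f := fun j => upperLimit N (B j) ω)
    fun i j hij => upperLimit_mono (hanti hij) ω
  simpa only [hω, Pi.zero_apply] using this

/-- Countable additivity: the remainders `⋃ j ≥ n, B j` decrease to `∅`. -/
theorem ae_upperLimit_iUnion {ρ : Measure E} [IsFiniteMeasure ρ]
    (hN : ∀ n, Measurable (N n)) (hρ : ∀ n, P.bind (N n) = ρ)
    (hconv : ∀ B, MeasurableSet B → ∀ᵐ ω ∂P, ∃ c, Tendsto (fun n => N n ω B) atTop (𝓝 c))
    {B : ℕ → Set E} (hB : ∀ j, MeasurableSet (B j)) (hd : Pairwise (Function.onFun Disjoint B)) :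
    ∀ᵐ ω ∂P, upperLimit N (⋃ j, B j) ω = ∑' j, upperLimit N (B j) ω := by
  set T : ℕ → Set E := fun n => ⋃ j ≥ n, B j with hT
  have hTm : ∀ n, MeasurableSet (T n) := fun n =>
    MeasurableSet.iUnion fun j => MeasurableSet.iUnion fun _ => hB j
  have hTanti : Antitone T := fun m n hmn =>
    iUnion_mono fun j => iUnion_mono' fun h => ⟨le_trans hmn h, le_rfl⟩
  have hTempty : ⋂ n, T n = ∅ := by
    rw [eq_empty_iff_forall_notMem]
    intro x hx
    rw [mem_iInter] at hx
    obtain ⟨i, -, hi⟩ := mem_iUnion₂.1 (hx 0)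
    obtain ⟨j, hj, hj'⟩ := mem_iUnion₂.1 (hx (i + 1))
    have hij : i ≠ j := by have : i + 1 ≤ j := hj; omega
    exact disjoint_left.1 (hd hij) hi hj'
  have hstep : ∀ n, T n = B n ∪ T (n + 1) := by
    intro n
    ext x
    simp only [hT, mem_iUnion, mem_union, exists_prop]
    constructor
    · rintro ⟨j, hj, hx⟩
      rcases eq_or_lt_of_le hj with h | h
      · left; rwa [h]
      · right; exact ⟨j, h, hx⟩
    · rintro (hx | ⟨j, hj, hx⟩)
      · exact ⟨n, le_rfl, hx⟩
      · exact ⟨j, (Nat.le_succ n).trans hj, hx⟩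
  have hdT : ∀ n, Disjoint (B n) (T (n + 1)) := by
    intro n
    refine disjoint_left.2 fun x hx hx' => ?_
    obtain ⟨j, hj, hj'⟩ := mem_iUnion₂.1 hx'
    have hij : n ≠ j := by have : n + 1 ≤ j := hj; omega
    exact disjoint_left.1 (hd hij) hx hj'
  have h0 : T 0 = ⋃ j, B j := by simp [hT]
  filter_upwards [ae_tendsto_zero_of_antitone hN hρ hconv hTm hTanti hTempty,
    ae_all_iff.2 fun n => ae_upperLimit_union hconv (hB n) (hTm (n + 1)) (hdT n)] with ω hz hs
  have hsum : ∀ n, upperLimit N (⋃ j, B j) ω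
      = ∑ j ∈ Finset.range n, upperLimit N (B j) ω + upperLimit N (T n) ω := by
    intro n
    induction n with
    | zero => simp [h0]
    | succ n ih => rw [ih, Finset.sum_range_succ, hstep n, hs n, add_assoc]
  have hlim := (ENNReal.tendsto_nat_tsum fun j => upperLimit N (B j) ω).add hz
  simp_rw [← hsum, add_zero] at hlim
  exact tendsto_nhds_unique tendsto_const_nhds hlim

/-- The upper limit at the half-lines, transported to the real line, is almost surely a
distribution function. -/
theorem ae_isRatStieltjesPoint {ρ : Measure E} [IsFiniteMeasure ρ]
    (hN : ∀ n, Measurable (N n)) (hN₁ : ∀ n ω, IsProbabilityMeasure (N n ω))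
    (hρ : ∀ n, P.bind (N n) = ρ)
    (hconv : ∀ B, MeasurableSet B → ∀ᵐ ω ∂P, ∃ c, Tendsto (fun n => N n ω B) atTop (𝓝 c))
    {e : E → ℝ} (he : Measurable e) :
    ∀ᵐ ω ∂P, IsRatStieltjesPoint
      (fun ω (q : ℚ) => (upperLimit N (e ⁻¹' Iic (q : ℝ)) ω).toReal) ω := by
  have hm : ∀ q : ℝ, MeasurableSet (e ⁻¹' Iic q) := fun q => he measurableSet_Iic
  have hmono : ∀ ω, Monotone fun q : ℝ => (upperLimit N (e ⁻¹' Iic q) ω).toReal := fun ω p q hpq =>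
    ENNReal.toReal_mono (upperLimit_ne_top hN₁ _ ω)
      (upperLimit_mono (preimage_mono (Iic_subset_Iic.2 hpq)) ω)
  have hle : ∀ q ω, (upperLimit N (e ⁻¹' Iic q) ω).toReal ≤ 1 := fun q ω =>
    ENNReal.toReal_le_of_le_ofReal zero_le_one (by simpa using upperLimit_le_one hN₁ _ ω)
  -- Mass near `+∞`.
  have htop : ∀ᵐ ω ∂P, Tendsto (fun j : ℕ => upperLimit N (e ⁻¹' Ioi (j : ℝ)) ω) atTop (𝓝 0) := by
    refine ae_tendsto_zero_of_antitone hN hρ hconv (fun j => he measurableSet_Ioi)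
      (fun i j hij => preimage_mono (Ioi_subset_Ioi (by exact_mod_cast hij))) ?_
    rw [eq_empty_iff_forall_notMem]
    intro x hx
    obtain ⟨n, hn⟩ := exists_nat_gt (e x)
    exact absurd (mem_iInter.1 hx n) (by simpa using hn.le)
  have htop' : ∀ᵐ ω ∂P, ∀ j : ℕ, (upperLimit N (e ⁻¹' Iic (j : ℝ)) ω).toReal
      + (upperLimit N (e ⁻¹' Ioi (j : ℝ)) ω).toReal = 1 := by
    refine ae_all_iff.2 fun j => ?_
    have hd : Disjoint (e ⁻¹' Iic (j : ℝ)) (e ⁻¹' Ioi (j : ℝ)) :=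
      Disjoint.preimage _ (by simp [disjoint_left])
    filter_upwards [ae_upperLimit_union hconv (hm j) (he measurableSet_Ioi) hd] with ω hω
    rw [← preimage_union, Iic_union_Ioi, preimage_univ, upperLimit_univ hN₁] at hω
    rw [← ENNReal.toReal_add (upperLimit_ne_top hN₁ _ _) (upperLimit_ne_top hN₁ _ _), ← hω]
    simp
  -- Mass near `-∞`.
  have hbot : ∀ᵐ ω ∂P, Tendsto (fun j : ℕ => upperLimit N (e ⁻¹' Iic (-(j : ℝ))) ω) atTop
      (𝓝 0) := by
    refine ae_tendsto_zero_of_antitone hN hρ hconv (fun j => hm _)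
      (fun i j hij => preimage_mono (Iic_subset_Iic.2 (by
        have : (i : ℝ) ≤ j := by exact_mod_cast hij
        linarith))) ?_
    rw [eq_empty_iff_forall_notMem]
    intro x hx
    obtain ⟨n, hn⟩ := exists_nat_gt (-(e x))
    have : e x ≤ -(n : ℝ) := mem_iInter.1 hx n
    linarith
  -- Mass immediately to the right of a rational.
  have hright : ∀ᵐ ω ∂P, ∀ q : ℚ, Tendsto (fun j : ℕ =>
      upperLimit N (e ⁻¹' Ioc (q : ℝ) (q + 1 / ((j : ℝ) + 1))) ω) atTop (𝓝 0) := by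
    refine ae_all_iff.2 fun q => ?_
    refine ae_tendsto_zero_of_antitone hN hρ hconv (fun j => he measurableSet_Ioc)
      (fun i j hij => preimage_mono (Ioc_subset_Ioc_right ?_)) ?_
    · have := Nat.one_div_le_one_div (α := ℝ) hij
      linarith
    · rw [eq_empty_iff_forall_notMem]
      intro x hx
      have hx0 : (q : ℝ) < e x := (mem_iInter.1 hx 0).1
      obtain ⟨n, hn⟩ := exists_nat_one_div_lt (sub_pos.2 hx0)
      have : e x ≤ q + 1 / ((n : ℝ) + 1) := (mem_iInter.1 hx n).2
      linarith
  have hright' : ∀ᵐ ω ∂P, ∀ (q : ℚ) (j : ℕ),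
      (upperLimit N (e ⁻¹' Iic ((q : ℝ) + 1 / ((j : ℝ) + 1))) ω).toReal
      = (upperLimit N (e ⁻¹' Iic (q : ℝ)) ω).toReal
        + (upperLimit N (e ⁻¹' Ioc (q : ℝ) (q + 1 / ((j : ℝ) + 1))) ω).toReal := by
    refine ae_all_iff.2 fun q => ae_all_iff.2 fun j => ?_
    have hd : Disjoint (e ⁻¹' Iic (q : ℝ)) (e ⁻¹' Ioc (q : ℝ) (q + 1 / ((j : ℝ) + 1))) :=
      Disjoint.preimage _ (disjoint_left.2 fun x hx hx' => not_le.2 hx'.1 hx)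
    filter_upwards [ae_upperLimit_union hconv (hm q) (he measurableSet_Ioc) hd] with ω hω
    have hj : (q : ℝ) ≤ q + 1 / ((j : ℝ) + 1) := by
      have : (0 : ℝ) < 1 / ((j : ℝ) + 1) := by positivity
      linarith
    rw [← preimage_union, Iic_union_Ioc_eq_Iic hj] at hω
    rw [hω, ENNReal.toReal_add (upperLimit_ne_top hN₁ _ _) (upperLimit_ne_top hN₁ _ _)]
  filter_upwards [htop, htop', hbot, hright, hright'] with ω h1 h1' h2 h3 h3'
  have toR : ∀ {u : ℕ → ℝ≥0∞}, Tendsto u atTop (𝓝 0) →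
      Tendsto (fun j => (u j).toReal) atTop (𝓝 0) := fun h => by
    simpa [Function.comp_def] using (ENNReal.tendsto_toReal ENNReal.zero_ne_top).comp h
  refine ⟨fun p q hpq => hmono ω (by exact_mod_cast hpq), ?_, ?_, fun q => ?_⟩
  · have hl : Tendsto (fun q : ℚ => 1 - (upperLimit N (e ⁻¹' Ioi ((⌊q⌋₊ : ℕ) : ℝ)) ω).toReal) atTop
        (𝓝 1) := by
      simpa using ((toR h1).comp (tendsto_nat_floor_atTop (α := ℚ))).const_sub 1
    refine tendsto_of_tendsto_of_tendsto_of_le_of_le' hl tendsto_const_nhds ?_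
      (Eventually.of_forall fun q => hle _ ω)
    filter_upwards [eventually_ge_atTop 0] with q hq
    have hq' : ((⌊q⌋₊ : ℕ) : ℝ) ≤ q := by exact_mod_cast Nat.floor_le hq
    have := h1' ⌊q⌋₊
    have := hmono ω hq'
    simp only at this
    linarith
  · have hu : Tendsto (fun q : ℚ => (upperLimit N (e ⁻¹' Iic (-((⌊-q⌋₊ : ℕ) : ℝ))) ω).toReal)
        atBot (𝓝 0) :=
      (toR h2).comp ((tendsto_nat_floor_atTop (α := ℚ)).comp tendsto_neg_atBot_atTop)
    refine tendsto_of_tendsto_of_tendsto_of_le_of_le' tendsto_const_nhds hu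
      (Eventually.of_forall fun q => ENNReal.toReal_nonneg) ?_
    filter_upwards [eventually_le_atBot 0] with q hq
    refine hmono ω ?_
    have : ((⌊-q⌋₊ : ℕ) : ℝ) ≤ ((-q : ℚ) : ℝ) := by
      exact_mod_cast Nat.floor_le (neg_nonneg.2 hq)
    push_cast at this
    linarith
  · have hbdd : BddBelow (range fun r : Ioi q =>
        (upperLimit N (e ⁻¹' Iic (((r : ℚ)) : ℝ)) ω).toReal) :=
      ⟨0, by rintro _ ⟨r, rfl⟩; exact ENNReal.toReal_nonneg⟩
    refine le_antisymm ?_ (le_ciInf fun r => hmono ω (by exact_mod_cast (le_of_lt r.2)))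
    have hlim : Tendsto (fun j : ℕ => (upperLimit N (e ⁻¹' Iic (q : ℝ)) ω).toReal
        + (upperLimit N (e ⁻¹' Ioc (q : ℝ) (q + 1 / ((j : ℝ) + 1))) ω).toReal) atTop
        (𝓝 (upperLimit N (e ⁻¹' Iic (q : ℝ)) ω).toReal) := by
      simpa using (toR (h3 q)).const_add _
    refine ge_of_tendsto' hlim fun j => ?_
    have hj : q < q + 1 / ((j : ℚ) + 1) := by
      have : (0 : ℚ) < 1 / ((j : ℚ) + 1) := by positivity
      linarith
    refine (ciInf_le hbdd ⟨q + 1 / ((j : ℚ) + 1), hj⟩).trans (le_of_eq ?_)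
    rw [← h3' q j]
    push_cast
    rfl

end RandomSetwiseLimit

open RandomSetwiseLimit in
/-- A sequence of random probability measures with constant mean, whose values on each measurable
set converge almost surely, converges setwise to a random probability measure: the constancy of
the mean provides countable additivity of the limit, and the limit is realised through its
distribution function on the real line. -/
theorem exists_random_setwise_limit {Ω : Type*} [MeasurableSpace Ω] {P : Measure Ω}
    {E : Type*} [MeasurableSpace E] [StandardBorelSpace E] [Nonempty E] {N : ℕ → Ω → Measure E}
    {ρ : Measure E} [IsFiniteMeasure ρ]
    (hN : ∀ n, Measurable (N n)) (hN₁ : ∀ n ω, IsProbabilityMeasure (N n ω))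
    (hρ : ∀ n, P.bind (N n) = ρ)
    (hconv : ∀ B, MeasurableSet B → ∀ᵐ ω ∂P, ∃ c, Tendsto (fun n => N n ω B) atTop (𝓝 c)) :
    ∃ μ : Ω → Measure E, Measurable μ ∧ (∀ ω, IsProbabilityMeasure (μ ω)) ∧
      ∀ B, MeasurableSet B → ∀ᵐ ω ∂P, Tendsto (fun n => N n ω B) atTop (𝓝 (μ ω B)) := by
  have he := measurableEmbedding_embeddingReal E
  set e := embeddingReal E
  set f : Ω → ℚ → ℝ := fun ω q => (upperLimit N (e ⁻¹' Iic (q : ℝ)) ω).toReal with hf_def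
  have hf : Measurable f := measurable_pi_lambda _ fun q =>
    (measurable_upperLimit hN (he.measurable measurableSet_Iic)).ennreal_toReal
  set lam : Ω → Measure ℝ := fun ω => (stieltjesOfMeasurableRat f hf ω).measure with hlam
  have hlamm : Measurable lam := measurable_measure_stieltjesOfMeasurableRat hf
  have hlamp : ∀ ω, IsProbabilityMeasure (lam ω) := fun ω => inferInstance
  have hkey : ∀ C : Set ℝ, MeasurableSet C → ∀ᵐ ω ∂P, lam ω C = upperLimit N (e ⁻¹' C) ω := by
    intro C hC
    induction C, hC using MeasurableSpace.induction_on_inter Real.borel_eq_generateFrom_Iic_rat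
      Real.isPiSystem_Iic_rat with
    | empty => exact Eventually.of_forall fun ω => by simp [upperLimit]
    | basic C hC =>
      obtain ⟨q, rfl⟩ : ∃ q : ℚ, C = Iic (q : ℝ) := by
        simpa [eq_comm] using hC
      filter_upwards [ae_isRatStieltjesPoint hN hN₁ hρ hconv he.measurable] with ω hω
      rw [hlam, measure_stieltjesOfMeasurableRat_Iic, stieltjesOfMeasurableRat_eq,
        toRatCDF_of_isRatStieltjesPoint hω, ENNReal.ofReal_toReal (upperLimit_ne_top hN₁ _ _)]
    | compl C hC ih =>
      filter_upwards [ih, ae_upperLimit_union hconv (he.measurable hC) (he.measurable hC.compl)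
        (disjoint_compl_right.preimage e)] with ω h1 h2
      rw [← preimage_union, union_compl_self, preimage_univ, upperLimit_univ hN₁] at h2
      rw [prob_compl_eq_one_sub hC, h1, h2]
      exact ENNReal.add_sub_cancel_left (upperLimit_ne_top hN₁ _ _)
    | iUnion C hd hC ih =>
      filter_upwards [ae_all_iff.2 ih, ae_upperLimit_iUnion hN hρ hconv
        (fun j => he.measurable (hC j)) (fun i j hij => (hd hij).preimage e)] with ω h1 h2
      rw [measure_iUnion hd hC, preimage_iUnion, h2]
      exact tsum_congr h1
  refine ⟨fun ω => (lam ω).map he.invFun,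
    (Measure.measurable_map _ he.measurable_invFun).comp hlamm,
    fun ω => Measure.isProbabilityMeasure_map he.measurable_invFun.aemeasurable, fun B hB => ?_⟩
  filter_upwards [hkey _ (he.measurable_invFun hB), ae_tendsto_upperLimit hconv hB] with ω h1 h2
  rw [Measure.map_apply he.measurable_invFun hB, h1, ← preimage_comp,
    he.leftInverse_invFun.comp_eq_id, preimage_id]
  exact h2

/-! ### The flow on the state space -/

namespace WhiteNoiseLocalRDS

variable {Ω : Type*} [MeasurableSpace Ω] {P : Measure Ω}
  {E : Type*} [MetricSpace E] [MeasurableSpace E]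

/-- The cocycle as a map into `E`, where the cemetery state is replaced by a base point `x₀`. -/
def flow (R : WhiteNoiseLocalRDS Ω P E) (x₀ : E) (t : ℝ≥0) (ω : Ω) (x : E) : E :=
  (R.φ t ω x).getD x₀

/-- The pullback flow `φ_t(θ_{-t} ω, x)`, with the cemetery state replaced by `x₀`. -/
def pullback (R : WhiteNoiseLocalRDS Ω P E) (x₀ : E) (t : ℝ≥0) (ω : Ω) (x : E) : E :=
  R.flow x₀ t (R.θ (-(t : ℝ)) ω) x

/-- The random measure `φ_t(θ_{-t} ω) ρ`, with the mass at the cemetery state moved to `x₀`. -/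
def pullbackLaw (R : WhiteNoiseLocalRDS Ω P E) (x₀ : E) (ρ : Measure E) (t : ℝ≥0) (ω : Ω) :
    Measure E :=
  ρ.map (R.pullback x₀ t ω)

variable (R : WhiteNoiseLocalRDS Ω P E) (x₀ : E)

theorem measurable_θ_const (r : ℝ) : Measurable (R.θ r) := (R.measurePreserving_θ r).measurable

theorem past_le (t : ℝ) : R.past t ≤ ‹MeasurableSpace Ω› :=
  iSup₂_le fun s hs => R.F_le s t hs

theorem some_flow {t : ℝ≥0} {ω : Ω} {x : E} (h : R.φ t ω x ≠ none) :
    R.φ t ω x = some (R.flow x₀ t ω x) := by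
  obtain ⟨y, hy⟩ := Option.ne_none_iff_exists'.1 h
  simp [flow, hy]

theorem φ_add_eq {s : ℝ≥0} {ω : Ω} {x : E} (t : ℝ≥0) (h : R.φ s ω x ≠ none) :
    R.φ (t + s) ω x = R.φ t (R.θ s ω) (R.flow x₀ s ω x) := by
  rw [R.φ_add, R.some_flow x₀ h, Option.bind_some]

theorem flow_add {s : ℝ≥0} {ω : Ω} {x : E} (t : ℝ≥0) (h : R.φ s ω x ≠ none) :
    R.flow x₀ (t + s) ω x = R.flow x₀ t (R.θ s ω) (R.flow x₀ s ω x) := by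
  rw [flow, R.φ_add_eq x₀ t h, ← flow]

theorem flow_zero (ω : Ω) (x : E) : R.flow x₀ 0 ω x = x := by simp [flow, R.φ_zero]

theorem θ_θ (s t : ℝ) (ω : Ω) : R.θ s (R.θ t ω) = R.θ (s + t) ω := (R.θ_add s t ω).symm

/-- The pullback flow over `[-(t+s), 0]` is the one over `[-(t+s), -t]` followed by the one
over `[-t, 0]`. -/
theorem pullback_add {s : ℝ≥0} {ω : Ω} {x : E} (t : ℝ≥0)
    (h : R.φ s (R.θ (-((t + s : ℝ≥0) : ℝ)) ω) x ≠ none) :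
    R.pullback x₀ (t + s) ω x
      = R.pullback x₀ t ω (R.flow x₀ s (R.θ (-((t + s : ℝ≥0) : ℝ)) ω) x) := by
  rw [pullback, R.flow_add x₀ t h, pullback, R.θ_θ]
  congr 2
  push_cast
  ring

/-- The events of the `E`-valued flow in terms of the events `φ t ω x ∈ some '' B`, the only ones
whose measurability is assumed. -/
theorem flow_mem_iff (B : Set E) (t : ℝ≥0) (ω : Ω) (x : E) :
    R.flow x₀ t ω x ∈ B ↔ R.φ t ω x ∈ some '' B ∨ (¬ R.φ t ω x ∈ some '' univ ∧ x₀ ∈ B) := by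
  rcases h : R.φ t ω x with _ | y <;> simp [flow, h]

theorem measurableSet_domain :
    MeasurableSet {p : ℝ≥0 × Ω × E | R.φ p.1 p.2.1 p.2.2 ≠ none} := by
  convert R.measurable_φ univ MeasurableSet.univ using 1
  ext p
  rcases h : R.φ p.1 p.2.1 p.2.2 with _ | y <;> simp [h]

theorem measurable_flow : Measurable fun p : ℝ≥0 × Ω × E => R.flow x₀ p.1 p.2.1 p.2.2 := by
  intro B hB
  have : (fun p : ℝ≥0 × Ω × E => R.flow x₀ p.1 p.2.1 p.2.2) ⁻¹' B
      = {p | R.φ p.1 p.2.1 p.2.2 ∈ some '' B}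
        ∪ ({p | R.φ p.1 p.2.1 p.2.2 ∈ some '' univ}ᶜ ∩ {_p | x₀ ∈ B}) := by
    ext p
    exact R.flow_mem_iff x₀ B _ _ _
  rw [this]
  exact (R.measurable_φ B hB).union
    ((R.measurable_φ univ MeasurableSet.univ).compl.inter (MeasurableSet.const _))

theorem measurable_flow_uncurry (t : ℝ≥0) : Measurable (Function.uncurry (R.flow x₀ t)) :=
  (R.measurable_flow x₀).comp measurable_prodMk_left

theorem measurable_flow_right (t : ℝ≥0) (ω : Ω) : Measurable (R.flow x₀ t ω) :=
  (R.measurable_flow_uncurry x₀ t).comp measurable_prodMk_left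

theorem measurable_pullback (t : ℝ≥0) : Measurable (Function.uncurry (R.pullback x₀ t)) :=
  (R.measurable_flow_uncurry x₀ t).comp
    (((R.measurable_θ_const _).comp measurable_fst).prodMk measurable_snd)

theorem measurable_pullback_right (t : ℝ≥0) (ω : Ω) : Measurable (R.pullback x₀ t ω) :=
  R.measurable_flow_right x₀ t _

theorem measurable_pullback_left (t : ℝ≥0) (x : E) : Measurable fun ω => R.pullback x₀ t ω x :=
  (R.measurable_pullback x₀ t).comp measurable_prodMk_right

/-- `φ_t(θ_r ω, x)` depends on the noise between the times `r` and `r + t` only. -/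
theorem measurable_flow_shift (r : ℝ) (t : ℝ≥0) (x : E) :
    Measurable[R.F r (t + r)] fun ω => R.flow x₀ t (R.θ r ω) x := by
  have h0 : Measurable[R.F 0 t] fun ω => R.flow x₀ t ω x := by
    intro B hB
    have : (fun ω => R.flow x₀ t ω x) ⁻¹' B = {ω | R.φ t ω x ∈ some '' B}
        ∪ ({ω | R.φ t ω x ∈ some '' univ}ᶜ ∩ {_ω | x₀ ∈ B}) := by
      ext p
      exact R.flow_mem_iff x₀ B _ _ _
    rw [this]
    exact @MeasurableSet.union _ (R.F 0 t) _ _ (R.F_adapted t x B hB)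
      (@MeasurableSet.inter _ (R.F 0 t) _ _
        (@MeasurableSet.compl _ _ (R.F 0 t) (R.F_adapted t x univ MeasurableSet.univ))
        (@MeasurableSet.const _ (R.F 0 t) _))
  have h1 := R.F_shift r 0 t t.2
  rw [zero_add] at h1
  rw [← h1]
  exact h0.comp (comap_measurable _)

theorem measurable_pullback_F (t : ℝ≥0) (x : E) :
    Measurable[R.F (-(t : ℝ)) 0] fun ω => R.pullback x₀ t ω x := by
  have h := R.measurable_flow_shift x₀ (-(t : ℝ)) t x
  rw [add_neg_cancel] at h
  exact h

theorem F_neg_le (t : ℝ≥0) : R.F (-(t : ℝ)) 0 ≤ ‹MeasurableSpace Ω› := R.F_le _ _ (by simp)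

theorem F_neg_mono {s t : ℝ≥0} (h : s ≤ t) : R.F (-(s : ℝ)) 0 ≤ R.F (-(t : ℝ)) 0 :=
  R.F_mono _ _ _ _ (by simpa using h) (by simp) le_rfl

theorem F_neg_le_past (t : ℝ≥0) : R.F (-(t : ℝ)) 0 ≤ R.past 0 :=
  le_iSup₂_of_le (f := fun s (_ : s ≤ (0 : ℝ)) => R.F s 0) (-(t : ℝ)) (by simp) le_rfl

theorem past_zero_eq : R.past 0 = ⨆ n : ℕ, R.F (-((n : ℝ≥0) : ℝ)) 0 := by
  refine le_antisymm (iSup₂_le fun s hs => ?_) (iSup_le fun n => R.F_neg_le_past _)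
  obtain ⟨n, hn⟩ := exists_nat_gt (-s)
  refine le_trans (R.F_mono _ _ _ _ ?_ hs le_rfl)
    (le_iSup (fun n : ℕ => R.F (-((n : ℝ≥0) : ℝ)) 0) n)
  simp only [NNReal.coe_natCast]
  linarith

theorem continuousAt_flow {t : ℝ≥0} {ω : Ω} {x : E} (h : R.φ t ω x ≠ none) :
    ContinuousAt (R.flow x₀ t ω) x := by
  have h1 := R.continuousAt_φ t ω x _ (R.some_flow x₀ h)
  rw [ContinuousAt]
  intro U hU
  have h2 : R.φ t ω ⁻¹' (some '' U) ∈ 𝓝 x := h1 (image_mem_map hU)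
  refine mem_map.2 (mem_of_superset h2 fun y hy => ?_)
  obtain ⟨z, hz, hz'⟩ := hy
  simpa [mem_preimage, flow, ← hz'] using hz

theorem isOpen_domain_section (t : ℝ≥0) (ω : Ω) : IsOpen {x | R.φ t ω x ≠ none} :=
  (R.isOpen_domain ω).preimage (Continuous.prodMk_right t)

theorem measurable_pullbackLaw [BorelSpace E] (ρ : Measure E) [SFinite ρ] (t : ℝ≥0) :
    Measurable (R.pullbackLaw x₀ ρ t) := by
  refine Measure.measurable_of_measurable_coe _ fun B hB => ?_
  have : ∀ ω, R.pullbackLaw x₀ ρ t ω B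
      = ρ (Prod.mk ω ⁻¹' (Function.uncurry (R.pullback x₀ t) ⁻¹' B)) := fun ω => by
    rw [pullbackLaw, Measure.map_apply (R.measurable_pullback_right x₀ t ω) hB]
    rfl
  simp_rw [this]
  exact measurable_measure_prodMk_left (R.measurable_pullback x₀ t hB)

instance (ρ : Measure E) [IsProbabilityMeasure ρ] (t : ℝ≥0) (ω : Ω) :
    IsProbabilityMeasure (R.pullbackLaw x₀ ρ t ω) :=
  Measure.isProbabilityMeasure_map (R.measurable_pullback_right x₀ t ω).aemeasurable

theorem integral_pullbackLaw (ρ : Measure E) (t : ℝ≥0) (ω : Ω) [BorelSpace E] (f : E →ᵇ ℝ) :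
    ∫ y, f y ∂(R.pullbackLaw x₀ ρ t ω) = ∫ x, f (R.pullback x₀ t ω x) ∂ρ :=
  integral_map (R.measurable_pullback_right x₀ t ω).aemeasurable
    f.continuous.measurable.aestronglyMeasurable

end WhiteNoiseLocalRDS

/-! ### The Markov property and the martingale of pullbacks -/

namespace WhiteNoiseLocalRDS

variable {Ω : Type*} [MeasurableSpace Ω] {P : Measure Ω}
  {E : Type*} [MetricSpace E] [MeasurableSpace E] {R : WhiteNoiseLocalRDS Ω P E} (x₀ : E)

theorem WeaklyComplete.ae_ne_none (hR : R.WeaklyComplete) (t : ℝ≥0) (r : ℝ) (x : E) :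
    ∀ᵐ ω ∂P, R.φ t (R.θ r ω) x ≠ none :=
  (R.measurePreserving_θ r).quasiMeasurePreserving.ae (hR t x)

theorem WeaklyComplete.ae_ae_ne_none [SFinite P] (hR : R.WeaklyComplete) (ρ : Measure E) [SFinite ρ]
    (t : ℝ≥0) (r : ℝ) : ∀ᵐ ω ∂P, ∀ᵐ x ∂ρ, R.φ t (R.θ r ω) x ≠ none := by
  refine (Measure.ae_ae_comm ?_).2 (Eventually.of_forall fun x => hR.ae_ne_none t r x)
  exact (measurable_const.prodMk
    (((R.measurable_θ_const r).comp measurable_fst).prodMk measurable_snd)) R.measurableSet_domain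

theorem WeaklyComplete.semigroup_eq (hR : R.WeaklyComplete) (t : ℝ≥0) (f : E → ℝ) (x : E) :
    R.semigroup t f x = ∫ ω, f (R.flow x₀ t ω x) ∂P := by
  refine integral_congr_ae ?_
  filter_upwards [hR t x] with ω hω
  rw [R.some_flow x₀ hω]
  rfl

variable [IsProbabilityMeasure P]

theorem abs_integral_mul_pullback_le {W : Ω → ℝ} {C : ℝ} (hC : ∀ ω, |W ω| ≤ C)
    (t : ℝ≥0) (f : E →ᵇ ℝ) (y : E) :
    |∫ ω, W ω * f (R.pullback x₀ t ω y) ∂P| ≤ C * ‖f‖ := by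
  have hb : ∀ ω, ‖W ω * f (R.pullback x₀ t ω y)‖ ≤ C * ‖f‖ := fun ω => by
    rw [norm_mul]
    exact mul_le_mul (hC ω) (f.norm_coe_le_norm _) (norm_nonneg _) ((abs_nonneg _).trans (hC ω))
  simpa using norm_integral_le_of_norm_le_const (μ := P) (Eventually.of_forall hb)

variable [BorelSpace E]

theorem measurable_integral_mul_pullback {W : Ω → ℝ}
    (hW : Measurable W) (t : ℝ≥0) (f : E →ᵇ ℝ) :
    Measurable fun y => ∫ ω, W ω * f (R.pullback x₀ t ω y) ∂P := by
  have : Measurable (Function.uncurry fun (y : E) (ω : Ω) => W ω * f (R.pullback x₀ t ω y)) :=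
    (hW.comp measurable_snd).mul
      (f.continuous.measurable.comp ((R.measurable_pullback x₀ t).comp measurable_swap))
  exact (StronglyMeasurable.integral_prod_right (ν := P) this.stronglyMeasurable).measurable

/-- A form of the Feller property, weighted by `W`. -/
theorem WeaklyComplete.continuous_integral_mul_pullback (hR : R.WeaklyComplete) {W : Ω → ℝ}
    (hW : Measurable W) {C : ℝ} (hC : ∀ ω, |W ω| ≤ C) (t : ℝ≥0) (f : E →ᵇ ℝ) :
    Continuous fun y => ∫ ω, W ω * f (R.pullback x₀ t ω y) ∂P := by
  refine continuous_iff_continuousAt.2 fun y => ?_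
  refine tendsto_integral_filter_of_dominated_convergence (fun _ => C * ‖f‖) ?_ ?_
    (integrable_const _) ?_
  · exact Eventually.of_forall fun z => (hW.mul (f.continuous.measurable.comp
      (R.measurable_pullback_left x₀ t z))).aestronglyMeasurable
  · refine Eventually.of_forall fun z => Eventually.of_forall fun ω => ?_
    rw [norm_mul]
    exact mul_le_mul (hC ω) (f.norm_coe_le_norm _) (norm_nonneg _) ((abs_nonneg _).trans (hC ω))
  · filter_upwards [hR.ae_ne_none t (-(t : ℝ)) y] with ω hω
    exact ((f.continuous.tendsto _).comp (R.continuousAt_flow x₀ hω)).const_mul _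

variable [SecondCountableTopology E]

/-- The Markov property of the pullback flow: the noise before time `-t` is independent of the
noise after time `-t`. -/
theorem WeaklyComplete.integral_mul_pullback_add (hR : R.WeaklyComplete) {t : ℝ≥0} {W : Ω → ℝ}
    (hW : Measurable[R.F (-(t : ℝ)) 0] W) {C : ℝ} (hC : ∀ ω, |W ω| ≤ C) (s : ℝ≥0)
    (f : E →ᵇ ℝ) (x : E) :
    ∫ ω, W ω * f (R.pullback x₀ (t + s) ω x) ∂P
      = R.semigroup s (fun y => ∫ ω, W ω * f (R.pullback x₀ t ω y) ∂P) x := by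
  set r : ℝ := -((t + s : ℝ≥0) : ℝ) with hr
  have hrt : r ≤ -(t : ℝ) := by rw [hr]; push_cast; linarith [s.2]
  have hW0 : Measurable W := hW.mono (R.F_neg_le t) le_rfl
  set Y : Ω → E := fun ω => R.flow x₀ s (R.θ r ω) x with hY_def
  have hY : Measurable[R.F r (-(t : ℝ))] Y := by
    have h := R.measurable_flow_shift x₀ r s x
    have : (s : ℝ) + r = -(t : ℝ) := by rw [hr]; push_cast; ring
    rwa [this] at h
  have hle : R.F r (-(t : ℝ)) ≤ ‹MeasurableSpace Ω› := R.F_le _ _ hrt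
  have hY0 : Measurable Y := hY.mono hle le_rfl
  have hne : ∀ᵐ ω ∂P, R.φ t (R.θ (-(t : ℝ)) ω) (Y ω) ≠ none := by
    filter_upwards [hR.ae_ne_none s r x, hR.ae_ne_none (t + s) r x] with ω h1 h2
    rw [R.φ_add_eq x₀ t h1, R.θ_θ] at h2
    have : (s : ℝ) + r = -(t : ℝ) := by rw [hr]; push_cast; ring
    rwa [this] at h2
  have hind : Indep (R.F (-(t : ℝ)) 0) (R.F r (-(t : ℝ))) P :=
    (R.F_indep r (-(t : ℝ)) (-(t : ℝ)) 0 hrt le_rfl (by simp)).symm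
  have key := integral_mul_integral_of_indep (R.F_neg_le t) hle hind hW hC
    (R.measurable_pullback x₀ t) (R.measurable_pullback_F x₀ t)
    (κ := fun ω => Measure.dirac (Y ω)) (Measure.measurable_dirac.comp hY) (fun ω => by simp)
    (by
      filter_upwards [hne] with ω hω
      rw [ae_dirac_eq]
      exact R.continuousAt_flow x₀ hω)
    (Eventually.of_forall fun y => by
      filter_upwards [hR.ae_ne_none t (-(t : ℝ)) y] with ω hω
      exact R.continuousAt_flow x₀ hω) f
  rw [Measure.bind_dirac_eq_map _ hY0,
    integral_map hY0.aemeasurable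
      (measurable_integral_mul_pullback x₀ hW0 t f).aestronglyMeasurable] at key
  simp only [integral_dirac] at key
  have h1 : ∫ ω, W ω * f (R.pullback x₀ (t + s) ω x) ∂P
      = ∫ ω, W ω * f (R.pullback x₀ t ω (Y ω)) ∂P := by
    refine integral_congr_ae ?_
    filter_upwards [hR.ae_ne_none s r x] with ω hω
    rw [R.pullback_add x₀ t hω]
  rw [h1, key, hR.semigroup_eq x₀]
  have hmp := R.measurePreserving_θ r
  have hm : AEStronglyMeasurable (fun ω' => ∫ ω, W ω * f (R.pullback x₀ t ω
      (R.flow x₀ s ω' x)) ∂P) (P.map (R.θ r)) :=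
    ((measurable_integral_mul_pullback x₀ hW0 t f).comp
      ((R.measurable_flow_uncurry x₀ s).comp measurable_prodMk_right)).aestronglyMeasurable
  have := integral_map hmp.measurable.aemeasurable hm
  rw [hmp.map_eq] at this
  exact this.symm

variable {ρ : Measure E} [IsProbabilityMeasure ρ]

theorem integral_mul_integral_pullbackLaw {W : Ω → ℝ} (hW : Measurable W) {C : ℝ}
    (hC : ∀ ω, |W ω| ≤ C) (t : ℝ≥0) (f : E →ᵇ ℝ) :
    ∫ ω, W ω * ∫ y, f y ∂(R.pullbackLaw x₀ ρ t ω) ∂P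
      = ∫ x, ∫ ω, W ω * f (R.pullback x₀ t ω x) ∂P ∂ρ := by
  simp_rw [R.integral_pullbackLaw, ← integral_const_mul]
  refine integral_integral_swap (f := fun ω x => W ω * f (R.pullback x₀ t ω x)) ?_
  refine Integrable.of_bound ((hW.comp measurable_fst).mul (f.continuous.measurable.comp
    (R.measurable_pullback x₀ t))).aestronglyMeasurable (C * ‖f‖) (Eventually.of_forall fun p => ?_)
  rw [Function.uncurry, norm_mul]
  exact mul_le_mul (hC _) (f.norm_coe_le_norm _) (norm_nonneg _) ((abs_nonneg _).trans (hC p.1))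

/-- Integrals against the pullbacks of an invariant measure form a martingale. -/
theorem WeaklyComplete.integral_mul_pullbackLaw_add (hR : R.WeaklyComplete)
    (hρ : R.IsInvariantMeasure ρ) {t : ℝ≥0} {W : Ω → ℝ}
    (hW : Measurable[R.F (-(t : ℝ)) 0] W) {C : ℝ} (hC : ∀ ω, |W ω| ≤ C) (s : ℝ≥0) (f : E →ᵇ ℝ) :
    ∫ ω, W ω * ∫ y, f y ∂(R.pullbackLaw x₀ ρ (t + s) ω) ∂P
      = ∫ ω, W ω * ∫ y, f y ∂(R.pullbackLaw x₀ ρ t ω) ∂P := by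
  have hW0 : Measurable W := hW.mono (R.F_neg_le t) le_rfl
  rw [integral_mul_integral_pullbackLaw x₀ hW0 hC, integral_mul_integral_pullbackLaw x₀ hW0 hC]
  simp_rw [hR.integral_mul_pullback_add x₀ hW hC s f]
  exact hρ s _ (measurable_integral_mul_pullback x₀ hW0 t f)
    ⟨C * ‖f‖, abs_integral_mul_pullback_le x₀ hC t f⟩

theorem WeaklyComplete.bind_restrict_pullbackLaw (hR : R.WeaklyComplete)
    (hρ : R.IsInvariantMeasure ρ) {t : ℝ≥0} {A : Set Ω}
    (hA : MeasurableSet[R.F (-(t : ℝ)) 0] A) {s : ℝ≥0} (hts : t ≤ s) :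
    (P.restrict A).bind (R.pullbackLaw x₀ ρ s) = (P.restrict A).bind (R.pullbackLaw x₀ ρ t) := by
  obtain ⟨u, rfl⟩ := exists_add_of_le hts
  have hA0 : MeasurableSet A := R.F_neg_le t _ hA
  have hfin : ∀ r, IsFiniteMeasure ((P.restrict A).bind (R.pullbackLaw x₀ ρ r)) := fun r => ⟨by
    rw [Measure.bind_apply MeasurableSet.univ (R.measurable_pullbackLaw x₀ ρ r).aemeasurable]
    simp⟩
  have := hfin t
  have := hfin (t + u)
  refine ext_of_forall_integral_eq_of_IsFiniteMeasure fun f => ?_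
  have hb : ∀ y, |f y| ≤ ‖f‖ := fun y => f.norm_coe_le_norm y
  rw [integral_bind_eq (R.measurable_pullbackLaw x₀ ρ _) (fun ω => by simp)
      f.continuous.measurable hb,
    integral_bind_eq (R.measurable_pullbackLaw x₀ ρ _) (fun ω => by simp)
      f.continuous.measurable hb, ← integral_indicator hA0, ← integral_indicator hA0]
  have h := hR.integral_mul_pullbackLaw_add (ρ := ρ) x₀ hρ (W := A.indicator fun _ => 1) (C := 1)
    (by rw [measurable_indicator_const_iff]; exact hA)
    (fun ω => by by_cases h : ω ∈ A <;> simp [h]) u f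
  have e : ∀ (g : Ω → ℝ) ω, A.indicator (fun _ => (1 : ℝ)) ω * g ω = A.indicator g ω := by
    intro g ω
    by_cases h : ω ∈ A <;> simp [h]
  exact (integral_congr_ae (.of_forall fun ω => (e _ ω).symm)).trans
    (h.trans (integral_congr_ae (.of_forall (e fun ω => ∫ y, f y ∂(R.pullbackLaw x₀ ρ t ω)))))

theorem WeaklyComplete.bind_pullbackLaw (hR : R.WeaklyComplete)
    (hρ : R.IsInvariantMeasure ρ) (t : ℝ≥0) : P.bind (R.pullbackLaw x₀ ρ t) = ρ := by
  have h := hR.bind_restrict_pullbackLaw (ρ := ρ) x₀ hρ (t := 0) (A := univ)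
    (@MeasurableSet.univ _ (R.F (-((0 : ℝ≥0) : ℝ)) 0)) (zero_le : 0 ≤ t)
  rw [Measure.restrict_univ] at h
  rw [h]
  have : ∀ ω, R.pullbackLaw x₀ ρ 0 ω = ρ := fun ω => by
    have : R.pullback x₀ 0 ω = id := funext fun x => by rw [pullback, flow_zero, id]
    rw [pullbackLaw, this, Measure.map_id]
  rw [show R.pullbackLaw x₀ ρ 0 = fun _ => ρ from funext this, Measure.bind_const]
  simp

end WhiteNoiseLocalRDS

/-! ### Existence of the statistical equilibrium -/

/-- If `Z(·, y)` is measurable for each `y`, then the image of `ρ` under `Z(ω, ·)` has a measurable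
version, provided that `Z(ω, ·)` is continuous at `ρ`-almost every point. -/
theorem exists_measurable_map_version {Ω : Type*} [MeasurableSpace Ω] {E : Type*} [MetricSpace E]
    [CompleteSpace E] [SecondCountableTopology E] [MeasurableSpace E] [BorelSpace E]
    (ρ : Measure E) [IsProbabilityMeasure ρ] {Z : Ω → E → E} (hZ : ∀ y, Measurable fun ω => Z ω y) :
    ∃ ν : Ω → Measure E, Measurable ν ∧ (∀ ω, IsProbabilityMeasure (ν ω)) ∧
      ∀ ω, (∀ᵐ y ∂ρ, ContinuousAt (Z ω) y) → ν ω = ρ.map (Z ω) := by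
  have : Nonempty E := nonempty_of_isProbabilityMeasure ρ
  obtain ⟨s, hs⟩ := exists_simpleFunc_tendsto_id E
  have hm : ∀ n, Measurable fun p : Ω × E => Z p.1 (s n p.2) := by
    intro n B hB
    have : (fun p : Ω × E => Z p.1 (s n p.2)) ⁻¹' B
        = ⋃ v ∈ (s n).range, ((fun ω => Z ω v) ⁻¹' B) ×ˢ (s n ⁻¹' {v}) := by
      ext p
      simp only [mem_preimage, mem_iUnion, mem_prod, mem_singleton_iff, exists_prop]
      exact ⟨fun h => ⟨_, (s n).mem_range_self p.2, h, rfl⟩, by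
        rintro ⟨v, -, h, rfl⟩; exact h⟩
    rw [this]
    exact Finset.measurableSet_biUnion _ fun v _ => (hZ v hB).prod ((s n).measurableSet_fiber v)
  obtain ⟨G, hG, hG'⟩ := exists_measurable_limit hm
  refine ⟨fun ω => ρ.map fun y => G (ω, y), ?_, fun ω =>
    Measure.isProbabilityMeasure_map (hG.comp measurable_prodMk_left).aemeasurable, fun ω hω => ?_⟩
  · refine Measure.measurable_of_measurable_coe _ fun B hB => ?_
    have : ∀ ω, (ρ.map fun y => G (ω, y)) B = ρ (Prod.mk ω ⁻¹' (G ⁻¹' B)) := fun ω => by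
      rw [Measure.map_apply (f := fun y => G (ω, y)) (hG.comp measurable_prodMk_left) hB]
      rfl
    simp_rw [this]
    exact measurable_measure_prodMk_left (hG hB)
  · refine Measure.map_congr ?_
    filter_upwards [hω] with y hy
    exact hG' (ω, y) _ (hy.tendsto.comp (hs y))

theorem exists_countable_isTopologicalBasis_isPiSystem (E : Type*) [TopologicalSpace E]
    [SecondCountableTopology E] :
    ∃ S : Set (Set E), S.Countable ∧ IsPiSystem S ∧ TopologicalSpace.IsTopologicalBasis S := by
  obtain ⟨b, hbc, -, hb⟩ := TopologicalSpace.exists_countable_basis E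
  refine ⟨sInter '' {F | F.Finite ∧ F ⊆ b}, (countable_ofPred_finite_subset hbc).image _, ?_, ?_⟩
  · rintro _ ⟨F, ⟨hF, hFb⟩, rfl⟩ _ ⟨F', ⟨hF', hFb'⟩, rfl⟩ -
    exact ⟨F ∪ F', ⟨hF.union hF', union_subset hFb hFb'⟩, sInter_union F F'⟩
  · refine TopologicalSpace.isTopologicalBasis_of_isOpen_of_nhds ?_ fun x U hx hU => ?_
    · rintro _ ⟨F, ⟨hF, hFb⟩, rfl⟩
      exact hF.isOpen_sInter fun U hU => hb.isOpen (hFb hU)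
    · obtain ⟨v, hv, hxv, hvU⟩ := hb.exists_subset_of_mem_open hx hU
      exact ⟨v, ⟨{v}, ⟨finite_singleton v, by simpa using hv⟩, sInter_singleton v⟩, hxv, hvU⟩

/-- For weak convergence it suffices to have convergence on countably many open sets, so that
setwise almost sure convergence implies almost sure weak convergence. -/
theorem ae_tendsto_integral_of_ae_tendsto_measure {Ω : Type*} [MeasurableSpace Ω] {P : Measure Ω}
    {E : Type*} [MetricSpace E] [SecondCountableTopology E] [MeasurableSpace E] [BorelSpace E]
    {N : ℕ → Ω → Measure E} {μ : Ω → Measure E} (hN : ∀ n ω, IsProbabilityMeasure (N n ω))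
    (hμ : ∀ ω, IsProbabilityMeasure (μ ω))
    (h : ∀ B, MeasurableSet B → ∀ᵐ ω ∂P, Tendsto (fun n => N n ω B) atTop (𝓝 (μ ω B))) :
    ∀ᵐ ω ∂P, ∀ f : E →ᵇ ℝ, Tendsto (fun n => ∫ x, f x ∂N n ω) atTop (𝓝 (∫ x, f x ∂μ ω)) := by
  obtain ⟨S, hSc, hSpi, hS⟩ := exists_countable_isTopologicalBasis_isPiSystem E
  have hall : ∀ᵐ ω ∂P, ∀ U ∈ S, Tendsto (fun n => N n ω U) atTop (𝓝 (μ ω U)) :=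
    (ae_ball_iff hSc).2 fun U hU => h U (hS.isOpen hU).measurableSet
  filter_upwards [hall] with ω hω
  have key : Tendsto (β := ProbabilityMeasure E) (fun n => ⟨N n ω, hN n ω⟩) atTop
      (𝓝 ⟨μ ω, hμ ω⟩) := by
    refine hSpi.tendsto_probabilityMeasure_of_tendsto_of_mem
      (fun U hU => (hS.isOpen hU).measurableSet) (fun u hu x hx => ?_) fun U hU => ?_
    · obtain ⟨v, hv, hxv, hvu⟩ := hS.exists_subset_of_mem_open hx hu
      exact ⟨v, hv, (hS.isOpen hv).mem_nhds hxv, hvu⟩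
    · have := hμ ω
      exact (ENNReal.tendsto_toNNReal (measure_ne_top (μ ω) U)).comp (hω U hU)
  exact ProbabilityMeasure.tendsto_iff_forall_integral_tendsto.1 key

theorem measurableSet_exists_tendsto_apply {Ω E : Type*} {_ : MeasurableSpace Ω}
    [MeasurableSpace E] {N : ℕ → Ω → Measure E} (hN : ∀ n, Measurable (N n)) {B : Set E}
    (hB : MeasurableSet B) :
    MeasurableSet {ω | ∃ c, Tendsto (fun n => N n ω B) atTop (𝓝 c)} :=
  measurableSet_exists_tendsto fun n => (Measure.measurable_coe hB).comp (hN n)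

theorem ae_trim_of_ae {α : Type*} {m m₀ : MeasurableSpace α} {μ : Measure α} (hm : m ≤ m₀)
    {p : α → Prop} (hp : MeasurableSet[m] {x | p x}) (h : ∀ᵐ x ∂μ, p x) :
    ∀ᵐ x ∂μ.trim hm, p x := by
  have hc : MeasurableSet[m] {x | p x}ᶜ := hp.compl
  exact (trim_measurableSet_eq hm hc).trans h

namespace WhiteNoiseLocalRDS

variable {Ω : Type*} [MeasurableSpace Ω] {P : Measure Ω} [IsProbabilityMeasure P]
  {E : Type*} [MetricSpace E] [CompleteSpace E] [SecondCountableTopology E]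
  [MeasurableSpace E] [BorelSpace E] {R : WhiteNoiseLocalRDS Ω P E} (x₀ : E)
  {ρ : Measure E} [IsProbabilityMeasure ρ]

/-- The pullback of `ρ` depends on the noise between the times `-t` and `0` only, up to a null set.
The passage to a version is needed as only the maps `φ_t(·, x)` are adapted, for fixed `x`. -/
theorem WeaklyComplete.exists_adapted_version (hR : R.WeaklyComplete) (ρ : Measure E)
    [IsProbabilityMeasure ρ] (t : ℝ≥0) :
    ∃ ν : Ω → Measure E, Measurable[R.F (-(t : ℝ)) 0] ν ∧ (∀ ω, IsProbabilityMeasure (ν ω)) ∧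
      ∀ᵐ ω ∂P, ν ω = R.pullbackLaw x₀ ρ t ω := by
  obtain ⟨ν, h1, h2, h3⟩ := @exists_measurable_map_version Ω (R.F (-(t : ℝ)) 0) E _ _ _ _ _ ρ _ _
    (R.measurable_pullback_F x₀ t)
  refine ⟨ν, h1, h2, ?_⟩
  filter_upwards [hR.ae_ae_ne_none ρ t (-(t : ℝ))] with ω hω
  refine h3 ω ?_
  filter_upwards [hω] with y hy
  exact R.continuousAt_flow x₀ hy

/-- Martingale convergence along an increasing sequence of times. -/
theorem WeaklyComplete.ae_exists_tendsto_of_monotone (hR : R.WeaklyComplete)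
    (hρ : R.IsInvariantMeasure ρ) {s : ℕ → ℝ≥0} (hs : Monotone s) {B : Set E}
    (hB : MeasurableSet B) :
    ∀ᵐ ω ∂P, ∃ c, Tendsto (fun n => R.pullbackLaw x₀ ρ (s n) ω B) atTop (𝓝 c) := by
  choose ν hνm hνp hν using fun n => hR.exists_adapted_version x₀ ρ (s n)
  let ℱ : Filtration ℕ ‹MeasurableSpace Ω› :=
    { seq := fun n => R.F (-(s n : ℝ)) 0
      mono' := fun i j hij => R.F_neg_mono (hs hij)
      le' := fun n => R.F_neg_le (s n) }
  set f : ℕ → Ω → ℝ := fun n ω => (ν n ω).real B with hf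
  have hfm : ∀ n, Measurable[ℱ n] (f n) := fun n =>
    ((Measure.measurable_coe hB).comp (hνm n)).ennreal_toReal
  have hfb : ∀ n ω, ‖f n ω‖ ≤ 1 := fun n ω => by
    have := hνp n ω
    rw [Real.norm_eq_abs, abs_of_nonneg measureReal_nonneg]
    exact measureReal_le_one
  have hint : ∀ n, Integrable (f n) P := fun n =>
    Integrable.of_bound ((hfm n).mono (ℱ.le n) le_rfl).aestronglyMeasurable 1
      (Eventually.of_forall (hfb n))
  have hset : ∀ n A, MeasurableSet A → ∫ ω in A, f n ω ∂P
      = ((P.restrict A).bind (R.pullbackLaw x₀ ρ (s n)) B).toReal := by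
    intro n A hA
    rw [Measure.bind_apply hB (R.measurable_pullbackLaw x₀ ρ (s n)).aemeasurable,
      integral_eq_lintegral_of_nonneg_ae (Eventually.of_forall fun _ => measureReal_nonneg)
        (hint n).aestronglyMeasurable.restrict]
    congr 1
    refine lintegral_congr_ae (ae_restrict_of_ae ?_)
    filter_upwards [hν n] with ω hω
    have := hνp n ω
    rw [ofReal_measureReal, hω]
  have hmart : Martingale f ℱ P := by
    refine martingale_of_setIntegral_eq_succ (fun n => (hfm n).stronglyMeasurable) hint ?_
    intro n A hA
    have hA0 : MeasurableSet A := ℱ.le n A hA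
    rw [hset n A hA0, hset (n + 1) A hA0,
      hR.bind_restrict_pullbackLaw x₀ hρ hA (hs (Nat.le_succ n))]
  have hlim := hmart.submartingale.ae_tendsto_limitProcess (R := 1) fun n => by
    refine (eLpNorm_le_of_ae_bound (C := 1) (Eventually.of_forall (hfb n))).trans ?_
    simp
  filter_upwards [hlim, ae_all_iff.2 hν] with ω hω hνω
  refine ⟨_, (ENNReal.tendsto_ofReal hω).congr fun n => ?_⟩
  have := hνp n ω
  rw [ofReal_measureReal, hνω n]

/-- The pullbacks of an invariant measure converge setwise, hence weakly, to a random probability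
measure, along every sequence of times tending to infinity. -/
theorem WeaklyComplete.exists_isStatisticalEquilibrium (hR : R.WeaklyComplete)
    (hρ : R.IsInvariantMeasure ρ) : ∃ μ : Ω → Measure E, R.IsStatisticalEquilibrium ρ μ := by
  obtain ⟨x₀⟩ : Nonempty E := nonempty_of_isProbabilityMeasure ρ
  choose ν hνm hνp hν using fun n : ℕ => hR.exists_adapted_version x₀ ρ (n : ℝ≥0)
  have hmono : Monotone ((↑) : ℕ → ℝ≥0) := Nat.mono_cast
  have hνm' : ∀ n, Measurable[R.past 0] (ν n) := fun n => (hνm n).mono (R.F_neg_le_past n) le_rfl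
  have hbind : ∀ n, (P.trim (R.past_le 0)).bind (ν n) = ρ := by
    intro n
    rw [← hR.bind_pullbackLaw (ρ := ρ) x₀ hρ n]
    ext B hB
    rw [Measure.bind_apply hB (hνm' n).aemeasurable,
      Measure.bind_apply hB (R.measurable_pullbackLaw x₀ ρ n).aemeasurable,
      lintegral_trim (f := fun ω => ν n ω B) (R.past_le 0)
        ((Measure.measurable_coe hB).comp (hνm' n))]
    refine lintegral_congr_ae ?_
    filter_upwards [hν n] with ω hω
    rw [hω]
  have hconv : ∀ B, MeasurableSet B →
      ∀ᵐ ω ∂P.trim (R.past_le 0), ∃ c, Tendsto (fun n => ν n ω B) atTop (𝓝 c) := by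
    intro B hB
    refine ae_trim_of_ae (R.past_le 0) (measurableSet_exists_tendsto_apply hνm' hB) ?_
    filter_upwards [hR.ae_exists_tendsto_of_monotone (ρ := ρ) x₀ hρ hmono hB,
      ae_all_iff.2 hν] with ω ⟨c, hc⟩ hω
    exact ⟨c, by simpa only [hω] using hc⟩
  obtain ⟨μ, hμm, hμp, hμ⟩ := @exists_random_setwise_limit Ω (R.past 0) (P.trim (R.past_le 0)) E _ _
    ⟨x₀⟩ ν ρ _ hνm' hνp hbind hconv
  refine ⟨μ, hμp, hμm, fun t ht => ?_⟩
  have hset : ∀ B, MeasurableSet B →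
      ∀ᵐ ω ∂P, Tendsto (fun k => R.pullbackLaw x₀ ρ (t k) ω B) atTop (𝓝 (μ ω B)) := by
    intro B hB
    -- Along a sequence containing both `t` and the integers the limits agree.
    obtain ⟨s, hs, ⟨i, hi, hsi⟩, j, hj, hsj⟩ := exists_monotone_enumeration t ht
    filter_upwards [hR.ae_exists_tendsto_of_monotone (ρ := ρ) x₀ hρ hs hB, ae_all_iff.2 hν,
      ae_of_ae_trim (R.past_le 0) (hμ B hB)] with ω ⟨c, hc⟩ hω hμω
    have h1 : Tendsto (fun n => ν n ω B) atTop (𝓝 c) := by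
      refine (hc.comp hi).congr fun n => ?_
      rw [Function.comp_apply, hsi n, hω n]
    rw [tendsto_nhds_unique hμω h1]
    exact (hc.comp hj).congr fun k => by rw [Function.comp_apply, hsj k]
  have hae : ∀ᵐ ω ∂P, ∀ k, ∀ᵐ x ∂ρ, R.φ (t k) (R.θ (-(t k : ℝ)) ω) x ≠ none :=
    ae_all_iff.2 fun k => hR.ae_ae_ne_none ρ (t k) _
  filter_upwards [ae_tendsto_integral_of_ae_tendsto_measure (fun k ω => inferInstance) hμp hset,
    hae] with ω hω hne f
  refine (hω f).congr fun k => ?_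
  rw [R.integral_pullbackLaw]
  refine integral_congr_ae ?_
  filter_upwards [hne k] with x hx
  rw [R.some_flow x₀ hx]
  rfl

end WhiteNoiseLocalRDS

/-! ### Stable convergence of the pullback flow -/

theorem measurable_integral_of_measurable {Ω E : Type*} {_ : MeasurableSpace Ω} [MeasurableSpace E]
    {κ : Ω → Measure E} (hκ : Measurable κ) (hκ₁ : ∀ ω, κ ω univ ≤ 1) {f : E → ℝ}
    (hf : Measurable f) : Measurable fun ω => ∫ y, f y ∂κ ω := by
  let η : Kernel Ω E := ⟨κ, hκ⟩
  have hη : IsFiniteKernel η := ⟨1, ENNReal.one_lt_top, hκ₁⟩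
  exact (hf.stronglyMeasurable.integral_kernel (κ := η)).measurable

theorem abs_integral_le_norm {E : Type*} [TopologicalSpace E] [MeasurableSpace E] {κ : Measure E}
    (hκ : κ univ ≤ 1) (f : E →ᵇ ℝ) : |∫ y, f y ∂κ| ≤ ‖f‖ := by
  have hκ' : IsFiniteMeasure κ := ⟨hκ.trans_lt ENNReal.one_lt_top⟩
  refine (norm_integral_le_of_norm_le_const (Eventually.of_forall f.norm_coe_le_norm)).trans ?_
  have : κ.real univ ≤ 1 := ENNReal.toReal_le_of_le_ofReal zero_le_one (by simpa using hκ)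
  simpa using mul_le_mul_of_nonneg_left this (norm_nonneg f)

theorem abs_integral_mul_sub_le {Ω : Type*} [MeasurableSpace Ω] {P : Measure Ω}
    [IsProbabilityMeasure P] {V W g : Ω → ℝ} {C K : ℝ} (hV : Measurable V) (hW : Measurable W)
    (hg : Measurable g) (hVC : ∀ ω, |V ω| ≤ C) (hWC : ∀ ω, |W ω| ≤ C) (hgK : ∀ ω, |g ω| ≤ K) :
    |∫ ω, V ω * g ω ∂P - ∫ ω, W ω * g ω ∂P| ≤ K * ∫ ω, |V ω - W ω| ∂P := by
  have hint : ∀ {U : Ω → ℝ}, Measurable U → (∀ ω, |U ω| ≤ C) →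
      Integrable (fun ω => U ω * g ω) P := fun hU hUC =>
    Integrable.of_bound (hU.mul hg).aestronglyMeasurable (C * K) (Eventually.of_forall fun ω => by
      rw [norm_mul]
      exact mul_le_mul (hUC ω) (hgK ω) (norm_nonneg _) ((abs_nonneg _).trans (hUC ω)))
  have hVi : Integrable V P := Integrable.of_bound hV.aestronglyMeasurable C (.of_forall hVC)
  have hWi : Integrable W P := Integrable.of_bound hW.aestronglyMeasurable C (.of_forall hWC)
  rw [← integral_sub (hint hV hVC) (hint hW hWC), ← integral_const_mul]
  refine (abs_integral_le_integral_abs).trans (integral_mono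
    ((hint hV hVC).sub (hint hW hWC)).abs ((hVi.sub hWi).abs.const_mul K) fun ω => ?_)
  rw [← sub_mul, abs_mul, mul_comm]
  exact mul_le_mul_of_nonneg_right (hgK ω) (abs_nonneg _)

namespace WhiteNoiseLocalRDS

variable {Ω : Type*} [MeasurableSpace Ω] {P : Measure Ω}
  {E : Type*} [MetricSpace E] [MeasurableSpace E] {R : WhiteNoiseLocalRDS Ω P E}

theorem IsStatisticalEquilibrium.measurable' {ρ : Measure E} {μ : Ω → Measure E}
    (hμ : R.IsStatisticalEquilibrium ρ μ) :
    Measurable μ := hμ.measurable.mono (R.past_le 0) le_rfl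

theorem IsStatisticalEquilibrium.measure_univ_le {ρ : Measure E} {μ : Ω → Measure E}
    (hμ : R.IsStatisticalEquilibrium ρ μ) (ω : Ω) :
    μ ω univ ≤ 1 := have := hμ.isProbabilityMeasure ω; prob_le_one

variable [IsProbabilityMeasure P]

/-- Bounded functions of the past are limits in mean of bounded functions of the finite past. -/
theorem exists_tendsto_of_measurable_past (R : WhiteNoiseLocalRDS Ω P E) {W : Ω → ℝ}
    (hW : Measurable[R.past 0] W) {C : ℝ} (hC : ∀ ω, |W ω| ≤ C) :
    ∃ V : ℕ → Ω → ℝ, (∀ n : ℕ, Measurable[R.F (-((n : ℝ≥0) : ℝ)) 0] (V n)) ∧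
      (∀ n ω, |V n ω| ≤ C) ∧ Tendsto (fun n => ∫ ω, |V n ω - W ω| ∂P) atTop (𝓝 0) := by
  have hC0 : 0 ≤ C := by
    obtain ⟨ω⟩ : Nonempty Ω := nonempty_of_isProbabilityMeasure P
    exact (abs_nonneg _).trans (hC ω)
  let ℱ : Filtration ℕ ‹MeasurableSpace Ω› :=
    { seq := fun n => R.F (-((n : ℝ≥0) : ℝ)) 0
      mono' := fun i j hij => R.F_neg_mono (by exact_mod_cast hij)
      le' := fun n => R.F_neg_le _ }
  have hsup : ⨆ n, ℱ n = R.past 0 := R.past_zero_eq.symm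
  have hW0 : Measurable W := hW.mono (R.past_le 0) le_rfl
  have hWi : Integrable W P := Integrable.of_bound hW0.aestronglyMeasurable C (.of_forall hC)
  have hlim := tendsto_ae_condExp (μ := P) (ℱ := ℱ) W
  rw [hsup, condExp_of_stronglyMeasurable (R.past_le 0) hW.stronglyMeasurable hWi] at hlim
  have hVm : ∀ n : ℕ, Measurable[R.F (-((n : ℝ≥0) : ℝ)) 0] fun ω =>
      max (-C) (min C ((P[W|ℱ n]) ω)) :=
    fun n => measurable_const.max (measurable_const.min
      (stronglyMeasurable_condExp (m := ℱ n) (μ := P) (f := W)).measurable)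
  have hVb : ∀ n ω, |max (-C) (min C ((P[W|ℱ n]) ω))| ≤ C := fun n ω =>
    abs_le.2 ⟨le_max_left _ _, max_le (by linarith) (min_le_left _ _)⟩
  -- The conditional expectations are truncated to obtain a bound at every point.
  refine ⟨fun n ω => max (-C) (min C ((P[W|ℱ n]) ω)), hVm, hVb, ?_⟩
  have h0 : (0 : ℝ) = ∫ ω, (0 : ℝ) ∂P := by simp
  rw [h0]
  refine tendsto_integral_of_dominated_convergence (fun _ => 2 * C) (fun n => ?_)
    (integrable_const _) (fun n => Eventually.of_forall fun ω => ?_) ?_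
  · exact (((hVm n).mono (R.F_neg_le _) le_rfl).sub hW0).abs.aestronglyMeasurable
  · rw [Real.norm_eq_abs, abs_abs]
    refine (abs_sub _ _).trans ?_
    linarith [hVb n ω, hC ω]
  · filter_upwards [hlim] with ω hω
    have h1 := ((((continuous_const (y := -C)).max
      ((continuous_const (y := C)).min continuous_id)).tendsto _).comp hω).sub_const (W ω) |>.abs
    have h2 : max (-C) (min C (W ω)) = W ω := by
      rw [min_eq_right (abs_le.1 (hC ω)).2, max_eq_right (abs_le.1 (hC ω)).1]
    simpa only [Function.comp_apply, id, h2, sub_self, abs_zero] using h1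

variable [SecondCountableTopology E] [BorelSpace E] {ρ : Measure E} [IsProbabilityMeasure ρ]
  {μ : Ω → Measure E} (x₀ : E)

theorem IsStatisticalEquilibrium.tendsto_pullbackLaw (hR : R.WeaklyComplete)
    (hμ : R.IsStatisticalEquilibrium ρ μ) {t : ℕ → ℝ≥0} (ht : Tendsto t atTop atTop) :
    ∀ᵐ ω ∂P, ∀ f : E →ᵇ ℝ, Tendsto (fun k => ∫ y, f y ∂(R.pullbackLaw x₀ ρ (t k) ω)) atTop
      (𝓝 (∫ y, f y ∂μ ω)) := by
  have hae : ∀ᵐ ω ∂P, ∀ k, ∀ᵐ x ∂ρ, R.φ (t k) (R.θ (-(t k : ℝ)) ω) x ≠ none :=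
    ae_all_iff.2 fun k => hR.ae_ae_ne_none ρ (t k) _
  filter_upwards [hμ.tendsto t ht, hae] with ω hω hne f
  refine (hω f).congr fun k => ?_
  rw [R.integral_pullbackLaw]
  refine integral_congr_ae ?_
  filter_upwards [hne k] with x hx
  rw [R.some_flow x₀ hx]
  rfl

/-- The statistical equilibrium closes the martingale of pullbacks. -/
theorem IsStatisticalEquilibrium.integral_mul_eq (hR : R.WeaklyComplete)
    (hρ : R.IsInvariantMeasure ρ) (hμ : R.IsStatisticalEquilibrium ρ μ) {t : ℝ≥0} {W : Ω → ℝ}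
    (hW : Measurable[R.F (-(t : ℝ)) 0] W) {C : ℝ} (hC : ∀ ω, |W ω| ≤ C) (f : E →ᵇ ℝ) :
    ∫ ω, W ω * ∫ y, f y ∂μ ω ∂P = ∫ ω, W ω * ∫ y, f y ∂(R.pullbackLaw x₀ ρ t ω) ∂P := by
  have hW0 : Measurable W := hW.mono (R.F_neg_le t) le_rfl
  have ht : Tendsto (fun n : ℕ => t + (n : ℝ≥0)) atTop atTop :=
    tendsto_atTop_mono (fun _ => le_add_self) tendsto_natCast_atTop_atTop
  have hlim : Tendsto (fun n : ℕ => ∫ ω, W ω * ∫ y, f y ∂(R.pullbackLaw x₀ ρ (t + n) ω) ∂P) atTop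
      (𝓝 (∫ ω, W ω * ∫ y, f y ∂μ ω ∂P)) := by
    refine tendsto_integral_of_dominated_convergence (fun _ => C * ‖f‖) (fun n => ?_)
      (integrable_const _) (fun n => Eventually.of_forall fun ω => ?_) ?_
    · exact (hW0.mul (measurable_integral_of_measurable (R.measurable_pullbackLaw x₀ ρ _)
        (fun ω => by simp) f.continuous.measurable)).aestronglyMeasurable
    · rw [norm_mul]
      exact mul_le_mul (hC ω) (abs_integral_le_norm (by simp) f) (norm_nonneg _)
        ((abs_nonneg _).trans (hC ω))
    · filter_upwards [hμ.tendsto_pullbackLaw x₀ hR ht] with ω hω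
      exact (hω f).const_mul _
  have e := fun n : ℕ => hR.integral_mul_pullbackLaw_add (ρ := ρ) x₀ hρ hW hC (n : ℝ≥0) f
  simp only [e] at hlim
  exact (tendsto_nhds_unique tendsto_const_nhds hlim).symm

/-- Started from a point of the convergence set, the pullback flow converges stably with respect to
the past: jointly with every functional of the past, it converges in law to a point sampled from the
statistical equilibrium. -/
theorem IsStatisticalEquilibrium.tendsto_integral_mul_pullback (hR : R.WeaklyComplete)
    (hρ : R.IsInvariantMeasure ρ) (hμ : R.IsStatisticalEquilibrium ρ μ) {W : Ω → ℝ}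
    (hW : Measurable[R.past 0] W) {C : ℝ} (hC : ∀ ω, |W ω| ≤ C) (f : E →ᵇ ℝ) {x : E}
    (hx : x ∈ R.convergenceSet ρ) :
    Tendsto (fun s => ∫ ω, W ω * f (R.pullback x₀ s ω x) ∂P) atTop
      (𝓝 (∫ ω, W ω * ∫ y, f y ∂μ ω ∂P)) := by
  have step : ∀ {t : ℝ≥0} {V : Ω → ℝ}, Measurable[R.F (-(t : ℝ)) 0] V → (∀ ω, |V ω| ≤ C) →
      Tendsto (fun s => ∫ ω, V ω * f (R.pullback x₀ s ω x) ∂P) atTop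
        (𝓝 (∫ ω, V ω * ∫ y, f y ∂μ ω ∂P)) := by
    intro t V hV hVC
    have hV0 : Measurable V := hV.mono (R.F_neg_le t) le_rfl
    let h : E →ᵇ ℝ := BoundedContinuousFunction.ofNormedAddCommGroup
      (fun y => ∫ ω, V ω * f (R.pullback x₀ t ω y) ∂P)
      (hR.continuous_integral_mul_pullback x₀ hV0 hVC t f) (C * ‖f‖)
      (abs_integral_mul_pullback_le x₀ hVC t f)
    -- For `s ≥ t`, the Markov property at time `-t` turns the expectation into `P_{s-t} h x`.
    have h1 : Tendsto (fun s => R.semigroup s h x) atTop (𝓝 (∫ y, h y ∂ρ)) := hx h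
    have h2 : ∫ y, h y ∂ρ = ∫ ω, V ω * ∫ y, f y ∂μ ω ∂P := by
      rw [hμ.integral_mul_eq x₀ hR hρ hV hVC, integral_mul_integral_pullbackLaw x₀ hV0 hVC]
      rfl
    rw [h2] at h1
    have hsub : Tendsto (fun s : ℝ≥0 => s - t) atTop atTop := tendsto_atTop.2 fun b => by
      filter_upwards [eventually_ge_atTop (b + t)] with s hs
      exact le_tsub_of_add_le_right hs
    refine (h1.comp hsub).congr' ?_
    filter_upwards [eventually_ge_atTop t] with s hs
    have h3 := hR.integral_mul_pullback_add x₀ hV hVC (s - t) f x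
    rw [add_tsub_cancel_of_le hs] at h3
    exact h3.symm
  obtain ⟨V, hVm, hVC, hV⟩ := R.exists_tendsto_of_measurable_past hW hC
  have hW0 : Measurable W := hW.mono (R.past_le 0) le_rfl
  have hVm0 : ∀ n, Measurable (V n) := fun n => (hVm n).mono (R.F_neg_le _) le_rfl
  rw [Metric.tendsto_atTop]
  intro ε hε
  have hsmall : Tendsto (fun n => ‖f‖ * ∫ ω, |V n ω - W ω| ∂P) atTop (𝓝 0) := by
    simpa using hV.const_mul ‖f‖
  obtain ⟨n, hn⟩ := (hsmall.eventually_lt_const (show (0 : ℝ) < ε / 3 by linarith)).exists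
  obtain ⟨S, hS⟩ := Metric.tendsto_atTop.1 (step (hVm n) (hVC n)) (ε / 3) (by linarith)
  refine ⟨S, fun s hs => ?_⟩
  have e1 := abs_integral_mul_sub_le (P := P) (hVm0 n) hW0
    (f.continuous.measurable.comp (R.measurable_pullback_left x₀ s x)) (hVC n) hC
    (fun ω => f.norm_coe_le_norm (R.pullback x₀ s ω x))
  have e2 := abs_integral_mul_sub_le (P := P) (hVm0 n) hW0
    (measurable_integral_of_measurable hμ.measurable' hμ.measure_univ_le f.continuous.measurable)
    (hVC n) hC (fun ω => abs_integral_le_norm (hμ.measure_univ_le ω) f)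
  have e3 := hS s hs
  rw [Real.dist_eq] at e3 ⊢
  simp only [Function.comp_apply] at e1
  rw [abs_le] at e1 e2
  rw [abs_lt] at e3 ⊢
  constructor <;> linarith [e1.1, e1.2, e2.1, e2.2, e3.1, e3.2]

end WhiteNoiseLocalRDS

/-! ### Attraction, invariance and minimality of the support -/

/-- A continuous cut-off between the concentric balls of radius `r` and `2 r`. -/
def ballCutoff {E : Type*} [MetricSpace E] (y : E) (r : ℝ) : E →ᵇ ℝ :=
  BoundedContinuousFunction.ofNormedAddCommGroup (fun z => max 0 (min 1 (2 - dist z y / r)))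
    (by fun_prop) 1 fun z => by
      rw [Real.norm_eq_abs, abs_of_nonneg (le_max_left _ _)]
      exact max_le zero_le_one (min_le_left _ _)

theorem ballCutoff_nonneg {E : Type*} [MetricSpace E] (y : E) (r : ℝ) (z : E) :
    0 ≤ ballCutoff y r z := le_max_left _ _

theorem ballCutoff_eq_one {E : Type*} [MetricSpace E] {y z : E} {r : ℝ} (hr : 0 < r)
    (hz : dist z y ≤ r) : ballCutoff y r z = 1 := by
  have : dist z y / r ≤ 1 := (div_le_one hr).2 hz
  change max 0 (min 1 (2 - dist z y / r)) = 1
  rw [min_eq_left (by linarith), max_eq_right zero_le_one]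

theorem ballCutoff_eq_zero {E : Type*} [MetricSpace E] {y z : E} {r : ℝ} (hr : 0 < r)
    (hz : z ∉ Metric.ball y (2 * r)) : ballCutoff y r z = 0 := by
  have h : 2 * r ≤ dist z y := by simpa using hz
  have : 2 ≤ dist z y / r := (le_div_iff₀ hr).2 h
  change max 0 (min 1 (2 - dist z y / r)) = 0
  exact max_eq_left ((min_le_right _ _).trans (by linarith))

theorem measurable_infDist_support {Ω E : Type*} [MeasurableSpace Ω] [MetricSpace E]
    [SecondCountableTopology E] [MeasurableSpace E] [BorelSpace E] {μ : Ω → Measure E}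
    (hμ : Measurable μ) (hμ0 : ∀ ω, μ ω ≠ 0) (x : E) :
    Measurable fun ω => Metric.infDist x (μ ω).support := by
  refine measurable_of_Iio fun r => ?_
  have : (fun ω => Metric.infDist x (μ ω).support) ⁻¹' Iio r
      = {ω | 0 < μ ω (Metric.ball x r)} := by
    ext ω
    rw [mem_preimage, mem_Iio, Metric.infDist_lt_iff (Measure.nonempty_support (hμ0 ω))]
    constructor
    · rintro ⟨y, hy, hxy⟩
      exact Measure.mem_support_iff_forall y |>.1 hy _
        (Metric.isOpen_ball.mem_nhds (by rwa [Metric.mem_ball']))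
    · intro h
      obtain ⟨y, hy, hy'⟩ := Measure.nonempty_inter_support_of_pos h
      exact ⟨y, hy', by rwa [Metric.mem_ball'] at hy⟩
  rw [this]
  exact measurableSet_lt measurable_const ((Measure.measurable_coe measurableSet_ball).comp hμ)

/-- If `g` is continuous at every point of the compact support of `κ`, then it maps this support
onto the support of the image measure. -/
theorem image_support_eq_support_map {E : Type*} [MetricSpace E] [SecondCountableTopology E]
    [MeasurableSpace E] [BorelSpace E] {κ : Measure E} {g : E → E} (hg : Measurable g)
    (hc : ∀ x ∈ κ.support, ContinuousAt g x) (hK : IsCompact κ.support) :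
    g '' κ.support = (κ.map g).support := by
  refine Subset.antisymm ?_ ?_
  · rintro _ ⟨x, hx, rfl⟩
    refine (Measure.mem_support_iff_forall _).2 fun U hU => ?_
    have h1 : g ⁻¹' U ∈ 𝓝 x := hc x hx hU
    exact ((Measure.mem_support_iff_forall x).1 hx _ h1).trans_le
      (Measure.le_map_apply hg.aemeasurable U)
  · have hcl : IsClosed (g '' κ.support) :=
      (hK.image_of_continuousOn fun x hx => (hc x hx).continuousWithinAt).isClosed
    refine Measure.support_subset_of_isClosed hcl ?_
    rw [mem_ae_iff, Measure.map_apply hg hcl.measurableSet.compl]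
    refine measure_mono_null (fun x hx hx' => hx (mem_image_of_mem g hx')) ?_
    exact Measure.measure_compl_support

namespace WhiteNoiseLocalRDS

theorem le_extInfEDist_of_lt_infDist {Ω : Type*} [MeasurableSpace Ω] {P : Measure Ω} {E : Type*}
    [MetricSpace E] [MeasurableSpace E] {R : WhiteNoiseLocalRDS Ω P E} (x₀ : E)
    {t : ℝ≥0} {ω : Ω} {x : E} {A : Set E} {ε : ℝ}
    (h : ε < Metric.infDist (R.flow x₀ t ω x) A) :
    ENNReal.ofReal ε ≤ extInfEDist (R.φ t ω x) A := by
  rcases hφ : R.φ t ω x with _ | z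
  · exact le_top
  · have hz : R.flow x₀ t ω x = z := by simp [flow, hφ]
    rw [hz] at h
    exact ENNReal.ofReal_le_of_le_toReal h.le

theorem IsWeakPointAttractorOf.tendsto_measure_lt_infDist {Ω : Type*} [MeasurableSpace Ω]
    {P : Measure Ω} {E : Type*} [MetricSpace E] [MeasurableSpace E] {R : WhiteNoiseLocalRDS Ω P E}
    (x₀ : E) {S : Set E} {A : Ω → Set E}
    (hA : R.IsWeakPointAttractorOf S A) {x : E} (hx : x ∈ S) {ε : ℝ} (hε : 0 < ε) :
    Tendsto (fun t => P {ω | ε < Metric.infDist (R.pullback x₀ t ω x) (A ω)}) atTop (𝓝 0) :=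
  tendsto_of_tendsto_of_tendsto_of_le_of_le tendsto_const_nhds
    (hA.attracts x hx (ENNReal.ofReal ε) (ENNReal.ofReal_pos.2 hε)) (fun _ => zero_le)
    fun _ => measure_mono fun _ hω => R.le_extInfEDist_of_lt_infDist x₀ hω

variable {Ω : Type*} [MeasurableSpace Ω] {P : Measure Ω} [IsProbabilityMeasure P]
  {E : Type*} [MetricSpace E] [MeasurableSpace E] [BorelSpace E]
  {R : WhiteNoiseLocalRDS Ω P E} {ρ : Measure E} [IsProbabilityMeasure ρ] {μ : Ω → Measure E}
  (x₀ : E)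

theorem eventually_measure_pullback_lt (hR : R.WeaklyComplete) {x : E}
    (hx : x ∈ R.convergenceSet ρ) {K : Set E} (hK : IsClosed K) {δ : ℝ≥0∞} (hδ : ρ K < δ) :
    ∀ᶠ s in atTop, P {ω | R.pullback x₀ s ω x ∈ K} < δ := by
  have hprob : ∀ s, IsProbabilityMeasure (P.map fun ω => R.pullback x₀ s ω x) := fun s =>
    Measure.isProbabilityMeasure_map (R.measurable_pullback_left x₀ s x).aemeasurable
  have hlim : Tendsto (β := ProbabilityMeasure E)
      (fun s => ⟨P.map fun ω => R.pullback x₀ s ω x, hprob s⟩) atTop (𝓝 ⟨ρ, inferInstance⟩) := by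
    refine ProbabilityMeasure.tendsto_iff_forall_integral_tendsto.2 fun f => ?_
    refine (hx f).congr fun s => ?_
    rw [hR.semigroup_eq x₀]
    change _ = ∫ y, f y ∂P.map fun ω => R.pullback x₀ s ω x
    rw [integral_map (R.measurable_pullback_left x₀ s x).aemeasurable
      f.continuous.measurable.aestronglyMeasurable]
    have hmp := R.measurePreserving_θ (-(s : ℝ))
    have := integral_map (μ := P) hmp.measurable.aemeasurable (f := fun ω => f (R.flow x₀ s ω x))
      (f.continuous.measurable.comp ((R.measurable_flow_uncurry x₀ s).comp
        measurable_prodMk_right)).aestronglyMeasurable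
    rw [hmp.map_eq] at this
    exact this
  have h := ProbabilityMeasure.limsup_measure_closed_le_of_tendsto hlim hK
  have h2 := eventually_lt_of_limsup_lt (h.trans_lt hδ)
  filter_upwards [h2] with s hs
  refine lt_of_eq_of_lt ?_ hs
  exact (Measure.map_apply (R.measurable_pullback_left x₀ s x) hK.measurableSet).symm

variable [SecondCountableTopology E]

/-- The pullback flow started in the convergence set asymptotically avoids the balls which are not
charged by the statistical equilibrium. -/
theorem IsStatisticalEquilibrium.tendsto_measure_ball (hR : R.WeaklyComplete)
    (hρ : R.IsInvariantMeasure ρ) (hμ : R.IsStatisticalEquilibrium ρ μ) {x : E}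
    (hx : x ∈ R.convergenceSet ρ) (y : E) {r : ℝ} (hr : 0 < r) :
    Tendsto (fun s => P {ω | μ ω (Metric.ball y (2 * r)) = 0 ∧ dist (R.pullback x₀ s ω x) y ≤ r})
      atTop (𝓝 0) := by
  set A : Set Ω := {ω | μ ω (Metric.ball y (2 * r)) = 0} with hA
  have hAm : MeasurableSet[R.past 0] A :=
    ((Measure.measurable_coe measurableSet_ball).comp hμ.measurable) (measurableSet_singleton 0)
  have hWm : Measurable[R.past 0] (A.indicator fun _ => (1 : ℝ)) := by
    rw [measurable_indicator_const_iff]; exact hAm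
  have hW0 : Measurable (A.indicator fun _ => (1 : ℝ)) := hWm.mono (R.past_le 0) le_rfl
  have h := hμ.tendsto_integral_mul_pullback x₀ hR hρ hWm (C := 1)
    (fun ω => by by_cases h : ω ∈ A <;> simp [h]) (ballCutoff y r) hx
  have hzero : ∀ ω, A.indicator (fun _ => (1 : ℝ)) ω * ∫ z, ballCutoff y r z ∂μ ω = 0 := by
    intro ω
    by_cases hω : ω ∈ A
    · have : ∀ᵐ z ∂μ ω, ballCutoff y r z = 0 := by
        filter_upwards [measure_eq_zero_iff_ae_notMem.1 hω] with z hz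
        exact ballCutoff_eq_zero hr hz
      rw [integral_eq_zero_of_ae this, mul_zero]
    · rw [indicator_of_notMem hω, zero_mul]
  simp only [hzero, integral_zero] at h
  have h' := ENNReal.tendsto_ofReal h
  rw [ENNReal.ofReal_zero] at h'
  refine tendsto_of_tendsto_of_tendsto_of_le_of_le tendsto_const_nhds h' (fun _ => zero_le)
    fun s => ?_
  have hg0 : ∀ ω, 0 ≤ A.indicator (fun _ => (1 : ℝ)) ω * ballCutoff y r (R.pullback x₀ s ω x) :=
    fun ω => mul_nonneg (indicator_nonneg (fun _ _ => zero_le_one) _) (ballCutoff_nonneg _ _ _)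
  have hgm : Measurable fun ω =>
      A.indicator (fun _ => (1 : ℝ)) ω * ballCutoff y r (R.pullback x₀ s ω x) :=
    hW0.mul ((ballCutoff y r).continuous.measurable.comp (R.measurable_pullback_left x₀ s x))
  have hgi : Integrable (fun ω =>
      A.indicator (fun _ => (1 : ℝ)) ω * ballCutoff y r (R.pullback x₀ s ω x)) P := by
    refine Integrable.of_bound hgm.aestronglyMeasurable (1 * ‖ballCutoff y r‖)
      (Eventually.of_forall fun ω => ?_)
    rw [norm_mul]
    refine mul_le_mul ?_ ((ballCutoff y r).norm_coe_le_norm _) (norm_nonneg _) zero_le_one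
    by_cases h : ω ∈ A <;> simp [h]
  rw [ofReal_integral_eq_lintegral_ofReal hgi (Eventually.of_forall hg0)]
  have hBm : MeasurableSet {ω | μ ω (Metric.ball y (2 * r)) = 0 ∧
      dist (R.pullback x₀ s ω x) y ≤ r} :=
    (R.past_le 0 _ hAm).inter (measurableSet_le
      ((R.measurable_pullback_left x₀ s x).dist measurable_const) measurable_const)
  rw [← lintegral_indicator_one hBm]
  refine lintegral_mono fun ω => ?_
  by_cases hω : ω ∈ {ω | μ ω (Metric.ball y (2 * r)) = 0 ∧ dist (R.pullback x₀ s ω x) y ≤ r}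
  · have hωA : ω ∈ A := hω.1
    rw [indicator_of_mem hω, indicator_of_mem hωA, ballCutoff_eq_one hr hω.2]
    simp
  · rw [indicator_of_notMem hω]
    exact zero_le

/-- The support of the statistical equilibrium attracts the points of the convergence set: up to
a set of small `ρ`-measure, `E` is covered by finitely many small balls, and the flow is unlikely to
end in one of those far from the support. -/
theorem IsStatisticalEquilibrium.attracts (hR : R.WeaklyComplete)
    (hρ : R.IsInvariantMeasure ρ) (hμ : R.IsStatisticalEquilibrium ρ μ) {x : E}
    (hx : x ∈ R.convergenceSet ρ) {ε : ℝ≥0∞} (hε : 0 < ε) :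
    Tendsto (fun t : ℝ≥0 => P {ω | ε ≤ extInfEDist (R.φ t (R.θ (-(t : ℝ)) ω) x) (μ ω).support})
      atTop (𝓝 0) := by
  obtain ⟨ε', hε'0, hε'⟩ := ENNReal.lt_iff_exists_nnreal_btwn.1 hε
  set r : ℝ := (ε' : ℝ) / 3 with hr_def
  have hr : 0 < r := by
    have : (0 : ℝ) < ε' := by exact_mod_cast hε'0
    positivity
  obtain ⟨x₀⟩ : Nonempty E := ⟨x⟩
  have hne : Nonempty E := ⟨x⟩
  set y := TopologicalSpace.denseSeq E with hy
  rw [ENNReal.tendsto_nhds_zero]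
  intro δ hδ
  have hδ2 : 0 < δ / 2 := ENNReal.half_pos hδ.ne'
  set K : ℕ → Set E := fun n => (⋃ i ∈ Finset.range n, Metric.ball (y i) r)ᶜ with hK_def
  have hKc : ∀ n, IsClosed (K n) := fun n =>
    (isOpen_biUnion fun i _ => Metric.isOpen_ball).isClosed_compl
  have hKlim : Tendsto (fun n => ρ (K n)) atTop (𝓝 0) := by
    have h := tendsto_measure_iInter_atTop (μ := ρ)
      (fun n => (hKc n).measurableSet.nullMeasurableSet)
      (fun m n hmn => compl_subset_compl.2 (biUnion_subset_biUnion_left fun i hi =>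
        Finset.range_mono hmn hi)) ⟨0, measure_ne_top _ _⟩
    have h0 : ⋂ n, K n = ∅ := by
      rw [eq_empty_iff_forall_notMem]
      intro z hz
      obtain ⟨i, hi⟩ := (TopologicalSpace.denseRange_denseSeq E).exists_dist_lt z hr
      refine mem_iInter.1 hz (i + 1) (mem_iUnion₂.2 ⟨i, by simp, ?_⟩)
      rwa [Metric.mem_ball]
    rw [h0, measure_empty] at h
    exact h
  obtain ⟨n, hn⟩ := (hKlim.eventually_lt_const hδ2).exists
  have hsum : Tendsto (fun s => ∑ i ∈ Finset.range n, P {ω | μ ω (Metric.ball (y i) (2 * r)) = 0 ∧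
      dist (R.pullback x₀ s ω x) (y i) ≤ r}) atTop (𝓝 0) := by
    simpa using tendsto_finsetSum (Finset.range n) fun i _ =>
      hμ.tendsto_measure_ball x₀ hR hρ hx (y i) hr
  filter_upwards [hsum.eventually_lt_const hδ2,
    eventually_measure_pullback_lt x₀ hR hx (hKc n) hn] with s h1 h2
  have hnull : P {ω | R.φ s (R.θ (-(s : ℝ)) ω) x = none} = 0 := by
    have := hR.ae_ne_none s (-(s : ℝ)) x
    rw [ae_iff] at this
    simpa using this
  have hsub : {ω | ε ≤ extInfEDist (R.φ s (R.θ (-(s : ℝ)) ω) x) (μ ω).support} ⊆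
      ({ω | R.φ s (R.θ (-(s : ℝ)) ω) x = none} ∪
        ⋃ i ∈ Finset.range n, {ω | μ ω (Metric.ball (y i) (2 * r)) = 0 ∧
          dist (R.pullback x₀ s ω x) (y i) ≤ r}) ∪ {ω | R.pullback x₀ s ω x ∈ K n} := by
    intro ω hω
    by_contra hcon
    simp only [mem_union, not_or, mem_ofPred_eq, mem_iUnion, not_exists, not_and] at hcon
    obtain ⟨⟨ha, hb⟩, hc⟩ := hcon
    have hc' : R.pullback x₀ s ω x ∈ ⋃ i ∈ Finset.range n, Metric.ball (y i) r := not_not.1 hc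
    obtain ⟨i, hi, hZ⟩ := mem_iUnion₂.1 hc'
    have hZ' : dist (R.pullback x₀ s ω x) (y i) ≤ r := (Metric.mem_ball.1 hZ).le
    have hpos : 0 < μ ω (Metric.ball (y i) (2 * r)) :=
      pos_iff_ne_zero.2 fun h0 => hb i hi h0 hZ'
    obtain ⟨a, ha1, ha2⟩ := Measure.nonempty_inter_support_of_pos hpos
    -- The flow is within `r` of `y i`, which is within `2 r` of the support, and `3 r = ε'`.
    have hlt : dist (R.pullback x₀ s ω x) a < ε' := by
      have h3 := dist_triangle_right (R.pullback x₀ s ω x) a (y i)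
      have h4 := Metric.mem_ball.1 ha1
      have : (ε' : ℝ) = 3 * r := by rw [hr_def]; ring
      linarith
    have hω' : ε ≤ extInfEDist (some (R.pullback x₀ s ω x)) (μ ω).support := by
      rw [mem_ofPred_eq, R.some_flow x₀ ha] at hω
      exact hω
    have h5 : ε ≤ edist (R.pullback x₀ s ω x) a := hω'.trans (Metric.infEDist_le_edist_of_mem ha2)
    rw [edist_dist] at h5
    have h6 : ENNReal.ofReal (dist (R.pullback x₀ s ω x) a) ≤ ε' := by
      rw [← ENNReal.ofReal_coe_nnreal]
      exact ENNReal.ofReal_le_ofReal hlt.le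
    exact absurd (h5.trans h6) (not_le.2 hε')
  calc P {ω | ε ≤ extInfEDist (R.φ s (R.θ (-(s : ℝ)) ω) x) (μ ω).support}
      ≤ (0 + ∑ i ∈ Finset.range n, P {ω | μ ω (Metric.ball (y i) (2 * r)) = 0 ∧
          dist (R.pullback x₀ s ω x) (y i) ≤ r}) + P {ω | R.pullback x₀ s ω x ∈ K n} := by
        refine (measure_mono hsub).trans ((measure_union_le _ _).trans ?_)
        gcongr
        refine (measure_union_le _ _).trans ?_
        rw [hnull]
        gcongr
        exact measure_biUnion_finset_le _ _
    _ ≤ δ / 2 + δ / 2 := by rw [zero_add]; exact add_le_add h1.le h2.le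
    _ = δ := ENNReal.add_halves δ

/-- The statistical equilibrium is transported by the flow: both sides are the weak limit of the
pullbacks of `ρ` over the time intervals `[-n, t]`. -/
theorem IsStatisticalEquilibrium.map_flow_eq (hR : R.WeaklyComplete)
    (hμ : R.IsStatisticalEquilibrium ρ μ) (t : ℝ≥0)
    (hne : ∀ᵐ ω ∂P, ∀ x ∈ (μ ω).support, R.φ t ω x ≠ none) :
    ∀ᵐ ω ∂P, (μ ω).map (R.flow x₀ t ω) = μ (R.θ t ω) := by
  have ht : Tendsto (fun n : ℕ => (n : ℝ≥0)) atTop atTop := tendsto_natCast_atTop_atTop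
  have ht' : Tendsto (fun n : ℕ => t + (n : ℝ≥0)) atTop atTop :=
    tendsto_atTop_mono (fun _ => le_add_self) tendsto_natCast_atTop_atTop
  have hae : ∀ᵐ ω ∂P, ∀ n : ℕ, ∀ᵐ x ∂ρ, R.φ n (R.θ (-((n : ℝ≥0) : ℝ)) ω) x ≠ none :=
    ae_all_iff.2 fun n => hR.ae_ae_ne_none ρ n _
  filter_upwards [hne, hae, hμ.tendsto_pullbackLaw x₀ hR ht,
    (R.measurePreserving_θ t).quasiMeasurePreserving.ae (hμ.tendsto_pullbackLaw x₀ hR ht')]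
    with ω h1 h2 h3 h4
  have hflow : ∀ n : ℕ, R.pullbackLaw x₀ ρ (t + n) (R.θ t ω)
      = (R.pullbackLaw x₀ ρ n ω).map (R.flow x₀ t ω) := by
    intro n
    rw [pullbackLaw, pullbackLaw, Measure.map_map (R.measurable_flow_right x₀ t ω)
      (R.measurable_pullback_right x₀ n ω)]
    refine Measure.map_congr ?_
    filter_upwards [h2 n] with x hx
    have e1 : R.θ (-((t + (n : ℝ≥0) : ℝ≥0) : ℝ)) (R.θ t ω) = R.θ (-((n : ℝ≥0) : ℝ)) ω := by
      rw [R.θ_θ]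
      congr 1
      push_cast
      ring
    have e2 : R.θ ((n : ℝ≥0) : ℝ) (R.θ (-((n : ℝ≥0) : ℝ)) ω) = ω := by
      rw [R.θ_θ, add_neg_cancel, R.θ_zero]
    rw [pullback, e1, R.flow_add x₀ t hx, e2]
    rfl
  have hp1 : ∀ n : ℕ, IsProbabilityMeasure ((R.pullbackLaw x₀ ρ n ω).map (R.flow x₀ t ω)) :=
    fun n => Measure.isProbabilityMeasure_map (R.measurable_flow_right x₀ t ω).aemeasurable
  have hpμ := hμ.isProbabilityMeasure
  have hp2 : IsProbabilityMeasure ((μ ω).map (R.flow x₀ t ω)) :=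
    Measure.isProbabilityMeasure_map (R.measurable_flow_right x₀ t ω).aemeasurable
  have l1 : Tendsto (β := ProbabilityMeasure E)
      (fun n : ℕ => ⟨R.pullbackLaw x₀ ρ n ω, inferInstance⟩) atTop (𝓝 ⟨μ ω, hpμ ω⟩) :=
    ProbabilityMeasure.tendsto_iff_forall_integral_tendsto.2 fun f => h3 f
  have l2 : Tendsto (β := ProbabilityMeasure E)
      (fun n : ℕ => ⟨(R.pullbackLaw x₀ ρ n ω).map (R.flow x₀ t ω), hp1 n⟩) atTop
      (𝓝 ⟨μ (R.θ t ω), hpμ _⟩) := by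
    refine ProbabilityMeasure.tendsto_iff_forall_integral_tendsto.2 fun f => ?_
    refine (h4 f).congr fun n => ?_
    rw [hflow n]
    rfl
  have l3 : Tendsto (β := ProbabilityMeasure E)
      (fun n : ℕ => ⟨(R.pullbackLaw x₀ ρ n ω).map (R.flow x₀ t ω), hp1 n⟩) atTop
      (𝓝 ⟨(μ ω).map (R.flow x₀ t ω), hp2⟩) := by
    refine tendsto_of_forall_isOpen_le_liminf' fun G hG => ?_
    -- The flow is continuous on the domain `D`, which is open and carries `μ ω`.
    set D := {x | R.φ t ω x ≠ none} with hD
    have hDo : IsOpen D := R.isOpen_domain_section t ω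
    have hcont : ContinuousOn (R.flow x₀ t ω) D := fun x hx =>
      (R.continuousAt_flow x₀ hx).continuousWithinAt
    have hO : IsOpen (D ∩ R.flow x₀ t ω ⁻¹' G) := hcont.isOpen_inter_preimage hDo hG
    have hD0 : μ ω Dᶜ = 0 :=
      measure_mono_null (fun x hx hx' => hx (h1 x hx')) Measure.measure_compl_support
    have hlim := ProbabilityMeasure.le_liminf_measure_open_of_tendsto l1 hO
    change (μ ω).map (R.flow x₀ t ω) G
      ≤ liminf (fun n : ℕ => (R.pullbackLaw x₀ ρ n ω).map (R.flow x₀ t ω) G) atTop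
    rw [Measure.map_apply (R.measurable_flow_right x₀ t ω) hG.measurableSet]
    calc μ ω (R.flow x₀ t ω ⁻¹' G) ≤ μ ω (D ∩ R.flow x₀ t ω ⁻¹' G) + μ ω Dᶜ := by
          refine (measure_mono fun x hx => ?_).trans (measure_union_le _ _)
          by_cases hxD : x ∈ D
          · exact Or.inl ⟨hxD, hx⟩
          · exact Or.inr hxD
      _ = μ ω (D ∩ R.flow x₀ t ω ⁻¹' G) := by rw [hD0, add_zero]
      _ ≤ liminf (fun n : ℕ => R.pullbackLaw x₀ ρ n ω (D ∩ R.flow x₀ t ω ⁻¹' G)) atTop := hlim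
      _ ≤ _ := by
          refine liminf_le_liminf (Eventually.of_forall fun n => ?_)
          change R.pullbackLaw x₀ ρ n ω (D ∩ R.flow x₀ t ω ⁻¹' G) ≤ _
          rw [Measure.map_apply (R.measurable_flow_right x₀ t ω) hG.measurableSet]
          exact measure_mono inter_subset_right
  have h := tendsto_nhds_unique l3 l2
  exact congrArg (fun ν : ProbabilityMeasure E => (ν : Measure E)) h

theorem IsStatisticalEquilibrium.isWeakPointAttractorOf (hR : R.WeaklyComplete)
    (hρ : R.IsInvariantMeasure ρ) (hμ : R.IsStatisticalEquilibrium ρ μ)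
    (hne : ∀ t : ℝ≥0, ∀ᵐ ω ∂P, ∀ x ∈ (μ ω).support, R.φ t ω x ≠ none)
    (hK : ∀ᵐ ω ∂P, IsCompact (μ ω).support) :
    R.IsWeakPointAttractorOf (R.convergenceSet ρ) (fun ω => (μ ω).support) := by
  obtain ⟨x₀⟩ : Nonempty E := nonempty_of_isProbabilityMeasure ρ
  have h0 : ∀ ω, μ ω ≠ 0 := fun ω => (hμ.isProbabilityMeasure ω).ne_zero
  refine ⟨⟨fun ω => Measure.nonempty_support (h0 ω), hK,
    measurable_infDist_support hμ.measurable' h0⟩, fun t => ?_,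
    fun x hx ε hε => hμ.attracts hR hρ hx hε⟩
  filter_upwards [hne t, hK, hμ.map_flow_eq x₀ hR t (hne t)] with ω h1 h2 h3
  rw [← h3, ← image_support_eq_support_map (R.measurable_flow_right x₀ t ω)
    (fun x hx => R.continuousAt_flow x₀ (h1 x hx)) h2, image_image]
  exact image_congr fun x hx => R.some_flow x₀ (h1 x hx)

/-- Every weak point attractor carries the statistical equilibrium: it attracts `ρ`-almost every
initial point, so the pullbacks of `ρ` concentrate near it. -/
theorem IsStatisticalEquilibrium.support_subset (hR : R.WeaklyComplete)
    (hμ : R.IsStatisticalEquilibrium ρ μ) {A : Ω → Set E} (hA : R.IsWeakPointAttractor A) :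
    ∀ᵐ ω ∂P, (μ ω).support ⊆ A ω := by
  obtain ⟨x₀⟩ : Nonempty E := nonempty_of_isProbabilityMeasure ρ
  have hd : Measurable (Function.uncurry fun (y : E) (ω : Ω) => Metric.infDist y (A ω)) :=
    measurable_uncurry_of_continuous_of_measurable
      (fun ω => Metric.continuous_infDist_pt (A ω)) hA.isRandomCompact.measurable_infDist
  have ht : Tendsto (fun n : ℕ => (n : ℝ≥0)) atTop atTop := tendsto_natCast_atTop_atTop
  have hopen : ∀ (ε : ℝ) ω, IsOpen {y | ε < Metric.infDist y (A ω)} := fun ε ω =>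
    isOpen_lt continuous_const (Metric.continuous_infDist_pt _)
  have hS : ∀ (ε : ℝ) (n : ℕ),
      MeasurableSet {p : Ω × E | ε < Metric.infDist (R.pullback x₀ n p.1 p.2) (A p.1)} :=
    fun ε n => by
      have hp : Measurable fun p : Ω × E => (R.pullback x₀ n p.1 p.2, p.1) :=
        (R.measurable_pullback x₀ n).prodMk measurable_fst
      have hc := hd.comp hp
      exact measurableSet_lt measurable_const hc
  have hlaw : ∀ (ε : ℝ) (n : ℕ) ω, R.pullbackLaw x₀ ρ n ω {y | ε < Metric.infDist y (A ω)}
      = ρ (Prod.mk ω ⁻¹' {p : Ω × E | ε < Metric.infDist (R.pullback x₀ n p.1 p.2) (A p.1)}) :=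
    fun ε n ω => by
      rw [pullbackLaw, Measure.map_apply (R.measurable_pullback_right x₀ n ω)
        (hopen ε ω).measurableSet]
      rfl
  have key : ∀ ε : ℝ, 0 < ε → ∀ᵐ ω ∂P, μ ω {y | ε < Metric.infDist y (A ω)} = 0 := by
    intro ε hε
    have hm : ∀ n : ℕ, Measurable fun ω =>
        R.pullbackLaw x₀ ρ n ω {y | ε < Metric.infDist y (A ω)} := fun n => by
      simp_rw [hlaw]
      exact measurable_measure_prodMk_left (hS ε n)
    have hlim : Tendsto (fun n : ℕ => ∫⁻ ω, R.pullbackLaw x₀ ρ n ω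
        {y | ε < Metric.infDist y (A ω)} ∂P) atTop (𝓝 0) := by
      have e1 : ∀ n : ℕ, ∫⁻ ω, R.pullbackLaw x₀ ρ n ω {y | ε < Metric.infDist y (A ω)} ∂P
          = ∫⁻ x, P {ω | ε < Metric.infDist (R.pullback x₀ n ω x) (A ω)} ∂ρ := by
        intro n
        simp_rw [hlaw]
        rw [← Measure.prod_apply (hS ε n), Measure.prod_apply_symm (hS ε n)]
        rfl
      simp_rw [e1]
      have : Tendsto (fun n : ℕ => ∫⁻ x, P {ω | ε < Metric.infDist (R.pullback x₀ n ω x) (A ω)} ∂ρ)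
          atTop (𝓝 (∫⁻ _, 0 ∂ρ)) := by
        refine tendsto_lintegral_of_dominated_convergence (fun _ => 1) (fun n => ?_)
          (fun n => Eventually.of_forall fun x => prob_le_one) (by simp)
          (Eventually.of_forall fun x => ?_)
        · exact measurable_measure_prodMk_right (hS ε n)
        · exact (hA.tendsto_measure_lt_infDist x₀ (mem_univ x) hε).comp ht
      simpa using this
    have hfatou : ∫⁻ ω, liminf (fun n : ℕ => R.pullbackLaw x₀ ρ n ω
        {y | ε < Metric.infDist y (A ω)}) atTop ∂P = 0 := by
      refine le_antisymm ((lintegral_liminf_le hm).trans ?_) zero_le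
      rw [hlim.liminf_eq]
    rw [lintegral_eq_zero_iff (Measurable.liminf hm)] at hfatou
    filter_upwards [hfatou, hμ.tendsto_pullbackLaw x₀ hR ht] with ω h1 h2
    have l1 : Tendsto (β := ProbabilityMeasure E)
        (fun n : ℕ => ⟨R.pullbackLaw x₀ ρ n ω, inferInstance⟩) atTop
        (𝓝 ⟨μ ω, hμ.isProbabilityMeasure ω⟩) :=
      ProbabilityMeasure.tendsto_iff_forall_integral_tendsto.2 fun f => h2 f
    have h3 := ProbabilityMeasure.le_liminf_measure_open_of_tendsto l1 (hopen ε ω)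
    exact le_antisymm (h3.trans (le_of_eq h1)) zero_le
  filter_upwards [hA.isRandomCompact.compact,
    ae_all_iff.2 fun k : ℕ => key (1 / ((k : ℝ) + 1)) (by positivity)] with ω h1 h2 x hx
  by_contra hxA
  have hpos : 0 < Metric.infDist x (A ω) :=
    (h1.isClosed.notMem_iff_infDist_pos (hA.isRandomCompact.nonempty ω)).1 hxA
  obtain ⟨k, hk⟩ := exists_nat_one_div_lt hpos
  exact Measure.subset_compl_support_of_isOpen (hopen _ ω) (h2 k) hk hx

end WhiteNoiseLocalRDS

/-! ### Uniqueness of the statistical equilibrium -/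

/-- Random measures that are measurable with respect to `m` agree almost surely if they have the
same mean on each event of `m`. -/
theorem ae_eq_of_forall_integral_indicator_mul_eq {Ω E : Type*} {m m₀ : MeasurableSpace Ω}
    (hm : m ≤ m₀) {P : Measure Ω} [IsProbabilityMeasure P] [MetricSpace E]
    [SecondCountableTopology E] [MeasurableSpace E] [BorelSpace E] {ν₁ ν₂ : Ω → Measure E}
    (h₁ : Measurable[m] ν₁) (h₂ : Measurable[m] ν₂) (hu₁ : ∀ ω, ν₁ ω univ ≤ 1)
    (hu₂ : ∀ ω, ν₂ ω univ ≤ 1)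
    (h : ∀ A, MeasurableSet[m] A → ∀ f : E →ᵇ ℝ,
      ∫ ω, A.indicator (fun _ => (1 : ℝ)) ω * ∫ y, f y ∂ν₁ ω ∂P
        = ∫ ω, A.indicator (fun _ => (1 : ℝ)) ω * ∫ y, f y ∂ν₂ ω ∂P) :
    ∀ᵐ ω ∂P, ν₁ ω = ν₂ ω := by
  have h₁' : Measurable ν₁ := h₁.mono hm le_rfl
  have h₂' : Measurable ν₂ := h₂.mono hm le_rfl
  have hfin : ∀ A {ν : Ω → Measure E}, Measurable ν → (∀ ω, ν ω univ ≤ 1) →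
      IsFiniteMeasure ((P.restrict A).bind ν) := fun A ν hν hu => ⟨by
    rw [Measure.bind_apply MeasurableSet.univ hν.aemeasurable]
    exact (lintegral_mono hu).trans_lt (by simp)⟩
  have e : ∀ (A : Set Ω) (g : Ω → ℝ) ω,
      A.indicator (fun _ => (1 : ℝ)) ω * g ω = A.indicator g ω := fun A g ω => by
    by_cases h : ω ∈ A <;> simp [h]
  have hbind : ∀ A, MeasurableSet[m] A → (P.restrict A).bind ν₁ = (P.restrict A).bind ν₂ := by
    intro A hA
    have := hfin A h₁' hu₁
    have := hfin A h₂' hu₂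
    refine ext_of_forall_integral_eq_of_IsFiniteMeasure fun f => ?_
    have hf : ∀ y, |f y| ≤ ‖f‖ := f.norm_coe_le_norm
    rw [integral_bind_eq h₁' hu₁ f.continuous.measurable hf,
      integral_bind_eq h₂' hu₂ f.continuous.measurable hf, ← integral_indicator (hm _ hA),
      ← integral_indicator (hm _ hA)]
    have h0 := h A hA f
    rwa [integral_congr_ae (.of_forall (e A fun ω => ∫ y, f y ∂ν₁ ω)),
      integral_congr_ae (.of_forall (e A fun ω => ∫ y, f y ∂ν₂ ω))] at h0
  have hB : ∀ B, MeasurableSet B → ∀ᵐ ω ∂P, ν₁ ω B = ν₂ ω B := by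
    intro B hB
    have g₁ : Measurable[m] fun ω => ν₁ ω B := (Measure.measurable_coe hB).comp h₁
    have g₂ : Measurable[m] fun ω => ν₂ ω B := (Measure.measurable_coe hB).comp h₂
    refine ae_eq_of_ae_eq_trim (hm := hm)
      (ae_eq_of_forall_setLIntegral_eq_of_sigmaFinite g₁ g₂ fun A hA _ => ?_)
    rw [restrict_trim hm _ hA, lintegral_trim hm g₁, lintegral_trim hm g₂,
      ← Measure.bind_apply hB h₁'.aemeasurable, ← Measure.bind_apply hB h₂'.aemeasurable,
      hbind A hA]
  obtain ⟨S, hSc, hSpi, hS⟩ := exists_countable_isTopologicalBasis_isPiSystem E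
  have hall : ∀ᵐ ω ∂P, ∀ U ∈ S, ν₁ ω U = ν₂ ω U :=
    (ae_ball_iff hSc).2 fun U hU => hB U (hS.isOpen hU).measurableSet
  filter_upwards [hall, hB univ MeasurableSet.univ] with ω h1 h2
  have : IsFiniteMeasure (ν₁ ω) := ⟨(hu₁ ω).trans_lt ENNReal.one_lt_top⟩
  exact ext_of_generate_finite S (BorelSpace.measurable_eq.trans hS.borel_eq_generateFrom) hSpi
    h1 h2

namespace WhiteNoiseLocalRDS

variable {Ω : Type*} [MeasurableSpace Ω] {P : Measure Ω} [IsProbabilityMeasure P]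
  {E : Type*} [MetricSpace E] [MeasurableSpace E]

theorem comap_past_zero_eq {P : Measure Ω} (R : WhiteNoiseLocalRDS Ω P E) (s : ℝ≥0) :
    (R.past 0).comap (R.θ (-(s : ℝ))) = ⨆ n : ℕ, R.F (-((s + n : ℝ≥0) : ℝ)) (-(s : ℝ)) := by
  rw [R.past_zero_eq, MeasurableSpace.comap_iSup]
  refine iSup_congr fun n => ?_
  rw [R.F_shift _ _ _ (by simp), zero_add]
  congr 1
  push_cast
  ring

/-- The noise after time `-s` is independent of the past at time `-s`. -/
theorem indep_comap_past (R : WhiteNoiseLocalRDS Ω P E) (s : ℝ≥0) :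
    Indep (R.F (-(s : ℝ)) 0) ((R.past 0).comap (R.θ (-(s : ℝ)))) P := by
  rw [comap_past_zero_eq]
  have hle : ∀ n : ℕ, -((s + n : ℝ≥0) : ℝ) ≤ -(s : ℝ) := fun n => by
    push_cast
    linarith [n.cast_nonneg (α := ℝ)]
  refine (indep_iSup_of_directed_le (fun n => ?_) (fun n => R.F_le _ _ (hle n)) (R.F_neg_le s)
    (Monotone.directed_le fun i j hij => ?_)).symm
  · exact R.F_indep _ _ _ _ (hle n) le_rfl (by simp)
  · refine R.F_mono _ _ _ _ ?_ (hle i) le_rfl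
    have : (i : ℝ) ≤ j := by exact_mod_cast hij
    push_cast
    linarith

variable [SecondCountableTopology E] [BorelSpace E] {R : WhiteNoiseLocalRDS Ω P E}
  {ρ : Measure E} [IsProbabilityMeasure ρ] {μ : Ω → Measure E} (x₀ : E)

/-- A random measure of the past that is transported by the flow is the image of its own past
under the pullback flow, and that past is independent of the pullback flow. -/
theorem integral_mul_integral_eq_of_map_flow_eq (hR : R.WeaklyComplete) {ν : Ω → Measure E}
    (hν : Measurable[R.past 0] ν) (hν₁ : ∀ ω, ν ω univ ≤ 1) {s : ℝ≥0}
    (hne : ∀ᵐ ω ∂P, ∀ᵐ x ∂ν ω, R.φ s ω x ≠ none)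
    (hinv : ∀ᵐ ω ∂P, (ν ω).map (R.flow x₀ s ω) = ν (R.θ s ω)) {W : Ω → ℝ}
    (hW : Measurable[R.F (-(s : ℝ)) 0] W) {C : ℝ} (hC : ∀ ω, |W ω| ≤ C) (f : E →ᵇ ℝ) :
    ∫ ω, W ω * ∫ y, f y ∂ν ω ∂P
      = ∫ y, ∫ ω, W ω * f (R.pullback x₀ s ω y) ∂P ∂P.bind ν := by
  have hmp := R.measurePreserving_θ (-(s : ℝ))
  have hν0 : Measurable ν := hν.mono (R.past_le 0) le_rfl
  have hκ : Measurable[(R.past 0).comap (R.θ (-(s : ℝ)))] fun ω => ν (R.θ (-(s : ℝ)) ω) :=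
    hν.comp (comap_measurable _)
  have hle : (R.past 0).comap (R.θ (-(s : ℝ))) ≤ ‹MeasurableSpace Ω› :=
    ((hmp.measurable.mono le_rfl (R.past_le 0))).comap_le
  have hbind : (P.bind fun ω => ν (R.θ (-(s : ℝ)) ω)) = P.bind ν := by
    refine Measure.ext fun B hB => ?_
    rw [Measure.bind_apply hB (hκ.mono hle le_rfl).aemeasurable,
      Measure.bind_apply hB hν0.aemeasurable]
    exact hmp.lintegral_comp ((Measure.measurable_coe hB).comp hν0)
  have key := integral_mul_integral_of_indep (R.F_neg_le s) hle (R.indep_comap_past s) hW hC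
    (R.measurable_pullback x₀ s) (R.measurable_pullback_F x₀ s) hκ (fun ω => hν₁ _)
    (by
      filter_upwards [hmp.quasiMeasurePreserving.ae hne] with ω hω
      filter_upwards [hω] with y hy
      exact R.continuousAt_flow x₀ hy)
    (Eventually.of_forall fun y => by
      filter_upwards [hR.ae_ne_none s (-(s : ℝ)) y] with ω hω
      exact R.continuousAt_flow x₀ hω) f
  rw [hbind] at key
  rw [← key]
  refine integral_congr_ae ?_
  filter_upwards [hmp.quasiMeasurePreserving.ae hinv] with ω hω
  rw [R.θ_θ, add_neg_cancel, R.θ_zero] at hω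
  rw [← hω, integral_map (R.measurable_flow_right x₀ s _).aemeasurable
    f.continuous.measurable.aestronglyMeasurable]
  rfl

/-- Under strong mixing, the statistical equilibrium is, up to a constant factor, the only random
measure of the past that is transported by the flow: its own remote past is independent of the
pullback flow, which converges stably to the statistical equilibrium. -/
theorem IsStatisticalEquilibrium.eq_smul_of_map_flow_eq (hR : R.WeaklyComplete)
    (hρ : R.IsInvariantMeasure ρ) (hmix : R.StronglyMixing ρ)
    (hμ : R.IsStatisticalEquilibrium ρ μ) {ν : Ω → Measure E}
    (hν : Measurable[R.past 0] ν) (hν₁ : ∀ ω, ν ω univ ≤ 1)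
    (hne : ∀ s, ∀ᵐ ω ∂P, ∀ᵐ x ∂ν ω, R.φ s ω x ≠ none)
    (hinv : ∀ s, ∀ᵐ ω ∂P, (ν ω).map (R.flow x₀ s ω) = ν (R.θ s ω)) :
    ∀ᵐ ω ∂P, ν ω = (P.bind ν univ) • μ ω := by
  have hν0 : Measurable ν := hν.mono (R.past_le 0) le_rfl
  set c := P.bind ν univ with hc_def
  have hc : c ≤ 1 := by
    rw [hc_def, Measure.bind_apply MeasurableSet.univ hν0.aemeasurable]
    exact (lintegral_mono hν₁).trans (by simp)
  have hfin : IsFiniteMeasure (P.bind ν) := ⟨hc.trans_lt ENNReal.one_lt_top⟩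
  have step : ∀ (f : E →ᵇ ℝ) {t : ℝ≥0} {V : Ω → ℝ} {C : ℝ}, Measurable[R.F (-(t : ℝ)) 0] V →
      (∀ ω, |V ω| ≤ C) →
      ∫ ω, V ω * ∫ y, f y ∂ν ω ∂P = c.toReal * ∫ ω, V ω * ∫ y, f y ∂μ ω ∂P := by
    intro f t V C hV hC
    have hV0 : Measurable V := hV.mono (R.F_neg_le t) le_rfl
    have ht : Tendsto (fun n : ℕ => t + (n : ℝ≥0)) atTop atTop :=
      tendsto_atTop_mono (fun _ => le_add_self) tendsto_natCast_atTop_atTop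
    have hlim : Tendsto (fun n : ℕ => ∫ y, ∫ ω, V ω * f (R.pullback x₀ (t + n) ω y) ∂P ∂P.bind ν)
        atTop (𝓝 (∫ _, ∫ ω, V ω * ∫ y, f y ∂μ ω ∂P ∂P.bind ν)) := by
      refine tendsto_integral_of_dominated_convergence (fun _ => C * ‖f‖) (fun n => ?_)
        (integrable_const _) (fun n => Eventually.of_forall fun y =>
          abs_integral_mul_pullback_le x₀ hC _ f y) (Eventually.of_forall fun y => ?_)
      · exact (measurable_integral_mul_pullback x₀ hV0 _ f).aestronglyMeasurable
      · have h1 := hμ.tendsto_integral_mul_pullback x₀ hR hρ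
          (hV.mono (R.F_neg_le_past t) le_rfl) hC f (hmix y)
        exact h1.comp ht
    have e : ∀ n : ℕ, ∫ y, ∫ ω, V ω * f (R.pullback x₀ (t + n) ω y) ∂P ∂P.bind ν
        = ∫ ω, V ω * ∫ y, f y ∂ν ω ∂P := fun n =>
      (integral_mul_integral_eq_of_map_flow_eq x₀ hR hν hν₁ (hne _) (hinv _)
        (hV.mono (R.F_neg_mono le_self_add) le_rfl) hC f).symm
    simp only [e] at hlim
    rw [tendsto_nhds_unique tendsto_const_nhds hlim, integral_const, smul_eq_mul]
    rfl
  refine ae_eq_of_forall_integral_indicator_mul_eq (R.past_le 0) hν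
    (Measure.measurable_of_measurable_coe _ fun B hB =>
      ((Measure.measurable_coe hB).comp hμ.measurable).const_mul c) hν₁ (fun ω => ?_)
    fun A hA f => ?_
  · rw [Measure.smul_apply, smul_eq_mul]
    exact mul_le_one' hc (hμ.measure_univ_le ω)
  · have hWm : Measurable[R.past 0] (A.indicator fun _ => (1 : ℝ)) := by
      rw [measurable_indicator_const_iff]; exact hA
    have hWC : ∀ ω, |A.indicator (fun _ => (1 : ℝ)) ω| ≤ 1 := fun ω => by
      by_cases h : ω ∈ A <;> simp [h]
    obtain ⟨V, hVm, hVC, hV⟩ := R.exists_tendsto_of_measurable_past hWm hWC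
    have hlim : ∀ {κ : Ω → Measure E}, Measurable κ → (∀ ω, κ ω univ ≤ 1) →
        Tendsto (fun n => ∫ ω, V n ω * ∫ y, f y ∂κ ω ∂P) atTop
          (𝓝 (∫ ω, A.indicator (fun _ => (1 : ℝ)) ω * ∫ y, f y ∂κ ω ∂P)) := by
      intro κ hκ hκ₁
      rw [tendsto_iff_dist_tendsto_zero]
      refine squeeze_zero (fun _ => dist_nonneg) (fun n => ?_) (by simpa using hV.const_mul ‖f‖)
      exact abs_integral_mul_sub_le ((hVm n).mono (R.F_neg_le _) le_rfl)
        (hWm.mono (R.past_le 0) le_rfl)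
        (measurable_integral_of_measurable hκ hκ₁ f.continuous.measurable) (hVC n) hWC
        (fun ω => abs_integral_le_norm (hκ₁ ω) f)
    have h1 := hlim hν0 hν₁
    simp only [fun n => step f (hVm n) (hVC n)] at h1
    rw [tendsto_nhds_unique h1 ((hlim hμ.measurable' hμ.measure_univ_le).const_mul c.toReal),
      ← integral_const_mul]
    refine integral_congr_ae (.of_forall fun ω => ?_)
    simp only [integral_smul_measure, smul_eq_mul]
    ring

end WhiteNoiseLocalRDS

/-! ### Atoms of random measures -/

theorem measurable_measure_section {α E : Type*} {_ : MeasurableSpace α} [MeasurableSpace E]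
    {κ : α → Measure E} (hκ : Measurable κ) (hκf : ∀ a, IsFiniteMeasure (κ a)) {t : Set (α × E)}
    (ht : MeasurableSet t) : Measurable fun a => κ a (Prod.mk a ⁻¹' t) :=
  Kernel.measurable_kernel_prodMk_left_of_finite (κ := ⟨κ, hκ⟩) ht hκf

theorem measurable_prod_self {α E : Type*} {_ : MeasurableSpace α} [MeasurableSpace E]
    {κ : α → Measure E}
    (hκ : Measurable κ) (hκ₁ : ∀ a, κ a univ ≤ 1) : Measurable fun a => (κ a).prod (κ a) := by
  let η : Kernel α E := ⟨κ, hκ⟩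
  have hη : IsFiniteKernel η := ⟨1, ENNReal.one_lt_top, hκ₁⟩
  have : (fun a => (κ a).prod (κ a)) = fun a => (η ×ₖ η) a := by
    funext a
    rw [Kernel.prod_apply]
    rfl
  rw [this]
  exact (η ×ₖ η).measurable

section Atoms

variable {E : Type*} [MetricSpace E] [SecondCountableTopology E] [MeasurableSpace E] [BorelSpace E]

theorem measurable_measure_singleton {α : Type*} {_ : MeasurableSpace α} {κ : α → Measure E}
    (hκ : Measurable κ) (hκf : ∀ a, IsFiniteMeasure (κ a)) :
    Measurable fun p : α × E => κ p.1 {p.2} := by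
  have ht : MeasurableSet {p : (α × E) × E | p.2 = p.1.2} :=
    measurableSet_eq_fun measurable_snd (measurable_snd.comp measurable_fst)
  exact measurable_measure_section (hκ.comp measurable_fst) (fun p => hκf p.1) ht

/-- The set of atoms of mass at least `c`, for `c > 0`. -/
def heavyAtoms {E : Type*} [MeasurableSpace E] (κ : Measure E) (c : ℝ≥0∞) : Set E :=
  {x | c ≤ κ {x}}

/-- The probability that two independent points with law `κ` coincide. -/
def coincidence {E : Type*} [MeasurableSpace E] (κ : Measure E) : ℝ≥0∞ := ∫⁻ x, κ {x} ∂κ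

theorem measurable_apply_singleton (κ : Measure E) [IsFiniteMeasure κ] :
    Measurable fun x => κ {x} := by
  have h : Measurable fun p : Unit × E => κ {p.2} :=
    measurable_measure_singleton (κ := fun _ : Unit => κ) measurable_const fun _ => inferInstance
  exact h.comp (measurable_prodMk_left (x := ()))

theorem measurableSet_heavyAtoms (κ : Measure E) [IsFiniteMeasure κ] (c : ℝ≥0∞) :
    MeasurableSet (heavyAtoms κ c) :=
  measurableSet_le measurable_const (measurable_apply_singleton κ)

theorem finite_heavyAtoms (κ : Measure E) [IsFiniteMeasure κ] {c : ℝ≥0∞} (hc : 0 < c) :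
    (heavyAtoms κ c).Finite := by
  have h := Measure.finite_const_le_meas_of_disjoint_iUnion κ hc (As := fun x : E => {x})
    (fun x => measurableSet_singleton x) (fun x y hxy => by simpa using hxy) (measure_ne_top _ _)
  exact h

theorem coincidence_eq_prod_diagonal (κ : Measure E) [IsFiniteMeasure κ] :
    coincidence κ = κ.prod κ (diagonal E) := by
  rw [Measure.prod_apply measurableSet_diagonal]
  refine lintegral_congr fun x => ?_
  congr 1
  ext y
  simp [eq_comm]

theorem coincidence_ne_top (κ : Measure E) [IsFiniteMeasure κ] : coincidence κ ≠ ⊤ := by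
  rw [coincidence_eq_prod_diagonal]
  exact measure_ne_top _ _

theorem measurable_coincidence {α : Type*} {_ : MeasurableSpace α} {κ : α → Measure E}
    (hκ : Measurable κ) (hκ₁ : ∀ a, κ a univ ≤ 1) : Measurable fun a => coincidence (κ a) := by
  let η : Kernel α E := ⟨κ, hκ⟩
  have hη : IsFiniteKernel η := ⟨1, ENNReal.one_lt_top, hκ₁⟩
  exact Measurable.lintegral_kernel_prod_right (κ := η) (f := fun a x => κ a {x})
    (measurable_measure_singleton hκ fun a => ⟨(hκ₁ a).trans_lt ENNReal.one_lt_top⟩)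

theorem measure_singleton_le_map (κ : Measure E) {g : E → E} (hg : Measurable g) (x : E) :
    κ {x} ≤ κ.map g {g x} := by
  rw [Measure.map_apply hg (measurableSet_singleton _)]
  exact measure_mono (by simp)

theorem coincidence_map (κ : Measure E) [IsFiniteMeasure κ] {g : E → E} (hg : Measurable g) :
    coincidence (κ.map g) = ∫⁻ x, κ.map g {g x} ∂κ :=
  lintegral_map (measurable_apply_singleton _) hg

theorem coincidence_le_map (κ : Measure E) [IsFiniteMeasure κ] {g : E → E} (hg : Measurable g) :
    coincidence κ ≤ coincidence (κ.map g) := by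
  rw [coincidence_map κ hg]
  exact lintegral_mono (measure_singleton_le_map κ hg)

/-- A map that does not increase the coincidence probability does not merge atoms. -/
theorem ae_map_singleton_eq (κ : Measure E) [IsFiniteMeasure κ] {g : E → E} (hg : Measurable g)
    (h : coincidence (κ.map g) ≤ coincidence κ) : ∀ᵐ x ∂κ, κ {x} = κ.map g {g x} := by
  rw [coincidence_map κ hg] at h
  exact ae_eq_of_ae_le_of_lintegral_le (.of_forall (measure_singleton_le_map κ hg))
    (coincidence_ne_top κ) ((measurable_apply_singleton _).comp hg).aemeasurable h

theorem map_restrict_heavyAtoms (κ : Measure E) [IsFiniteMeasure κ] {g : E → E} (hg : Measurable g)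
    (h : ∀ᵐ x ∂κ, κ {x} = κ.map g {g x}) (c : ℝ≥0∞) :
    (κ.restrict (heavyAtoms κ c)).map g = (κ.map g).restrict (heavyAtoms (κ.map g) c) := by
  refine Measure.ext fun B hB => ?_
  rw [Measure.map_apply hg hB, Measure.restrict_apply (hg hB), Measure.restrict_apply hB,
    Measure.map_apply hg (hB.inter (measurableSet_heavyAtoms _ c))]
  refine measure_congr ?_
  filter_upwards [h] with x hx
  refine propext (and_congr Iff.rfl ?_)
  change c ≤ κ {x} ↔ c ≤ κ.map g {g x}
  rw [hx]

theorem measurable_restrict_heavyAtoms {α : Type*} {_ : MeasurableSpace α} {κ : α → Measure E}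
    (hκ : Measurable κ) (hκf : ∀ a, IsFiniteMeasure (κ a)) (c : ℝ≥0∞) :
    Measurable fun a => (κ a).restrict (heavyAtoms (κ a) c) := by
  refine Measure.measurable_of_measurable_coe _ fun B hB => ?_
  simp_rw [Measure.restrict_apply hB]
  have ht : MeasurableSet {p : α × E | p.2 ∈ B ∧ c ≤ κ p.1 {p.2}} :=
    (measurable_snd hB).inter (measurableSet_le measurable_const
      (measurable_measure_singleton hκ hκf))
  exact measurable_measure_section hκ hκf ht

/-- The support of a measure carried by its heavy atoms consists of these atoms. -/
theorem support_eq_heavyAtoms {κ : Measure E} [IsFiniteMeasure κ] {c : ℝ≥0∞} (hc : 0 < c)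
    (h : κ (heavyAtoms κ c)ᶜ = 0) : κ.support = heavyAtoms κ c := by
  refine Subset.antisymm
    (Measure.support_subset_of_isClosed (finite_heavyAtoms κ hc).isClosed h) fun x hx => ?_
  refine (Measure.mem_support_iff_forall x).2 fun U hU => ?_
  exact (hc.trans_le hx).trans_le (measure_mono (singleton_subset_iff.2 (mem_of_mem_nhds hU)))

end Atoms

theorem le_extEDist_of_lt_dist {E : Type*} [MetricSpace E] (x₀ : E) {z w : Option E} {r : ℝ}
    (h : r < dist (z.getD x₀) (w.getD x₀)) : ENNReal.ofReal r ≤ extEDist z w := by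
  rcases z with _ | z <;> rcases w with _ | w <;> try exact le_top
  change _ ≤ edist z w
  rw [edist_dist]
  exact ENNReal.ofReal_le_ofReal h.le

namespace WhiteNoiseLocalRDS

variable {Ω : Type*} [MeasurableSpace Ω] {P : Measure Ω} [IsProbabilityMeasure P]
  {E : Type*} [MetricSpace E] [SecondCountableTopology E] [MeasurableSpace E] [BorelSpace E]
  {R : WhiteNoiseLocalRDS Ω P E} {ρ : Measure E} [IsProbabilityMeasure ρ] {μ : Ω → Measure E}
  (x₀ : E)

/-- The probability that the flow brings two independent points with law `ρ` within distance `r`,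
bounded below by the contribution of the event `M` and of initial points in `U`. -/
theorem le_lintegral_prod_pullbackLaw (M : Set Ω) (U : Set (E × E)) (t : ℝ≥0) (r : ℝ) :
    ∫⁻ p in U, (P M - P {ω | ω ∈ M ∧ r < dist (R.flow x₀ t ω p.1) (R.flow x₀ t ω p.2)}) ∂ρ.prod ρ
      ≤ ∫⁻ ω, ((R.pullbackLaw x₀ ρ t ω).prod (R.pullbackLaw x₀ ρ t ω))
          {p | dist p.1 p.2 ≤ r} ∂P := by
  have hD : MeasurableSet {p : E × E | dist p.1 p.2 ≤ r} :=
    measurableSet_le (measurable_fst.dist measurable_snd) measurable_const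
  have hpair : Measurable fun q : Ω × (E × E) =>
      (R.pullback x₀ t q.1 q.2.1, R.pullback x₀ t q.1 q.2.2) :=
    ((R.measurable_pullback x₀ t).comp
      (measurable_fst.prodMk (measurable_fst.comp measurable_snd))).prodMk
      ((R.measurable_pullback x₀ t).comp
        (measurable_fst.prodMk (measurable_snd.comp measurable_snd)))
  have hT := hpair hD
  have e : ∀ ω, ((R.pullbackLaw x₀ ρ t ω).prod (R.pullbackLaw x₀ ρ t ω)) {p | dist p.1 p.2 ≤ r}
      = (ρ.prod ρ) (Prod.mk ω ⁻¹' ((fun q : Ω × (E × E) =>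
        (R.pullback x₀ t q.1 q.2.1, R.pullback x₀ t q.1 q.2.2)) ⁻¹' {p | dist p.1 p.2 ≤ r})) := by
    intro ω
    have hm := R.measurable_pullback_right x₀ t ω
    rw [pullbackLaw, Measure.map_prod_map _ _ hm hm, Measure.map_apply (hm.prodMap hm) hD]
    rfl
  simp_rw [e]
  rw [← Measure.prod_apply hT, Measure.prod_apply_symm hT]
  refine (setLIntegral_le_lintegral _ _).trans (lintegral_mono fun p => ?_)
  have hp : MeasurableSet {ω | dist (R.flow x₀ t ω p.1) (R.flow x₀ t ω p.2) ≤ r} :=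
    measurableSet_le (((R.measurable_flow_uncurry x₀ t).comp measurable_prodMk_right).dist
      ((R.measurable_flow_uncurry x₀ t).comp measurable_prodMk_right)) measurable_const
  have hmp := (R.measurePreserving_θ (-(t : ℝ))).measure_preimage hp.nullMeasurableSet
  refine le_trans ?_ (le_of_eq hmp.symm)
  rw [tsub_le_iff_right]
  refine (measure_mono fun ω hω => ?_).trans (measure_union_le _ _)
  by_cases h : dist (R.flow x₀ t ω p.1) (R.flow x₀ t ω p.2) ≤ r
  · exact Or.inl h
  · exact Or.inr ⟨hω, not_le.1 h⟩

theorem IsStatisticalEquilibrium.limsup_prod_pullbackLaw_le (hR : R.WeaklyComplete)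
    (hμ : R.IsStatisticalEquilibrium ρ μ) {t : ℕ → ℝ≥0} (ht : Tendsto t atTop atTop)
    {D : Set (E × E)} (hD : IsClosed D) :
    ∀ᵐ ω ∂P, limsup (fun n =>
      ((R.pullbackLaw x₀ ρ (t n) ω).prod (R.pullbackLaw x₀ ρ (t n) ω)) D) atTop
        ≤ ((μ ω).prod (μ ω)) D := by
  filter_upwards [hμ.tendsto_pullbackLaw x₀ hR ht] with ω hω
  have l1 : Tendsto (β := ProbabilityMeasure E)
      (fun n : ℕ => ⟨R.pullbackLaw x₀ ρ (t n) ω, inferInstance⟩) atTop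
      (𝓝 ⟨μ ω, hμ.isProbabilityMeasure ω⟩) :=
    ProbabilityMeasure.tendsto_iff_forall_integral_tendsto.2 fun f => hω f
  have l2 := (ProbabilityMeasure.continuous_prod.tendsto _).comp (l1.prodMk_nhds l1)
  exact ProbabilityMeasure.limsup_measure_closed_le_of_tendsto l2 hD

/-- Under weak asymptotic stability the statistical equilibrium has atoms with positive
probability: two independent points with law `ρ` lie in `U` with probability `(ρ U) ^ 2`, and then
the flow brings them together with probability at least `P M`, asymptotically. -/
theorem IsStatisticalEquilibrium.lintegral_coincidence_pos (hR : R.WeaklyComplete)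
    (hμ : R.IsStatisticalEquilibrium ρ μ) {U : Set E} (hU : R.WeaklyAsymptoticallyStableOn U)
    (hρU : 0 < ρ U) : 0 < ∫⁻ ω, coincidence (μ ω) ∂P := by
  obtain ⟨x₀⟩ : Nonempty E := nonempty_of_isProbabilityMeasure ρ
  obtain ⟨hUo, -, t, M, -, ht, hM, hPM, hst⟩ := hU
  have hprob := hμ.isProbabilityMeasure
  have hD : ∀ r : ℝ, IsClosed {p : E × E | dist p.1 p.2 ≤ r} := fun r =>
    isClosed_le continuous_dist continuous_const
  have hprodm := measurable_prod_self hμ.measurable' hμ.measure_univ_le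
  have key : ∀ r : ℝ, 0 < r →
      P M * (ρ U * ρ U) ≤ ∫⁻ ω, ((μ ω).prod (μ ω)) {p | dist p.1 p.2 ≤ r} ∂P := by
    intro r hr
    have hlim : Tendsto (fun n => ∫⁻ p in U ×ˢ U, (P M - P {ω | ω ∈ M ∧
        r < dist (R.flow x₀ (t n) ω p.1) (R.flow x₀ (t n) ω p.2)}) ∂ρ.prod ρ) atTop
        (𝓝 (∫⁻ _ in U ×ˢ U, P M ∂ρ.prod ρ)) := by
      refine tendsto_lintegral_of_dominated_convergence (fun _ => P M) (fun n => ?_)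
        (fun n => Eventually.of_forall fun p => tsub_le_self) (by
          rw [lintegral_const]
          exact ENNReal.mul_ne_top (measure_ne_top _ _) (measure_ne_top _ _)) ?_
      · have hs : MeasurableSet {q : Ω × (E × E) | q.1 ∈ M ∧
            r < dist (R.flow x₀ (t n) q.1 q.2.1) (R.flow x₀ (t n) q.1 q.2.2)} := by
          refine (measurable_fst hM).inter (measurableSet_lt measurable_const
            (Measurable.dist ?_ ?_))
          · exact (R.measurable_flow_uncurry x₀ (t n)).comp
              (measurable_fst.prodMk (measurable_fst.comp measurable_snd))
          · exact (R.measurable_flow_uncurry x₀ (t n)).comp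
              (measurable_fst.prodMk (measurable_snd.comp measurable_snd))
        have := measurable_measure_prodMk_right (μ := P) hs
        exact measurable_const.sub this
      · refine (ae_restrict_iff' (hUo.prod hUo).measurableSet).2
          (Eventually.of_forall fun p hp => ?_)
        have h0 : Tendsto (fun n => P {ω | ω ∈ M ∧
            r < dist (R.flow x₀ (t n) ω p.1) (R.flow x₀ (t n) ω p.2)}) atTop (𝓝 0) :=
          tendsto_of_tendsto_of_tendsto_of_le_of_le tendsto_const_nhds
            (hst p.1 hp.1 p.2 hp.2 (ENNReal.ofReal r) (ENNReal.ofReal_pos.2 hr))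
            (fun _ => zero_le)
            fun n => measure_mono fun ω hω => ⟨hω.1, le_extEDist_of_lt_dist x₀ hω.2⟩
        simpa using ENNReal.Tendsto.sub (tendsto_const_nhds (x := P M)) h0
          (Or.inl (measure_ne_top _ _))
    rw [setLIntegral_const, Measure.prod_prod] at hlim
    have hmeas : ∀ n, Measurable fun ω =>
        ((R.pullbackLaw x₀ ρ (t n) ω).prod (R.pullbackLaw x₀ ρ (t n) ω))
          {p | dist p.1 p.2 ≤ r} := fun n =>
      (Measure.measurable_coe (hD r).measurableSet).comp
        (measurable_prod_self (R.measurable_pullbackLaw x₀ ρ (t n)) fun ω => by simp)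
    calc P M * (ρ U * ρ U)
        ≤ limsup (fun n => ∫⁻ ω, ((R.pullbackLaw x₀ ρ (t n) ω).prod
            (R.pullbackLaw x₀ ρ (t n) ω)) {p | dist p.1 p.2 ≤ r} ∂P) atTop := by
          rw [← hlim.limsup_eq]
          exact limsup_le_limsup (Eventually.of_forall fun n =>
            le_lintegral_prod_pullbackLaw x₀ M (U ×ˢ U) (t n) r)
      _ ≤ ∫⁻ ω, limsup (fun n => ((R.pullbackLaw x₀ ρ (t n) ω).prod
            (R.pullbackLaw x₀ ρ (t n) ω)) {p | dist p.1 p.2 ≤ r}) atTop ∂P :=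
          limsup_lintegral_le (fun _ => 1) hmeas
            (fun n => Eventually.of_forall fun ω => prob_le_one) (by simp)
      _ ≤ _ := lintegral_mono_ae (hμ.limsup_prod_pullbackLaw_le x₀ hR ht (hD r))
  have hlim : Tendsto (fun n : ℕ => ∫⁻ ω, ((μ ω).prod (μ ω))
      {p | dist p.1 p.2 ≤ 1 / ((n : ℝ) + 1)} ∂P) atTop (𝓝 (∫⁻ ω, coincidence (μ ω) ∂P)) := by
    refine tendsto_lintegral_of_dominated_convergence (fun _ => 1)
      (fun n => (Measure.measurable_coe (hD _).measurableSet).comp hprodm)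
      (fun n => Eventually.of_forall fun ω => prob_le_one) (by simp)
      (Eventually.of_forall fun ω => ?_)
    have h := tendsto_measure_iInter_atTop (μ := (μ ω).prod (μ ω))
      (s := fun n : ℕ => {p : E × E | dist p.1 p.2 ≤ 1 / ((n : ℝ) + 1)})
      (fun n => (hD _).measurableSet.nullMeasurableSet)
      (fun m n hmn p (hp : dist p.1 p.2 ≤ _) => hp.trans (Nat.one_div_le_one_div hmn))
      ⟨0, measure_ne_top _ _⟩
    have e : ⋂ n : ℕ, {p : E × E | dist p.1 p.2 ≤ 1 / ((n : ℝ) + 1)} = diagonal E := by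
      ext p
      simp only [mem_iInter, mem_ofPred_eq, mem_diagonal_iff]
      refine ⟨fun hp => dist_le_zero.1 (ge_of_tendsto' tendsto_one_div_add_atTop_nhds_zero_nat hp),
        fun hp n => ?_⟩
      rw [hp, dist_self]
      positivity
    rw [e] at h
    rw [coincidence_eq_prod_diagonal]
    exact h
  refine lt_of_lt_of_le ?_ (ge_of_tendsto' hlim fun n => key _ (by positivity))
  exact ENNReal.mul_pos hPM.ne' (ENNReal.mul_pos hρU.ne' hρU.ne').ne'

/-- The flow does not merge atoms of the statistical equilibrium, as it preserves the mean of the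
coincidence probability. Hence it transports the part carried by the heavy atoms. -/
theorem IsStatisticalEquilibrium.map_flow_restrict_heavyAtoms (hR : R.WeaklyComplete)
    (hμ : R.IsStatisticalEquilibrium ρ μ) (t : ℝ≥0)
    (hne : ∀ᵐ ω ∂P, ∀ x ∈ (μ ω).support, R.φ t ω x ≠ none) (c : ℝ≥0∞) :
    ∀ᵐ ω ∂P, ((μ ω).restrict (heavyAtoms (μ ω) c)).map (R.flow x₀ t ω)
      = (μ (R.θ t ω)).restrict (heavyAtoms (μ (R.θ t ω)) c) := by
  have hprob := hμ.isProbabilityMeasure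
  have hJ : Measurable fun ω => coincidence (μ ω) :=
    measurable_coincidence hμ.measurable' hμ.measure_univ_le
  have hmap := hμ.map_flow_eq x₀ hR t hne
  have hmp := R.measurePreserving_θ t
  have hle : ∀ᵐ ω ∂P, coincidence (μ ω) ≤ coincidence (μ (R.θ t ω)) := by
    filter_upwards [hmap] with ω hω
    rw [← hω]
    exact coincidence_le_map _ (R.measurable_flow_right x₀ t ω)
  have hfin : ∫⁻ ω, coincidence (μ ω) ∂P ≠ ⊤ := by
    refine ((lintegral_mono fun ω => ?_).trans_lt (by simp : ∫⁻ _, 1 ∂P < ⊤)).ne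
    rw [coincidence_eq_prod_diagonal]
    exact prob_le_one
  have heq := ae_eq_of_ae_le_of_lintegral_le hle hfin (hJ.comp hmp.measurable).aemeasurable
    (hmp.lintegral_comp hJ).le
  filter_upwards [hmap, heq] with ω h1 h2
  rw [← h1] at h2 ⊢
  exact map_restrict_heavyAtoms _ (R.measurable_flow_right x₀ t ω)
    (ae_map_singleton_eq _ (R.measurable_flow_right x₀ t ω) h2.ge) c

/-- If the part of the statistical equilibrium carried by its heavy atoms does not vanish, then it
is all of it, as it is transported by the flow and hence a multiple of the statistical
equilibrium. -/
theorem IsStatisticalEquilibrium.measure_compl_heavyAtoms (hR : R.WeaklyComplete)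
    (hρ : R.IsInvariantMeasure ρ) (hmix : R.StronglyMixing ρ) (hμ : R.IsStatisticalEquilibrium ρ μ)
    (hne : ∀ t : ℝ≥0, ∀ᵐ ω ∂P, ∀ x ∈ (μ ω).support, R.φ t ω x ≠ none)
    (hpos : 0 < ∫⁻ ω, coincidence (μ ω) ∂P) :
    ∃ k : ℕ, 0 < k ∧ ∀ᵐ ω ∂P, μ ω (heavyAtoms (μ ω) (k : ℝ≥0∞)⁻¹)ᶜ = 0 := by
  obtain ⟨x₀⟩ : Nonempty E := nonempty_of_isProbabilityMeasure ρ
  have hprob := hμ.isProbabilityMeasure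
  have hm : ∀ c, Measurable[R.past 0] fun ω => (μ ω).restrict (heavyAtoms (μ ω) c) :=
    fun c =>
    measurable_restrict_heavyAtoms hμ.measurable (fun ω => inferInstance) c
  have hm0 : ∀ c, Measurable fun ω => (μ ω).restrict (heavyAtoms (μ ω) c) := fun c =>
    (hm c).mono (R.past_le 0) le_rfl
  obtain ⟨k, hk⟩ : ∃ k : ℕ, (P.bind fun ω => (μ ω).restrict
      (heavyAtoms (μ ω) ((k + 1 : ℕ) : ℝ≥0∞)⁻¹)) univ ≠ 0 := by
    by_contra! hcon
    refine hpos.ne' ?_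
    have h0 : ∀ᵐ ω ∂P, ∀ k : ℕ, μ ω (heavyAtoms (μ ω) ((k + 1 : ℕ) : ℝ≥0∞)⁻¹) = 0 := by
      refine ae_all_iff.2 fun k => ?_
      have h1 := hcon k
      have h2 : Measurable fun ω =>
          (μ ω).restrict (heavyAtoms (μ ω) ((k + 1 : ℕ) : ℝ≥0∞)⁻¹) univ :=
        (Measure.measurable_coe MeasurableSet.univ).comp (hm0 _)
      rw [Measure.bind_apply MeasurableSet.univ (hm0 _).aemeasurable,
        lintegral_eq_zero_iff h2] at h1
      filter_upwards [h1] with ω hω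
      simpa using hω
    rw [lintegral_eq_zero_iff (measurable_coincidence hμ.measurable' hμ.measure_univ_le)]
    filter_upwards [h0] with ω hω
    refine (lintegral_eq_zero_iff (measurable_apply_singleton (μ ω))).2 ?_
    filter_upwards [ae_all_iff.2 fun k => measure_eq_zero_iff_ae_notMem.1 (hω k)] with x hx
    by_contra hne
    obtain ⟨n, hn⟩ := ENNReal.exists_inv_nat_lt hne
    refine hx n (le_trans (ENNReal.inv_le_inv.2 ?_) hn.le)
    exact_mod_cast Nat.le_succ n
  have hu := hμ.eq_smul_of_map_flow_eq x₀ hR hρ hmix (hm ((k + 1 : ℕ) : ℝ≥0∞)⁻¹)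
    (fun ω => (Measure.restrict_apply_le _ _).trans (hμ.measure_univ_le ω))
    (fun s => by
      filter_upwards [hne s] with ω hω
      refine ae_restrict_of_ae ?_
      filter_upwards [Measure.support_mem_ae (μ := μ ω)] with x hx
      exact hω x hx)
    (fun s => hμ.map_flow_restrict_heavyAtoms x₀ hR s (hne s) _)
  refine ⟨k + 1, k.succ_pos, ?_⟩
  filter_upwards [hu] with ω hω
  -- The two measures are compared on the complement of the heavy atoms.
  have h := congrArg (fun ν : Measure E => ν (heavyAtoms (μ ω) ((k + 1 : ℕ) : ℝ≥0∞)⁻¹)ᶜ) hω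
  simp only [Measure.smul_apply, smul_eq_mul] at h
  rw [Measure.restrict_apply (measurableSet_heavyAtoms _ _).compl, compl_inter_self,
    measure_empty] at h
  exact (mul_eq_zero.1 h.symm).resolve_left hk

end WhiteNoiseLocalRDS

/-! ### Measurable enumeration of the atoms -/

/-- The lower quantile of level `u` of a probability measure on the line. It is only meaningful
for `0 < u < 1`. -/
def quantile (κ : Measure ℝ) (u : ℝ) : ℝ := sInf {v | u ≤ cdf κ v}

theorem quantile_le_iff (κ : Measure ℝ) {u : ℝ} (h0 : 0 < u) (h1 : u < 1) (v : ℝ) :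
    quantile κ u ≤ v ↔ u ≤ cdf κ v := by
  have hbdd : BddBelow {v | u ≤ cdf κ v} := by
    obtain ⟨w, hw⟩ := ((tendsto_cdf_atBot κ).eventually_lt_const h0).exists
    exact ⟨w, fun v hv => le_of_not_gt fun hvw =>
      absurd (hv.trans (monotone_cdf κ hvw.le)) (not_le.2 hw)⟩
  have hne : {v | u ≤ cdf κ v}.Nonempty :=
    ((tendsto_cdf_atTop κ).eventually_const_le h1).exists
  refine ⟨fun h => ?_, fun h => csInf_le hbdd h⟩
  have hlim : Tendsto (cdf κ) (𝓝[>] v) (𝓝 (cdf κ v)) :=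
    ((cdf κ).right_continuous v).mono Ioi_subset_Ici_self
  refine ge_of_tendsto hlim ?_
  filter_upwards [self_mem_nhdsWithin] with w hw
  obtain ⟨z, hz, hzw⟩ := exists_lt_of_csInf_lt hne (h.trans_lt hw)
  exact le_trans hz (monotone_cdf κ hzw.le)

theorem measurable_quantile {α : Type*} {_ : MeasurableSpace α} {κ : α → Measure ℝ}
    (hκ : Measurable κ) (hκp : ∀ a, IsProbabilityMeasure (κ a)) {u : ℝ} (h0 : 0 < u) (h1 : u < 1) :
    Measurable fun a => quantile (κ a) u := by
  refine measurable_of_Iic fun v => ?_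
  have : (fun a => quantile (κ a) u) ⁻¹' Iic v = {a | u ≤ (κ a (Iic v)).toReal} := by
    ext a
    rw [mem_preimage, mem_Iic, quantile_le_iff _ h0 h1, cdf_eq_real]
    rfl
  rw [this]
  exact measurableSet_le measurable_const
    ((Measure.measurable_coe measurableSet_Iic).comp hκ).ennreal_toReal

/-- If a law on the line is carried by atoms of mass at least `1 / k`, then its distribution
function jumps by more than `1 / (k + 1)` at each atom, and so the quantiles of the
levels `i / (k + 1)` are exactly the atoms. -/
theorem heavyAtoms_eq_range_quantile (κ : Measure ℝ) [IsProbabilityMeasure κ] {k : ℕ} (hk : 0 < k)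
    (h : κ (heavyAtoms κ (k : ℝ≥0∞)⁻¹)ᶜ = 0) :
    heavyAtoms κ (k : ℝ≥0∞)⁻¹
      = range fun i : Fin k => quantile κ (((i : ℕ) + 1 : ℝ) / (k + 1)) := by
  have hk0 : (0 : ℝ) < k := by exact_mod_cast hk
  refine Subset.antisymm (fun x hx => ?_) ?_
  · set a := κ.real (Iio x) with ha
    have ha0 : 0 ≤ a := measureReal_nonneg
    have hx' : (k : ℝ)⁻¹ ≤ κ.real {x} := by
      have := ENNReal.toReal_mono (measure_ne_top κ {x}) hx
      rwa [ENNReal.toReal_inv, ENNReal.toReal_natCast] at this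
    have hb : cdf κ x = a + κ.real {x} := by
      rw [cdf_eq_real, ← Iio_union_right, measureReal_union (by simp) (measurableSet_singleton x)]
    have hb1 := cdf_le_one κ x
    have hinv : (k : ℝ) * (k : ℝ)⁻¹ = 1 := mul_inv_cancel₀ hk0.ne'
    have hinv0 : 0 < (k : ℝ)⁻¹ := inv_pos.2 hk0
    -- The least level `(i + 1) / (k + 1)` above the mass `a` to the left of `x`.
    set i := ⌊((k : ℝ) + 1) * a⌋₊ with hi
    have hi1 : (i : ℝ) ≤ (k + 1) * a := Nat.floor_le (by positivity)
    have hi2 : (k + 1) * a < (i : ℝ) + 1 := Nat.lt_floor_add_one _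
    have hik : i < k := by
      have : (i : ℝ) < k := by nlinarith
      exact_mod_cast this
    have hu0 : 0 < ((i : ℝ) + 1) / (k + 1) := by positivity
    have hua : a < ((i : ℝ) + 1) / (k + 1) := by
      rw [lt_div_iff₀ (by positivity)]
      linarith
    have hub : ((i : ℝ) + 1) / (k + 1) < cdf κ x := by
      rw [div_lt_iff₀ (by positivity)]
      nlinarith
    have hu1 := hub.trans_le hb1
    refine ⟨⟨i, hik⟩, le_antisymm ((quantile_le_iff κ hu0 hu1 x).2 hub.le) ?_⟩
    refine le_of_forall_lt fun v hv => lt_of_not_ge fun hcon => ?_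
    refine absurd ((quantile_le_iff κ hu0 hu1 v).1 hcon) (not_le.2 (lt_of_le_of_lt ?_ hua))
    rw [cdf_eq_real]
    exact measureReal_mono fun z hz => lt_of_le_of_lt hz hv
  · rintro _ ⟨i, rfl⟩
    have hu0 : 0 < ((i : ℕ) + 1 : ℝ) / (k + 1) := by positivity
    have hu1 : ((i : ℕ) + 1 : ℝ) / (k + 1) < 1 := by
      rw [div_lt_one (by positivity)]
      have : ((i : ℕ) : ℝ) < k := by exact_mod_cast i.2
      linarith
    set q := quantile κ (((i : ℕ) + 1 : ℝ) / (k + 1)) with hq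
    by_contra hqT
    have hT := finite_heavyAtoms κ (c := (k : ℝ≥0∞)⁻¹) (by simp)
    -- Otherwise the distribution function is constant on a left neighbourhood of the quantile.
    have hev : ∀ᶠ v in 𝓝[<] q, ∀ x ∈ heavyAtoms κ (k : ℝ≥0∞)⁻¹, (x ≤ v ↔ x ≤ q) := by
      refine (eventually_all_finite hT).2 fun x hx => ?_
      rcases lt_trichotomy x q with hxq | hxq | hxq
      · filter_upwards [mem_nhdsWithin_of_mem_nhds (Ioi_mem_nhds hxq)] with v hv
        exact iff_of_true (le_of_lt hv) hxq.le
      · exact absurd hx (hxq.symm ▸ hqT)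
      · filter_upwards [self_mem_nhdsWithin] with v hv
        exact iff_of_false (not_le.2 (lt_trans hv hxq)) (not_le.2 hxq)
    obtain ⟨v, hv, hvq⟩ := (hev.and self_mem_nhdsWithin).exists
    have heq : cdf κ v = cdf κ q := by
      rw [cdf_eq_real, cdf_eq_real]
      refine measureReal_congr ?_
      filter_upwards [measure_eq_zero_iff_ae_notMem.1 h] with x hx
      exact propext (hv x (not_not.1 hx))
    have h1 := (quantile_le_iff κ hu0 hu1 q).1 le_rfl
    rw [← heq] at h1
    exact absurd ((quantile_le_iff κ hu0 hu1 v).2 h1) (not_le.2 hvq)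

/-- A random probability measure carried by atoms of mass at least `1 / k` has a measurable
enumeration of its atoms: the quantiles of its image under a Borel embedding into the line. -/
theorem exists_measurable_enum_heavyAtoms {Ω E : Type*} {_ : MeasurableSpace Ω} [MeasurableSpace E]
    [StandardBorelSpace E] [Nonempty E] {μ : Ω → Measure E} (hμ : Measurable μ)
    (hμp : ∀ ω, IsProbabilityMeasure (μ ω)) {k : ℕ} (hk : 0 < k) :
    ∃ a : Fin k → Ω → E, (∀ i, Measurable (a i)) ∧
      ∀ ω, μ ω (heavyAtoms (μ ω) (k : ℝ≥0∞)⁻¹)ᶜ = 0 →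
        heavyAtoms (μ ω) (k : ℝ≥0∞)⁻¹ = range fun i => a i ω := by
  have he := measurableEmbedding_embeddingReal E
  set e := embeddingReal E
  obtain ⟨g, hg, hge⟩ := he.exists_measurable_extend measurable_id fun _ => inferInstance
  have hge' : ∀ x, g (e x) = x := fun x => congrFun hge x
  have hmp : ∀ ω, IsProbabilityMeasure ((μ ω).map e) := fun ω =>
    Measure.isProbabilityMeasure_map he.measurable.aemeasurable
  refine ⟨fun i ω => g (quantile ((μ ω).map e) (((i : ℕ) + 1 : ℝ) / (k + 1))), fun i => ?_,
    fun ω hω => ?_⟩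
  · refine hg.comp (measurable_quantile ((Measure.measurable_map _ he.measurable).comp hμ) hmp
      (by positivity) ?_)
    rw [div_lt_one (by positivity)]
    have : ((i : ℕ) : ℝ) < k := by exact_mod_cast i.2
    linarith
  · have hpre : e ⁻¹' heavyAtoms ((μ ω).map e) (k : ℝ≥0∞)⁻¹ = heavyAtoms (μ ω) (k : ℝ≥0∞)⁻¹ := by
      ext x
      change _ ≤ (μ ω).map e {e x} ↔ _ ≤ μ ω {x}
      rw [he.map_apply, ← image_singleton, preimage_image_eq _ he.injective]
    have hfull : (μ ω).map e (heavyAtoms ((μ ω).map e) (k : ℝ≥0∞)⁻¹)ᶜ = 0 := by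
      rw [he.map_apply, preimage_compl, hpre, hω]
    have hr := heavyAtoms_eq_range_quantile ((μ ω).map e) hk hfull
    refine Subset.antisymm (fun x hx => ?_) ?_
    · rw [← hpre, mem_preimage, hr] at hx
      obtain ⟨i, hi⟩ := hx
      exact ⟨i, (congrArg g hi).trans (hge' x)⟩
    · rintro _ ⟨i, rfl⟩
      have hi : quantile ((μ ω).map e) (((i : ℕ) + 1 : ℝ) / (k + 1))
          ∈ heavyAtoms ((μ ω).map e) (k : ℝ≥0∞)⁻¹ := by
        rw [hr]
        exact mem_range_self i
      -- A point charged by the image measure lies in the range of the embedding.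
      obtain ⟨x, hx⟩ : ∃ x, e x = quantile ((μ ω).map e) (((i : ℕ) + 1 : ℝ) / (k + 1)) := by
        by_contra! hcon
        have h0 : (μ ω).map e {quantile ((μ ω).map e) (((i : ℕ) + 1 : ℝ) / (k + 1))} = 0 := by
          rw [he.map_apply, preimage_singleton_eq_empty.2 (by rintro ⟨x, hx⟩; exact hcon x hx),
            measure_empty]
        have h1 : (k : ℝ≥0∞)⁻¹ ≤ 0 := h0 ▸ hi
        simp at h1
      rw [← hx, ← mem_preimage, hpre] at hi
      change g (quantile _ _) ∈ _
      rw [← hx, hge']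
      exact hi

end

theorem mainTheorem6
    {Ω : Type*} [MeasurableSpace Ω] (P : Measure Ω) [IsProbabilityMeasure P]
    {E : Type*} [MetricSpace E] [CompleteSpace E] [SecondCountableTopology E]
    [MeasurableSpace E] [BorelSpace E]
    (R : WhiteNoiseLocalRDS Ω P E) (hR : R.WeaklyComplete)
    (ρ : Measure E) [IsProbabilityMeasure ρ] (hρ : R.IsErgodicMeasure ρ) :
    -- the statistical equilibrium of `ρ` exists
    (∃ μ : Ω → Measure E, R.IsStatisticalEquilibrium ρ μ) ∧
    ∀ μ : Ω → Measure E, R.IsStatisticalEquilibrium ρ μ →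
      -- no trajectory started on the support explodes (automatic for a global system)
      (∀ t : ℝ≥0, ∀ᵐ ω ∂P, ∀ x ∈ (μ ω).support, R.φ t ω x ≠ none) →
      ((∀ᵐ ω ∂P, IsCompact (μ ω).support) →
        R.IsWeakPointAttractorOf (R.convergenceSet ρ) (fun ω => (μ ω).support) ∧
        (R.StronglyMixing ρ → R.IsMinimalWeakPointAttractor (fun ω => (μ ω).support))) ∧
      (R.StronglyMixing ρ →
        ∀ U : Set E, R.WeaklyAsymptoticallyStableOn U → 0 < ρ U →
          ∃ (N : ℕ) (a : Fin N → Ω → E), 0 < N ∧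
            (∀ i, Measurable[R.past 0] (a i)) ∧
            (∀ᵐ ω ∂P, (μ ω).support = Set.range fun i => a i ω) ∧
            R.IsMinimalWeakPointAttractor (fun ω => (μ ω).support)) := by
  refine ⟨hR.exists_isStatisticalEquilibrium hρ.1, fun μ hμ hne => ?_⟩
  have hattr := hμ.isWeakPointAttractorOf hR hρ.1 hne
  have hmin : R.StronglyMixing ρ → (∀ᵐ ω ∂P, IsCompact (μ ω).support) →
      R.IsMinimalWeakPointAttractor fun ω => (μ ω).support := by
    intro hmix hK
    refine ⟨?_, fun A hA => hμ.support_subset hR hA⟩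
    have h := hattr hK
    rwa [eq_univ_of_forall hmix] at h
  refine ⟨fun hK => ⟨hattr hK, fun hmix => hmin hmix hK⟩, fun hmix U hU hρU => ?_⟩
  have hprob := hμ.isProbabilityMeasure
  have : Nonempty E := nonempty_of_isProbabilityMeasure ρ
  obtain ⟨k, hk, hatoms⟩ := hμ.measure_compl_heavyAtoms hR hρ.1 hmix hne
    (hμ.lintegral_coincidence_pos hR hU hρU)
  obtain ⟨a, ha, hrange⟩ := exists_measurable_enum_heavyAtoms hμ.measurable hprob hk
  have hsupp : ∀ᵐ ω ∂P, (μ ω).support = heavyAtoms (μ ω) (k : ℝ≥0∞)⁻¹ := by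
    filter_upwards [hatoms] with ω hω
    exact support_eq_heavyAtoms (by simp) hω
  refine ⟨k, a, hk, ha, ?_, hmin hmix ?_⟩
  · filter_upwards [hatoms, hsupp] with ω h1 h2
    rw [h2, hrange ω h1]
  · filter_upwards [hsupp] with ω h
    rw [h]
    exact (finite_heavyAtoms _ (by simp)).isCompact
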